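/- Conventions. $\mathrm{HF}$ is the set of hereditarily finite sets, identified with $\mathbb N$ by the Ackermann coding. A structured graph is a graph $G$ (symmetric, irreflexive adjacency) with finitely many additional relations on $V(G)$; graphs are locally finite, $\rho_G$ is the path metric, $G\upharpoonright W$ the induced substructure on $W$, and $G^r$ joins distinct vertices $x,y$ with $\rho_G(x,y)\le r$. A coloring problem $(\Pi,\Gamma)$ is a class $\Gamma$ of structured graphs together with a class $\Pi$ of functions $V(G)\to\mathrm{HF}$, $G\in\Gamma$, both closed under isomorphism and such that membership holds if and only if it holds on every connected component. Let $s\in\mathbb N$. An ASI-$s$ algorithm is a function $\mathcal A$ assigning to each input $\mathcal H=(H,<,U_0,\dots,U_s,C)$, where $H$ is a finite structured graph, $<$ a linear order on $V(H)$, $U_0,\dots,U_s$ a partition of $V(H)$ (parts may be empty) and $C\subseteq V(H)$, a coloring $\mathcal A(\mathcal H):C\to\mathrm{HF}$, such that $\mathcal A(\mathcal H)=\mathcal A(\mathcal H')\circ(\varphi\upharpoonright C)$ for every isomorphism $\varphi:\mathcal H\to\mathcal H'$. It is computable if the coloring is computable from (a finite code of) the canonical copy of $\mathcal H$ with vertices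 $0<1<\dots<m-1$. Let $r,n\in\mathbb N$ and let $\mathcal G=(G,<,U_0,\dots,U_s)$, where $G$ is a (possibly infinite) locally finite structured graph, $<$ is a linear order on $V(G)$, and $U_0,\dots,U_s$ is a partition of $V(G)$ such that every connected component of each $G^r\upharpoonright U_i$ is finite. Let $\mathcal C$ be the set of all these components, and let $\tilde G$ be the graph on $\mathcal C$ joining $C\ne D$ when $\rho_G(C,D)\le r$. The coloring $\mathcal A_n[\mathcal G]:V(G)\to\mathrm{HF}$ is given on each $C\in\mathcal C$ by $\mathcal A(G\upharpoonright W,<\upharpoonright W,U_0\cap W,\dots,U_s\cap W,C)$, where $W=\bigcup\{D\in\mathcal C:\rho_{\tilde G}(C,D)\le n\}$ (a finite set). $\mathcal A$ solves $(\Pi,\Gamma)$ in $n$ stages with scale $r$ if $\mathcal A_n[\mathcal G]\in\Pi$ for all such $\mathcal G$ with $G\in\Gamma$. The class $\mathrm{ASI}_c(s)$ consists of the coloring problems that are solved by some computable ASI-$s$ algorithm, for some $n$ and some $r$. A loopless multigraph of edge multiplicity at most $p$ is regarded as a structured graph with $p$ additional binary relations $E_0,\dots,E_{p-1}$: vertices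 are adjacent when they are joined by at least one edge, and for adjacent $x,y$, $E_j(x,y)$ holds if and only if there are more than $j$ edges between $x$ and $y$ (the values of $E_j$ at non-adjacent pairs are irrelevant). A proper edge coloring gives different colors to different edges with a common vertex (in particular to parallel edges). It is expressed by a vertex coloring $V(G)\to\mathrm{HF}$ in which each vertex $x$ receives a pair consisting of a name of $x$ and a finite list, such that different neighbors of any vertex have different names and the list at $x$ consists exactly of the pairs (name of $y$, color of $e$) for the edges $e$ between $x$ and a neighbor $y$. Theorem. Let $k,p,s\in\mathbb N$. Let $\Gamma$ be the class of $k$-edge-colorable multigraphs with edge multiplicity at most $p$, and let $\Pi$ be the problem of proper edge coloring with $k+ps$ colors. Then $(\Pi,\Gamma)\in\mathrm{ASI}_c(s)$. -/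

import Mathlib

universe u

namespace ASI

/-! ### Structured graphs -/

/-- A finite relational language extending the language of graphs: the additional relation
symbols are numbered by `Fin numRel`, each with an arity. -/
structure Signature where
  numRel : ℕ
  arity : Fin numRel → ℕ

/-- A structured graph on the vertex set `V`: a graph with additional relations. -/
structure StructuredGraph (σ : Signature) (V : Type u) where
  graph : SimpleGraph V
  rel : (i : Fin σ.numRel) → (Fin (σ.arity i) → V) → Prop

namespace StructuredGraph

variable {σ : Signature} {V V' : Type u}

/-- The restriction of a structured graph to a set of vertices. -/
def induce (G : StructuredGraph σ V) (W : Set V) : StructuredGraph σ W where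
  graph := G.graph.induce W
  rel i t := G.rel i fun a => (t a : V)

/-- Isomorphisms of structured graphs. -/
structure Iso (G : StructuredGraph σ V) (G' : StructuredGraph σ V') extends V ≃ V' where
  adj_iff : ∀ x y, G.graph.Adj x y ↔ G'.graph.Adj (toEquiv x) (toEquiv y)
  rel_iff : ∀ i t, G.rel i t ↔ G'.rel i (fun a => toEquiv (t a))

/-- Every vertex has finitely many neighbors. -/
def LocFinite (G : StructuredGraph σ V) : Prop :=
  ∀ x, (G.graph.neighborSet x).Finite

end StructuredGraph

/-- The hereditarily finite sets, identified with the natural numbers by the Ackermann coding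
(`a` is an element of `b` when the binary digit of `b` at position `a` is `1`). -/
abbrev HF : Type := ℕ

/-- A coloring problem: a class `Γ` of structured graphs and a class `Π` of colorings of the
vertices of graphs in `Γ` by hereditarily finite sets, both invariant under isomorphism and both
determined by the connected components. -/
structure ColoringProblem (σ : Signature) where
  /-- The class of graphs. -/
  Gam : ∀ {V : Type u}, StructuredGraph σ V → Prop
  /-- The class of admissible colorings of a graph in the class `Gam`. -/
  Pi : ∀ {V : Type u}, StructuredGraph σ V → (V → HF) → Prop
  gam_iso : ∀ {V V' : Type u} {G : StructuredGraph σ V} {G' : StructuredGraph σ V'},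
    G.Iso G' → Gam G → Gam G'
  gam_components : ∀ {V : Type u} (G : StructuredGraph σ V),
    Gam G ↔ ∀ K : G.graph.ConnectedComponent, Gam (G.induce K.supp)
  pi_iso : ∀ {V V' : Type u} {G : StructuredGraph σ V} {G' : StructuredGraph σ V'}
    (φ : G.Iso G') (c : V → HF), Gam G → Pi G c → Pi G' (c ∘ φ.toEquiv.symm)
  pi_components : ∀ {V : Type u} (G : StructuredGraph σ V) (c : V → HF), Gam G →
    (Pi G c ↔ ∀ K : G.graph.ConnectedComponent, Pi (G.induce K.supp) (fun x => c x))

/-! ### ASI algorithms -/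

/-- The inputs `(H, <, U₀, …, U_s, C)` of an ASI-`s` algorithm with vertex set `V`; the partition
`U₀, …, U_s` (parts may be empty) is given by the function sending a vertex to the index of its
part. -/
structure Input (σ : Signature) (s : ℕ) (V : Type u) where
  graph : StructuredGraph σ V
  order : LinearOrder V
  part : V → Fin (s + 1)
  target : Set V

/-- Isomorphisms of inputs. -/
structure Input.Iso {σ : Signature} {s : ℕ} {V V' : Type u}
    (I : Input σ s V) (I' : Input σ s V') extends I.graph.Iso I'.graph where
  le_iff : ∀ x y, I.order.le x y ↔ I'.order.le (toEquiv x) (toEquiv y)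
  part_eq : ∀ x, I.part x = I'.part (toEquiv x)
  target_iff : ∀ x, x ∈ I.target ↔ toEquiv x ∈ I'.target

/-- An ASI-`s` algorithm: an isomorphism-invariant assignment to each finite input
`(H, <, U₀, …, U_s, C)` of a coloring `C → HF`. -/
structure Algorithm (σ : Signature) (s : ℕ) where
  run : ∀ {V : Type u} [Finite V] (I : Input σ s V), I.target → HF
  run_iso : ∀ {V V' : Type u} [Finite V] [Finite V'] (I : Input σ s V) (I' : Input σ s V')
    (φ : I.Iso I') (x : I.target),
    run I x = run I' ⟨φ.toEquiv x, (φ.target_iff x).1 x.2⟩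

/-- Finite presentations of inputs with vertex set `{0, …, m - 1}` and the usual order:
the number `m`, a list of the adjacent pairs, a list of the additional relations that hold
(the number of the relation symbol together with a tuple of vertices), the list of the part
indices of `0, …, m - 1`, and a list of the elements of the target set. -/
abbrev Code : Type :=
  ℕ × List (ℕ × ℕ) × List (ℕ × List ℕ) × List ℕ × List ℕ

/-- `code` is a presentation of the input `I`, when vertices are numbered by `e`. -/
structure Presents {σ : Signature} {s : ℕ} {V : Type u} (I : Input σ s V) {m : ℕ}
    (e : V ≃ Fin m) (code : Code) : Prop where
  card : code.1 = m
  adj : ∀ a b, (a, b) ∈ code.2.1 ↔ ∃ x y, I.graph.graph.Adj x y ∧ (e x : ℕ) = a ∧ (e y : ℕ) = b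
  rel : ∀ i l, (i, l) ∈ code.2.2.1 ↔ ∃ (j : Fin σ.numRel) (t : Fin (σ.arity j) → V),
    I.graph.rel j t ∧ (j : ℕ) = i ∧ List.ofFn (fun a => (e (t a) : ℕ)) = l
  part : code.2.2.2.1 = List.ofFn fun a : Fin m => (I.part (e.symm a) : ℕ)
  target : ∀ a, a ∈ code.2.2.2.2 ↔ ∃ x ∈ I.target, (e x : ℕ) = a

/-- An algorithm is computable if the coloring it returns can be computed from a presentation of
the canonical copy of the input, in which the vertices are replaced by `0, …, m - 1` in increasing
order. -/
def Algorithm.IsComputable {σ : Signature} {s : ℕ} (A : Algorithm.{u} σ s) : Prop :=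
  ∃ f : Code → ℕ → HF, Computable₂ f ∧
    ∀ {V : Type u} [Finite V] (I : Input σ s V) (m : ℕ) (e : V ≃ Fin m),
      (∀ x y, I.order.le x y ↔ e x ≤ e y) →
      ∀ code : Code, Presents I e code →
        ∀ x : I.target, A.run I x = f code (e x)

/-! ### Running an algorithm -/

section Run

variable {σ : Signature} {V : Type u} {s : ℕ}

/-- The disjoint union over `i` of the graphs `G^r ↾ U_i`: distinct vertices in the same part are
adjacent if their distance in `G` is at most `r`. -/
def pieceGraph (G : SimpleGraph V) (part : V → Fin (s + 1)) (r : ℕ) : SimpleGraph V where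
  Adj x y := x ≠ y ∧ part x = part y ∧ G.edist x y ≤ r
  symm := ⟨fun _ _ h => ⟨h.1.symm, h.2.1.symm, by rw [SimpleGraph.edist_comm]; exact h.2.2⟩⟩
  loopless := ⟨fun _ h => h.1 rfl⟩

/-- The set `𝒞` of all connected components of the graphs `G^r ↾ U_i`. -/
abbrev Piece (G : SimpleGraph V) (part : V → Fin (s + 1)) (r : ℕ) : Type u :=
  (pieceGraph G part r).ConnectedComponent

/-- The parts given by `part` form an ASI-`s` witness for `G` with scale `r`: the graphs
`G^r ↾ U_i` have only finite components. -/
def IsWitness (G : SimpleGraph V) (part : V → Fin (s + 1)) (r : ℕ) : Prop :=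
  ∀ C : Piece G part r, C.supp.Finite

/-- The graph on `𝒞` in which different pieces are adjacent if their distance in `G` is at
most `r`. -/
def tildeGraph (G : SimpleGraph V) (part : V → Fin (s + 1)) (r : ℕ) :
    SimpleGraph (Piece G part r) where
  Adj C D := C ≠ D ∧ ∃ x ∈ C.supp, ∃ y ∈ D.supp, G.edist x y ≤ r
  symm := ⟨fun _ _ h => ⟨h.1.symm, by
    obtain ⟨x, hx, y, hy, hxy⟩ := h.2
    exact ⟨y, hy, x, hx, by rw [SimpleGraph.edist_comm]; exact hxy⟩⟩⟩
  loopless := ⟨fun _ h => h.1 rfl⟩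

/-- The union `W` of all pieces at distance at most `n` from the piece `C` in the graph on `𝒞`. -/
def window (G : SimpleGraph V) (part : V → Fin (s + 1)) (r n : ℕ) (C : Piece G part r) : Set V :=
  {x | (tildeGraph G part r).edist C ((pieceGraph G part r).connectedComponentMk x) ≤ n}

theorem finite_ball {α : Type*} (H : SimpleGraph α) (hH : ∀ x, (H.neighborSet x).Finite)
    (x : α) (n : ℕ) : {y | H.edist x y ≤ n}.Finite := by
  induction n with
  | zero =>
    refine (Set.finite_singleton x).subset fun y hy => ?_
    have h : H.edist x y = 0 := nonpos_iff_eq_zero.1 (by exact_mod_cast hy)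
    exact (SimpleGraph.edist_eq_zero_iff.1 h).symm
  | succ n ih =>
    refine (ih.union (ih.biUnion fun z _ => hH z)).subset fun y hy => ?_
    have hne : H.edist x y ≠ ⊤ := fun h => by
      rw [Set.mem_ofPred_eq, h] at hy
      exact absurd (top_le_iff.1 hy) (ENat.natCast_ne_top _)
    obtain ⟨w, hw⟩ := (SimpleGraph.reachable_of_edist_ne_top hne).exists_walk_length_eq_edist
    have hlen : w.length ≤ n + 1 := by
      rw [Set.mem_ofPred_eq, ← hw] at hy
      exact_mod_cast hy
    by_cases hn : w.Nil
    · left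
      have hxy := hn.eq
      subst hxy
      simp
    · right
      have h1 := w.dropLast.edist_le
      refine Set.mem_biUnion (x := w.penultimate) ?_ (w.adj_penultimate hn)
      refine h1.trans ?_
      have : w.dropLast.length ≤ n := by
        rw [SimpleGraph.Walk.length_dropLast]; omega
      exact_mod_cast this

theorem finite_window (G : SimpleGraph V) (hG : ∀ x, (G.neighborSet x).Finite)
    (part : V → Fin (s + 1)) (r n : ℕ) (hU : IsWitness G part r) (C : Piece G part r) :
    (window G part r n C).Finite := by
  have hloc : ∀ D, ((tildeGraph G part r).neighborSet D).Finite := by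
    intro D
    refine (((hU D).biUnion fun x _ => finite_ball G hG x r).image
      (pieceGraph G part r).connectedComponentMk).subset ?_
    rintro E ⟨-, x, hx, y, hy, hxy⟩
    exact ⟨y, Set.mem_biUnion hx hxy, hy⟩
  refine ((finite_ball _ hloc C n).biUnion fun D _ => hU D).subset fun x hx => ?_
  exact Set.mem_biUnion (x := (pieceGraph G part r).connectedComponentMk x) hx rfl

/-- The input that the piece `C` sees: the restriction of `(G, <, U₀, …, U_s)` to the window
around `C`, together with `C` itself. -/
def localInput (G : StructuredGraph σ V) (ord : LinearOrder V) (part : V → Fin (s + 1))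
    (r n : ℕ) (C : Piece G.graph part r) : Input σ s (window G.graph part r n C) where
  graph := G.induce _
  order := Subtype.instLinearOrder _
  part x := part x
  target := {x | (x : V) ∈ C.supp}

/-- The coloring `A_n[𝒢]` of the vertices of `G`, for `𝒢 = (G, <, U₀, …, U_s)`. -/
noncomputable def Algorithm.apply (A : Algorithm.{u} σ s) (n r : ℕ) (G : StructuredGraph σ V)
    (hG : G.LocFinite) (ord : LinearOrder V) (part : V → Fin (s + 1))
    (hU : IsWitness G.graph part r) (x : V) : HF :=
  let C : Piece G.graph part r := (pieceGraph G.graph part r).connectedComponentMk x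
  haveI : Finite (window G.graph part r n C) := finite_window G.graph hG part r n hU C
  A.run (localInput G ord part r n C) ⟨⟨x, by simp [window, C]⟩, rfl⟩

/-- The algorithm `A` solves the coloring problem `P` in `n` stages with scale `r`. -/
def Algorithm.Solves (A : Algorithm.{u} σ s) (P : ColoringProblem.{u} σ) (n r : ℕ) : Prop :=
  ∀ {V : Type u} (G : StructuredGraph σ V) (hG : G.LocFinite) (ord : LinearOrder V)
    (part : V → Fin (s + 1)) (hU : IsWitness G.graph part r),
    P.Gam G → P.Pi G (A.apply n r G hG ord part hU)

/-- The coloring problem `P` is in the class `ASI_c(s)`: it is solved by a computable ASI-`s`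
algorithm, for some number of stages and some scale. -/
def MemASIc (s : ℕ) (P : ColoringProblem.{u} σ) : Prop :=
  ∃ A : Algorithm.{u} σ s, A.IsComputable ∧ ∃ n r : ℕ, A.Solves P n r

end Run

/-! ### Edge colorings of multigraphs -/

/-- A loopless multigraph on `V`, given by the number of edges between any two vertices. The edges
between `x` and `y` are numbered by the `j < mult x y`. -/
@[ext] structure Multigraph (V : Type u) where
  mult : V → V → ℕ
  symm : ∀ x y, mult x y = mult y x
  loopless : ∀ x, mult x x = 0

namespace Multigraph

variable {V : Type u}

/-- `χ` is a proper edge coloring of `M` with colors `0, …, K - 1`, where `χ x y j` is the color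
of the edge with number `j` between `x` and `y`: different edges with a common vertex have
different colors. -/
structure IsProperEdgeColoring (M : Multigraph V) (K : ℕ) (χ : V → V → ℕ → ℕ) : Prop where
  lt : ∀ x y j, j < M.mult x y → χ x y j < K
  symm : ∀ x y j, j < M.mult x y → χ x y j = χ y x j
  proper : ∀ x y j y' j', j < M.mult x y → j' < M.mult x y' → (y, j) ≠ (y', j') →
    χ x y j ≠ χ x y' j'

/-- `M` has a proper edge coloring with `K` colors. -/
def EdgeColorable (M : Multigraph V) (K : ℕ) : Prop :=
  ∃ χ, M.IsProperEdgeColoring K χ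

/-- The restriction of a multigraph to a set of vertices. -/
def induce (M : Multigraph V) (W : Set V) : Multigraph W where
  mult x y := M.mult x y
  symm x y := M.symm x y
  loopless x := M.loopless x

end Multigraph

/-- The language of multigraphs with edge multiplicity at most `p`: besides adjacency, there are
`p` binary relation symbols. -/
def multigraphSignature (p : ℕ) : Signature where
  numRel := p
  arity _ := 2

/-- `G` is the multigraph `M`, of edge multiplicity at most `p`, regarded as a structured graph:
adjacent vertices are those joined by an edge, and the relation with number `j` holds between
adjacent vertices `x` and `y` when there are more than `j` edges between them. The values of the
relations at non-adjacent vertices are irrelevant, so that being a multigraph is determined by the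
connected components. -/
structure Represents {p : ℕ} {V : Type u} (G : StructuredGraph (multigraphSignature p) V)
    (M : Multigraph V) : Prop where
  mult_le : ∀ x y, M.mult x y ≤ p
  adj_iff : ∀ x y, G.graph.Adj x y ↔ 0 < M.mult x y
  rel_iff : ∀ (j : Fin p) (t : Fin 2 → V), G.graph.Adj (t 0) (t 1) →
    (G.rel j t ↔ (j : ℕ) < M.mult (t 0) (t 1))

/-- The standard bijection between colors and pairs `(a, l)`, where `a` is a number (serving as
the local name of a vertex) and `l` is a finite list of pairs (local name of a neighbor, edge
color). -/
def label (z : HF) : ℕ × List (ℕ × ℕ) :=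
  Denumerable.ofNat (ℕ × List (ℕ × ℕ)) z

/-- The vertex coloring `c` expresses the edge coloring `χ` of `M`: each vertex carries a local
name, different neighbors of a vertex having different names, and lists, for each neighbor, the
name of the neighbor with the colors of the edges to it. -/
structure Expresses {V : Type u} (M : Multigraph V) (χ : V → V → ℕ → ℕ) (c : V → HF) : Prop where
  name_ne : ∀ x y y', 0 < M.mult x y → 0 < M.mult x y' → y ≠ y' →
    (label (c y)).1 ≠ (label (c y')).1
  mem_iff : ∀ x b t, (b, t) ∈ (label (c x)).2 ↔
    ∃ y j, j < M.mult x y ∧ (label (c y)).1 = b ∧ χ x y j = t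

section EdgeLemmas

variable {p : ℕ} {V : Type u} {G : StructuredGraph (multigraphSignature p) V}

theorem Represents.unique {M N : Multigraph V} (hM : Represents G M) (hN : Represents G N) :
    M = N := by
  ext x y
  have h0 := (hM.adj_iff x y).symm.trans (hN.adj_iff x y)
  by_cases hadj : G.graph.Adj x y
  · have key : ∀ j < p, (j < M.mult x y ↔ j < N.mult x y) := fun j hj =>
      (hM.rel_iff ⟨j, hj⟩ ![x, y] hadj).symm.trans (hN.rel_iff ⟨j, hj⟩ ![x, y] hadj)
    have h1 := hM.mult_le x y
    have h2 := hN.mult_le x y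
    rcases lt_trichotomy (M.mult x y) (N.mult x y) with h | h | h
    · have := key (M.mult x y) (by omega)
      omega
    · exact h
    · have := key (N.mult x y) (by omega)
      omega
  · have h1 := mt (hM.adj_iff x y).2 hadj
    have h2 := mt (hN.adj_iff x y).2 hadj
    omega

theorem Represents.induce {M : Multigraph V} (hM : Represents G M) (W : Set V) :
    Represents (G.induce W) (M.induce W) where
  mult_le x y := hM.mult_le x y
  adj_iff x y := hM.adj_iff x y
  rel_iff j t h := hM.rel_iff j (fun a => (t a : V)) h

theorem Represents.component_eq {M : Multigraph V} (hM : Represents G M) {x y : V}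
    (h : 0 < M.mult x y) :
    G.graph.connectedComponentMk x = G.graph.connectedComponentMk y :=
  SimpleGraph.ConnectedComponent.sound ((hM.adj_iff x y).2 h).reachable

end EdgeLemmas

section Glue

variable {V : Type u} (H : SimpleGraph V)

/-- Glues colorings of the components of a graph together; edges between components (there are
none) get the color `0`. -/
noncomputable def glue {ι : Type*} [Zero ι]
    (χ : ∀ K : H.ConnectedComponent, K.supp → K.supp → ι) (x y : V) : ι :=
  open Classical in
  if h : H.connectedComponentMk x = H.connectedComponentMk y then
    χ (H.connectedComponentMk y) ⟨x, h⟩ ⟨y, rfl⟩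
  else 0

theorem glue_eq {ι : Type*} [Zero ι] (χ : ∀ K : H.ConnectedComponent, K.supp → K.supp → ι)
    (K : H.ConnectedComponent) (x y : K.supp) : glue H χ x y = χ K x y := by
  obtain ⟨x, hx⟩ := x
  obtain ⟨y, hy⟩ := y
  have hy' : H.connectedComponentMk y = K := hy
  subst hy'
  have hx' : H.connectedComponentMk x = H.connectedComponentMk y := hx
  simp [glue, hx']

theorem glue_of_eq {ι : Type*} [Zero ι] (χ : ∀ K : H.ConnectedComponent, K.supp → K.supp → ι)
    {x y : V} (h : H.connectedComponentMk x = H.connectedComponentMk y) :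
    glue H χ x y = χ (H.connectedComponentMk x) ⟨x, rfl⟩ ⟨y, h.symm⟩ :=
  glue_eq H χ (H.connectedComponentMk x) ⟨x, rfl⟩ ⟨y, h.symm⟩

end Glue

section EdgeLemmas

variable {p : ℕ} {V : Type u} {G : StructuredGraph (multigraphSignature p) V}

theorem glue_proper {M : Multigraph V} (hM : Represents G M) {K : ℕ}
    (χ : ∀ C : G.graph.ConnectedComponent, C.supp → C.supp → ℕ → ℕ)
    (h : ∀ C, (M.induce C.supp).IsProperEdgeColoring K (χ C)) :
    M.IsProperEdgeColoring K (glue G.graph χ) where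
  lt x y j hj := by
    have hc := hM.component_eq (Nat.zero_lt_of_lt hj)
    rw [glue_of_eq _ _ hc]
    exact (h _).lt ⟨x, rfl⟩ ⟨y, hc.symm⟩ j hj
  symm x y j hj := by
    have hc := hM.component_eq (Nat.zero_lt_of_lt hj)
    rw [glue_of_eq _ _ hc]
    exact ((h _).symm ⟨x, rfl⟩ ⟨y, hc.symm⟩ j hj).trans (congrFun
      (glue_eq G.graph χ _ ⟨y, hc.symm⟩ ⟨x, rfl⟩).symm j)
  proper x y j y' j' hj hj' hne := by
    have hc := hM.component_eq (Nat.zero_lt_of_lt hj)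
    have hc' := hM.component_eq (Nat.zero_lt_of_lt hj')
    rw [glue_of_eq _ _ hc, glue_of_eq _ _ hc']
    refine (h _).proper ⟨x, rfl⟩ ⟨y, hc.symm⟩ j ⟨y', hc'.symm⟩ j' hj hj' (fun he => hne ?_)
    have h1 : y = y' := congrArg (fun z => (z.1 : V)) he
    have h2 : j = j' := congrArg Prod.snd he
    rw [h1, h2]

theorem proper_induce {M : Multigraph V} {K : ℕ} {χ : V → V → ℕ → ℕ}
    (h : M.IsProperEdgeColoring K χ) (W : Set V) :
    (M.induce W).IsProperEdgeColoring K (fun x y => χ x y) where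
  lt x y j hj := h.lt x y j hj
  symm x y j hj := h.symm x y j hj
  proper x y j y' j' hj hj' hne := h.proper x y j y' j' hj hj' (fun he => hne (by
    simp only [Prod.mk.injEq, Subtype.coe_inj] at he
    simp [he.1, he.2]))

/-- Transport of a multigraph along a bijection of the vertex sets. -/
def Multigraph.map {V' : Type u} (M : Multigraph V) (φ : V ≃ V') : Multigraph V' where
  mult x y := M.mult (φ.symm x) (φ.symm y)
  symm _ _ := M.symm _ _
  loopless _ := M.loopless _

theorem Represents.map {V' : Type u} {G' : StructuredGraph (multigraphSignature p) V'}
    {M : Multigraph V} (hM : Represents G M) (φ : G.Iso G') :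
    Represents G' (M.map φ.toEquiv) where
  mult_le x y := hM.mult_le _ _
  adj_iff x y := by
    have := φ.adj_iff (φ.toEquiv.symm x) (φ.toEquiv.symm y)
    simp only [Equiv.apply_symm_apply] at this
    rw [← this, hM.adj_iff]
    rfl
  rel_iff j t h := by
    have h1 := φ.rel_iff j (fun a => φ.toEquiv.symm (t a))
    have h2 := φ.adj_iff (φ.toEquiv.symm (t 0)) (φ.toEquiv.symm (t 1))
    simp only [Equiv.apply_symm_apply] at h1 h2
    exact h1.symm.trans (hM.rel_iff j (fun a => φ.toEquiv.symm (t a)) (h2.2 h))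

theorem proper_map {V' : Type u} {M : Multigraph V} {K : ℕ} {χ : V → V → ℕ → ℕ}
    (h : M.IsProperEdgeColoring K χ) (φ : V ≃ V') :
    (M.map φ).IsProperEdgeColoring K (fun x y => χ (φ.symm x) (φ.symm y)) where
  lt x y j hj := h.lt _ _ j hj
  symm x y j hj := h.symm _ _ j hj
  proper x y j y' j' hj hj' hne := h.proper _ _ j _ j' hj hj' (fun he => hne (by
    simpa using he))

theorem gam_glue (K : ℕ) (h : ∀ C : G.graph.ConnectedComponent, ∃ M : Multigraph C.supp,
      Represents (G.induce C.supp) M ∧ M.EdgeColorable K) :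
    ∃ M : Multigraph V, Represents G M ∧ M.EdgeColorable K := by
  choose M hM χ hχ using h
  let m : V → V → ℕ := glue G.graph fun C => (M C).mult
  have hoff : ∀ x y, G.graph.connectedComponentMk x ≠ G.graph.connectedComponentMk y →
      m x y = 0 := fun x y hxy => by simp [m, glue, hxy]
  have hon : ∀ x y (hc : G.graph.connectedComponentMk x = G.graph.connectedComponentMk y),
      m x y = (M _).mult ⟨x, rfl⟩ ⟨y, hc.symm⟩ := fun x y hc =>
    glue_eq G.graph (fun C => (M C).mult) _ ⟨x, rfl⟩ ⟨y, hc.symm⟩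
  let N : Multigraph V :=
    { mult := m
      symm := fun x y => by
        by_cases hc : G.graph.connectedComponentMk x = G.graph.connectedComponentMk y
        · rw [hon x y hc, (M _).symm]
          exact (glue_eq G.graph (fun C => (M C).mult) _ ⟨y, hc.symm⟩ ⟨x, rfl⟩).symm
        · rw [hoff x y hc, hoff y x (Ne.symm hc)]
      loopless := fun x => by rw [hon x x rfl, (M _).loopless] }
  have hind : ∀ C, N.induce C.supp = M C := by
    intro C
    ext x y
    exact glue_eq G.graph (fun C => (M C).mult) C x y
  have hN : Represents G N := by
    refine ⟨fun x y => ?_, fun x y => ?_, fun j t ha => ?_⟩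
    · change m x y ≤ p
      by_cases hc : G.graph.connectedComponentMk x = G.graph.connectedComponentMk y
      · rw [hon x y hc]; exact (hM _).mult_le _ _
      · rw [hoff x y hc]; exact Nat.zero_le _
    · change _ ↔ 0 < m x y
      by_cases hc : G.graph.connectedComponentMk x = G.graph.connectedComponentMk y
      · rw [hon x y hc, ← (hM _).adj_iff]
        rfl
      · rw [hoff x y hc]
        refine ⟨fun ha => absurd (SimpleGraph.ConnectedComponent.sound ha.reachable) hc,
          fun h0 => absurd h0 (lt_irrefl _)⟩
    · change _ ↔ (j : ℕ) < m (t 0) (t 1)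
      have hc : G.graph.connectedComponentMk (t 0) = G.graph.connectedComponentMk (t 1) :=
        SimpleGraph.ConnectedComponent.sound ha.reachable
      rw [hon _ _ hc]
      have ht : (fun a => ((![⟨t 0, rfl⟩, ⟨t 1, hc.symm⟩] :
          Fin 2 → (G.graph.connectedComponentMk (t 0)).supp) a : V)) = t := by
        funext a
        fin_cases a <;> rfl
      have := (hM (G.graph.connectedComponentMk (t 0))).rel_iff j
        ![⟨t 0, rfl⟩, ⟨t 1, hc.symm⟩] ha
      change (G.rel j (fun a => ((![⟨t 0, rfl⟩, ⟨t 1, hc.symm⟩] :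
          Fin 2 → (G.graph.connectedComponentMk (t 0)).supp) a : V)) ↔ _) at this
      exact (iff_of_eq (congrArg (G.rel j) ht)).symm.trans this
  exact ⟨N, hN, _, glue_proper hN χ fun C => (hind C) ▸ hχ C⟩

theorem expresses_glue {M : Multigraph V} (hM : Represents G M)
    (χ : ∀ C : G.graph.ConnectedComponent, C.supp → C.supp → ℕ → ℕ) (c : V → HF)
    (h : ∀ C, Expresses (M.induce C.supp) (χ C) (fun x => c x)) :
    Expresses M (glue G.graph χ) c where
  name_ne x y y' hy hy' hne := by
    have hc := hM.component_eq hy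
    have hc' := hM.component_eq hy'
    exact (h _).name_ne ⟨x, rfl⟩ ⟨y, hc.symm⟩ ⟨y', hc'.symm⟩ hy hy'
      (fun he => hne (congrArg Subtype.val he))
  mem_iff x b t := by
    refine ((h (G.graph.connectedComponentMk x)).mem_iff ⟨x, rfl⟩ b t).trans ⟨?_, ?_⟩
    · rintro ⟨y, j, hj, hb, ht⟩
      refine ⟨y, j, hj, hb, ?_⟩
      rw [glue_of_eq _ _ y.2.symm]
      exact ht
    · rintro ⟨y, j, hj, hb, ht⟩
      have hc := hM.component_eq (Nat.zero_lt_of_lt hj)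
      rw [glue_of_eq _ _ hc] at ht
      exact ⟨⟨y, hc.symm⟩, j, hj, hb, ht⟩

theorem expresses_induce {M : Multigraph V} (hM : Represents G M) {χ : V → V → ℕ → ℕ}
    {c : V → HF} (h : Expresses M χ c) (C : G.graph.ConnectedComponent) :
    Expresses (M.induce C.supp) (fun x y => χ x y) (fun x => c x) where
  name_ne x y y' hy hy' hne := h.name_ne x y y' hy hy' (fun he => hne (Subtype.ext he))
  mem_iff x b t := by
    refine (h.mem_iff x b t).trans ⟨?_, ?_⟩
    · rintro ⟨y, j, hj, hb, ht⟩
      have hc := hM.component_eq (Nat.zero_lt_of_lt hj)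
      exact ⟨⟨y, hc.symm.trans x.2⟩, j, hj, hb, ht⟩
    · rintro ⟨y, j, hj, hb, ht⟩
      exact ⟨y, j, hj, hb, ht⟩

theorem expresses_map {V' : Type u} {M : Multigraph V} {χ : V → V → ℕ → ℕ} {c : V → HF}
    (h : Expresses M χ c) (φ : V ≃ V') :
    Expresses (M.map φ) (fun x y => χ (φ.symm x) (φ.symm y)) (c ∘ φ.symm) where
  name_ne x y y' hy hy' hne := h.name_ne _ _ _ hy hy' (fun he => hne (φ.symm.injective he))
  mem_iff x b t := by
    refine (h.mem_iff (φ.symm x) b t).trans ⟨?_, ?_⟩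
    · rintro ⟨y, j, hj, hb, ht⟩
      exact ⟨φ y, j, by simpa [Multigraph.map] using hj, by simpa using hb, by simpa using ht⟩
    · rintro ⟨y, j, hj, hb, ht⟩
      exact ⟨φ.symm y, j, hj, hb, ht⟩

end EdgeLemmas

/-- The problem of properly edge coloring with `K` colors the `k`-edge-colorable multigraphs of
edge multiplicity at most `p`. -/
def edgeColoringProblem (k p K : ℕ) : ColoringProblem.{u} (multigraphSignature p) where
  Gam G := ∃ M, Represents G M ∧ M.EdgeColorable k
  Pi G c := ∃ M, Represents G M ∧ ∃ χ, M.IsProperEdgeColoring K χ ∧ Expresses M χ c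
  gam_iso := by
    rintro V V' G G' φ ⟨M, hM, χ, hχ⟩
    exact ⟨_, hM.map φ, _, proper_map hχ φ.toEquiv⟩
  gam_components := by
    intro V G
    constructor
    · rintro ⟨M, hM, χ, hχ⟩ C
      exact ⟨_, hM.induce C.supp, _, proper_induce hχ C.supp⟩
    · exact gam_glue k
  pi_iso := by
    rintro V V' G G' φ c - ⟨M, hM, χ, hχ, hc⟩
    exact ⟨_, hM.map φ, _, proper_map hχ φ.toEquiv, expresses_map hc φ.toEquiv⟩
  pi_components := by
    rintro V G c ⟨M, hM, -⟩
    constructor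
    · rintro ⟨N, hN, χ, hχ, hc⟩ C
      exact ⟨_, hN.induce C.supp, _, proper_induce hχ C.supp, expresses_induce hN hc C⟩
    · intro h
      have h' : ∀ C : G.graph.ConnectedComponent, ∃ χ,
          (M.induce C.supp).IsProperEdgeColoring K χ ∧
          Expresses (M.induce C.supp) χ (fun x => c x) := by
        intro C
        obtain ⟨N, hN, hχ⟩ := h C
        rwa [hN.unique (hM.induce C.supp)] at hχ
      choose χ hχ hc using h'
      exact ⟨M, hM, _, glue_proper hM χ hχ, expresses_glue hM χ c hc⟩

end ASI

/-! Call the finite components of the graphs `G^r ↾ U_i` pieces. The edges are colored in stages 0,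
…, s. Stage i deals with the edges whose ends are both within `zoneWidth k p s i` of U₀ ∪ … ∪ U_i.
It keeps the previous colors on the edges whose ends are both within this distance of U₀ ∪ … ∪
U_{i-1}, and it may use k + pi colors. The widths decrease to 0, so stage s colors every edge, with
k + ps colors.

Locality. A free edge of stage i is close to a piece of U_i, and different pieces of U_i have
distance more than r, which exceeds twice the zone width. Hence the choices near different pieces do
not interact. Every window chooses the colex-least admissible coloring of each stage. If two windows
chose differently near a piece deep in both, exchanging their choices there would improve one of
them (`IsColexLeast.eqOn_of_exchange`, `stage_eq`). A stage costs two layers of pieces, so windows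
of radius 2s + 4 suffice for adjacent vertices to agree on their common edges. Local names for the
vertices are chosen and compared in the same way (`name_eq`).

Existence. An admissible coloring must exist at every stage. The window has a proper coloring h with
k colors, and the previous stage left a coloring f with K ≥ k colors in a zone that is wider than
the fixed one by `pasteRadius K`. Both are pasted with p more colors (`exists_paste`,
`exists_stageValid_succ`), by induction on K. If K ≤ p, one level of edges in raised colors
separates f from h. Otherwise let K = q + p. Well inside the zone of f, set its first p color
classes aside. The other edges there have degree at most q, and q + p colors are what a Vizing
argument for multiplicity p needs. Thus a strip of bounded width can be recolored so that p of the
classes, which outside the zone consist of the first p classes of h, end in the strip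
(`exists_split_coloring`). The other q classes then pose two pasting problems with q colors, one on
each side of the strip.

The recoloring of the strip has to be local, although Kempe chains may run arbitrarily far.
Therefore the colors are divided into two kinds and are exchanged only within a kind: a chain then
changes colors far away but no kinds, and only the kinds matter far away (`extendsTo_of_fan`,
`extendsTo_of_split`, `exists_complete_of_split`). -/

/-- In a finite graph of maximum degree at most two, a connected component has at most two vertices
of degree at most one. -/
theorem not_all_reachable_of_degree_le {V : Type*} [Finite V] (G : SimpleGraph V)
    (h2 : ∀ v, (G.neighborSet v).ncard ≤ 2) {x y z : V} (hxy : x ≠ y) (hxz : x ≠ z) (hyz : y ≠ z)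
    (hx : (G.neighborSet x).ncard ≤ 1) (hy : (G.neighborSet y).ncard ≤ 1)
    (hz : (G.neighborSet z).ncard ≤ 1) (hrxy : G.Reachable x y) (hrxz : G.Reachable x z) :
    False := by
  classical
  let C := G.connectedComponentMk x
  have hconn : (G.induce C.supp).Connected := C.connected_toSimpleGraph
  have : Fintype C.supp := Fintype.ofFinite _
  -- A connected graph on n vertices has degree sum at least 2n - 2, whereas degrees at most 2, with
  -- three of them at most 1, sum to at most 2n - 3.
  have hcard := hconn.card_vert_le_card_edgeSet_add_one
  have hsum := (G.induce C.supp).sum_degrees_eq_twice_card_edges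
  have hdeg : ∀ v : C.supp, (G.induce C.supp).degree v ≤ (G.neighborSet v).ncard := by
    intro v
    rw [← SimpleGraph.card_neighborSet_eq_degree, ← Nat.card_eq_fintype_card,
      Nat.card_coe_set_eq, ← Set.ncard_image_of_injective _ Subtype.val_injective]
    refine Set.ncard_le_ncard ?_ (Set.toFinite _)
    rintro _ ⟨w, hw, rfl⟩
    exact hw
  let x' : C.supp := ⟨x, rfl⟩
  let y' : C.supp := ⟨y, SimpleGraph.ConnectedComponent.sound hrxy.symm⟩
  let z' : C.supp := ⟨z, SimpleGraph.ConnectedComponent.sound hrxz.symm⟩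
  let S : Finset C.supp := {x', y', z'}
  have hS : S.card = 3 := by
    rw [Finset.card_eq_three]
    exact ⟨x', y', z', fun h => hxy (congrArg Subtype.val h), fun h => hxz (congrArg Subtype.val h),
      fun h => hyz (congrArg Subtype.val h), rfl⟩
  have hle : ∀ v : C.supp, (G.induce C.supp).degree v + (if v ∈ S then 1 else 0) ≤ 2 := by
    intro v
    have h0 := hdeg v
    have h1 := h2 v
    split_ifs with hv
    · have : (G.neighborSet v).ncard ≤ 1 := by
        simp only [S, Finset.mem_insert, Finset.mem_singleton] at hv
        rcases hv with rfl | rfl | rfl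
        · exact hx
        · exact hy
        · exact hz
      omega
    · omega
  have htot := Finset.sum_le_sum fun v (_ : v ∈ (Finset.univ : Finset C.supp)) => hle v
  rw [Finset.sum_add_distrib, hsum, Finset.sum_ite_mem, Finset.univ_inter] at htot
  simp only [Finset.sum_const, smul_eq_mul, mul_one, hS, Finset.card_univ] at htot
  rw [Nat.card_eq_fintype_card, Nat.card_eq_fintype_card, ← SimpleGraph.edgeFinset_card] at hcard
  omega

/-! ### Partial edge colorings -/

section EdgeColoring

variable {V E κ : Type*}

/-- The partial edge coloring `c` is proper. -/
def ProperPartial (ends : E → Sym2 V) (c : E → Option κ) : Prop :=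
  ∀ ⦃e e' v a⦄, v ∈ ends e → v ∈ ends e' → c e = some a → c e' = some a → e = e'

/-- No edge at `v` has the color `a`. -/
def MissingAt (ends : E → Sym2 V) (c : E → Option κ) (v : V) (a : κ) : Prop :=
  ∀ ⦃e⦄, v ∈ ends e → c e ≠ some a

/-- The graph formed by the edges with the colors `a` and `b`. -/
def kempeGraph (ends : E → Sym2 V) (c : E → Option κ) (a b : κ) : SimpleGraph V where
  Adj u w := u ≠ w ∧ ∃ e, ends e = s(u, w) ∧ (c e = some a ∨ c e = some b)
  symm := ⟨fun _ _ h => ⟨h.1.symm, h.2.imp fun _ he => ⟨he.1.trans Sym2.eq_swap, he.2⟩⟩⟩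
  loopless := ⟨fun _ h => h.1 rfl⟩

variable {ends : E → Sym2 V} {c : E → Option κ} {a b : κ} {S : Set V}

/-- Properness allows one edge of each of the two colors at `v`, and none of a missing color. These
are the degree bounds that `not_all_reachable_of_degree_le` asks for. -/
theorem kempeGraph_neighborSet_ncard_le (hc : ProperPartial ends c) [Finite V] (v : V) :
    ((kempeGraph ends c a b).neighborSet v).ncard ≤ 2 ∧
    (MissingAt ends c v a ∨ MissingAt ends c v b →
      ((kempeGraph ends c a b).neighborSet v).ncard ≤ 1) := by
  have key : ∀ t : κ, ({w | ∃ e, ends e = s(v, w) ∧ c e = some t} : Set V).ncard ≤ 1 := by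
    intro t
    rw [Set.ncard_le_one (Set.toFinite _)]
    rintro w ⟨e, he, hce⟩ w' ⟨e', he', hce'⟩
    have : e = e' := hc (v := v) (by simp [he]) (by simp [he']) hce hce'
    subst this
    rw [he] at he'
    exact Sym2.congr_right.1 he'
  have hsub : (kempeGraph ends c a b).neighborSet v ⊆
      {w | ∃ e, ends e = s(v, w) ∧ c e = some a} ∪ {w | ∃ e, ends e = s(v, w) ∧ c e = some b} := by
    rintro w ⟨-, e, he, h | h⟩
    · exact Or.inl ⟨e, he, h⟩
    · exact Or.inr ⟨e, he, h⟩
  have hempty : ∀ t, MissingAt ends c v t →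
      ({w | ∃ e, ends e = s(v, w) ∧ c e = some t} : Set V) = ∅ := by
    intro t ht
    rw [Set.eq_empty_iff_forall_notMem]
    rintro w ⟨e, he, hce⟩
    exact ht (by simp [he]) hce
  have hle := (Set.ncard_le_ncard hsub (Set.toFinite _)).trans (Set.ncard_union_le _ _)
  have ha := key a
  have hb := key b
  refine ⟨by omega, ?_⟩
  rintro (h | h)
  · rw [hempty a h, Set.ncard_empty] at hle
    omega
  · rw [hempty b h, Set.ncard_empty] at hle
    omega

/-- `S` is a union of components of the graph formed by the edges with the colors `a` and `b`. -/
def KempeClosed (ends : E → Sym2 V) (c : E → Option κ) (a b : κ) (S : Set V) : Prop :=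
  ∀ ⦃e u w⦄, u ∈ ends e → w ∈ ends e → (c e = some a ∨ c e = some b) → u ∈ S → w ∈ S

theorem kempeClosed_component (v : V) :
    KempeClosed ends c a b {w | (kempeGraph ends c a b).Reachable v w} := by
  intro e u w hu hw hce hr
  rcases eq_or_ne u w with rfl | hne
  · exact hr
  · refine SimpleGraph.Reachable.trans hr (SimpleGraph.Adj.reachable ⟨hne, e, ?_, hce⟩)
    exact (Sym2.mem_and_mem_iff hne).1 ⟨hu, hw⟩

section Swap

variable [DecidableEq κ]

open Classical in
/-- The coloring obtained by exchanging the colors `a` and `b` on the edges meeting `S`. -/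
noncomputable def kempeSwap (ends : E → Sym2 V) (c : E → Option κ) (a b : κ) (S : Set V) :
    E → Option κ :=
  fun e => if ∃ v ∈ ends e, v ∈ S then (c e).map (Equiv.swap a b) else c e

theorem kempeSwap_of_mem {e : E} {v : V} (hv : v ∈ ends e) (hS : v ∈ S) :
    kempeSwap ends c a b S e = (c e).map (Equiv.swap a b) :=
  if_pos ⟨v, hv, hS⟩

/-- The other end of `e` may lie in `S`, but then closedness excludes the colors `a` and `b` for
`e`, and the exchange does not affect it. -/
theorem kempeSwap_of_notMem (hcl : KempeClosed ends c a b S) {e : E} {v : V} (hv : v ∈ ends e)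
    (hS : v ∉ S) : kempeSwap ends c a b S e = c e := by
  unfold kempeSwap
  split_ifs with h
  · obtain ⟨w, hw, hwS⟩ := h
    rcases hce : c e with - | t
    · rfl
    · have hta : t ≠ a := fun h => hS (hcl hw hv (Or.inl (h ▸ hce)) hwS)
      have htb : t ≠ b := fun h => hS (hcl hw hv (Or.inr (h ▸ hce)) hwS)
      simp [Equiv.swap_apply_of_ne_of_ne hta htb]
  · rfl

theorem kempeSwap_eq_none_iff {e : E} : kempeSwap ends c a b S e = none ↔ c e = none := by
  unfold kempeSwap
  split_ifs <;> simp

/-- This is what makes Kempe changes harmless at a distance: however far a chain runs, the kinds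
along it stay the same. -/
theorem kempeSwap_kind {τ : Type*} (kind : κ → τ) (hab : kind a = kind b) (e : E) :
    (kempeSwap ends c a b S e).map kind = (c e).map kind := by
  unfold kempeSwap
  split_ifs
  · rw [Option.map_map]
    congr 1
    funext t
    simp only [Function.comp_apply]
    rcases eq_or_ne t a with rfl | ha
    · rw [Equiv.swap_apply_left, hab]
    rcases eq_or_ne t b with rfl | hb
    · rw [Equiv.swap_apply_right, hab]
    rw [Equiv.swap_apply_of_ne_of_ne ha hb]
  · rfl

theorem map_swap_eq_some {o : Option κ} {t : κ} :
    o.map (Equiv.swap a b) = some t ↔ o = some (Equiv.swap a b t) := by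
  rcases o with - | u
  · simp
  · simp only [Option.map_some, Option.some.injEq]
    exact ⟨fun h => by rw [← h, Equiv.swap_apply_self], fun h => by rw [h, Equiv.swap_apply_self]⟩

theorem kempeSwap_proper (hc : ProperPartial ends c) (hcl : KempeClosed ends c a b S) :
    ProperPartial ends (kempeSwap ends c a b S) := by
  intro e e' v t hv hv' he he'
  by_cases hS : v ∈ S
  · rw [kempeSwap_of_mem hv hS, map_swap_eq_some] at he
    rw [kempeSwap_of_mem hv' hS, map_swap_eq_some] at he'
    exact hc hv hv' he he'
  · rw [kempeSwap_of_notMem hcl hv hS] at he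
    rw [kempeSwap_of_notMem hcl hv' hS] at he'
    exact hc hv hv' he he'

theorem missingAt_kempeSwap_of_mem {v : V} (hS : v ∈ S) {t : κ} :
    MissingAt ends (kempeSwap ends c a b S) v t ↔ MissingAt ends c v (Equiv.swap a b t) := by
  refine forall_congr' fun e => forall_congr' fun hv => not_congr ?_
  rw [kempeSwap_of_mem hv hS, map_swap_eq_some]

theorem missingAt_kempeSwap_of_notMem (hcl : KempeClosed ends c a b S) {v : V} (hS : v ∉ S)
    {t : κ} : MissingAt ends (kempeSwap ends c a b S) v t ↔ MissingAt ends c v t := by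
  refine forall_congr' fun e => forall_congr' fun hv => not_congr ?_
  rw [kempeSwap_of_notMem hcl hv hS]

end Swap

/-! ### Fans -/

/-- The edge `e'` at `v` has an admissible color that is missing at the other end of the edge `e`
at `v`. -/
def FanStep (ends : E → Sym2 V) (c : E → Option κ) (v : V) (ok : κ → Prop) (e e' : E) : Prop :=
  v ∈ ends e' ∧ ∃ y β, ends e = s(v, y) ∧ ok β ∧ MissingAt ends c y β ∧ c e' = some β

/-- A chain may be started at its last visit to `x`. -/
theorem reflTransGen_avoid {α : Type*} {r : α → α → Prop} {x y : α}
    (h : Relation.ReflTransGen r x y) :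
    Relation.ReflTransGen (fun u w => r u w ∧ w ≠ x) x y := by
  induction h with
  | refl => exact .refl
  | @tail u w _ huw ih =>
    by_cases hw : w = x
    · rw [hw]
    · exact ih.tail ⟨huw, hw⟩

/-- Shifting the colors along a fan makes a given edge of the fan the uncolored one. -/
theorem exists_shift [Finite E] {v : V} {ok : κ → Prop} {e : E} (Z : Set E) :
    ∀ (c : E → Option κ) (e₀ : E), ProperPartial ends c → c e₀ = none → v ∈ ends e₀ →
    Relation.ReflTransGen (fun x y => FanStep ends c v ok x y ∧ y ∉ Z) e₀ e →
    ∃ c', ProperPartial ends c' ∧ v ∈ ends e ∧ (∀ e', v ∉ ends e' → c' e' = c e') ∧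
      (∀ e', c' e' = none ↔ (c e' = none ∧ e' ≠ e₀) ∨ e' = e) ∧
      (∀ t, MissingAt ends c' v t ↔ MissingAt ends c v t) ∧
      (∀ e' t, ¬ ok t → c' e' = some t → c e' = some t) := by
  classical
  -- `Z` collects the edges that the fan has already passed, so its complement shrinks with every
  -- shift.
  induction hn : Zᶜ.ncard using Nat.strong_induction_on generalizing Z with
  | _ n ih =>
  intro c e₀ hc hnone hv hr
  rcases hr.cases_head with rfl | ⟨e₁, ⟨⟨hv₁, y₀, β, hy₀, hok, hmiss, hβ⟩, h₁Z⟩, hr'⟩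
  · refine ⟨c, hc, hv, fun _ _ => rfl, fun e' => ?_, fun _ => Iff.rfl, fun _ _ _ h => h⟩
    by_cases h : e' = e₀
    · simp [h, hnone]
    · simp [h]
  have hne : e₁ ≠ e₀ := fun h => by rw [h, hnone] at hβ; cases hβ
  let c₁ : E → Option κ := Function.update (Function.update c e₀ (some β)) e₁ none
  have h₁ : c₁ e₁ = none := Function.update_self ..
  have h₀ : c₁ e₀ = some β := by
    simp only [c₁]; rw [Function.update_of_ne hne.symm, Function.update_self]
  have hoff : ∀ e', e' ≠ e₀ → e' ≠ e₁ → c₁ e' = c e' := fun e' h h' => by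
    simp only [c₁]; rw [Function.update_of_ne h', Function.update_of_ne h]
  have hsub : ∀ e' t, t ≠ β → c₁ e' = some t → c e' = some t := by
    intro e' t ht h
    by_cases hh₁ : e' = e₁
    · rw [hh₁, h₁] at h; cases h
    by_cases hh₀ : e' = e₀
    · rw [hh₀, h₀] at h; exact absurd (Option.some.inj h).symm ht
    rwa [hoff e' hh₀ hh₁] at h
  have hcβ : ∀ e', c₁ e' = some β → e' = e₀ ∨ (c e' = some β ∧ e' ≠ e₁) := by
    intro e' h
    by_cases hh₁ : e' = e₁
    · rw [hh₁, h₁] at h; cases h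
    by_cases hh₀ : e' = e₀
    · exact Or.inl hh₀
    · rw [hoff e' hh₀ hh₁] at h
      exact Or.inr ⟨h, hh₁⟩
  -- Moving `β` from `e₁` to `e₀` is safe: at `v` only `e₁` has this color, and at the leaf of `e₀`
  -- it is missing.
  have hβfree : ∀ e' u, u ∈ ends e₀ → u ∈ ends e' → c e' = some β → e' = e₁ := by
    intro e' u hu hu' h
    rw [hy₀, Sym2.mem_iff] at hu
    rcases hu with rfl | rfl
    · exact hc hu' hv₁ h hβ
    · exact absurd h (hmiss hu')
  have hc₁ : ProperPartial ends c₁ := by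
    intro e' e'' u t hu hu' h h'
    by_cases ht : t = β
    · subst ht
      rcases hcβ _ h with rfl | ⟨h1, hn⟩ <;> rcases hcβ _ h' with rfl | ⟨h1', hn'⟩
      · rfl
      · exact absurd (hβfree _ _ hu hu' h1') hn'
      · exact absurd (hβfree _ _ hu' hu h1) hn
      · exact hc hu hu' h1 h1'
    · exact hc hu hu' (hsub _ _ ht h) (hsub _ _ ht h')
  have hmv : ∀ t, MissingAt ends c₁ v t ↔ MissingAt ends c v t := by
    intro t
    by_cases ht : t = β
    · subst ht
      exact ⟨fun h => absurd h₀ (h hv), fun h => absurd hβ (h hv₁)⟩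
    · refine ⟨fun h e' he' hce' => ?_, fun h e' he' hce' => h he' (hsub _ _ ht hce')⟩
      have hh₀ : e' ≠ e₀ := fun hh => by rw [hh, hnone] at hce'; cases hce'
      have hh₁ : e' ≠ e₁ := fun hh => by
        rw [hh, hβ] at hce'; exact ht (Option.some.inj hce').symm
      exact h he' ((hoff _ hh₀ hh₁).trans hce')
  -- The rest of the fan survives the shift. It avoids `e₁`, hence uses only colors other than `β`,
  -- and no edge acquires such a color by the shift.
  have hr₁ : Relation.ReflTransGen (fun x y => FanStep ends c₁ v ok x y ∧ y ∉ insert e₁ Z) e₁ e := by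
    refine Relation.ReflTransGen.mono ?_ _ _ (reflTransGen_avoid hr')
    rintro u w ⟨⟨⟨hw, y, γ, hy, hγok, hγm, hγ⟩, hwZ⟩, hw₁⟩
    have hw₀ : w ≠ e₀ := fun hh => by rw [hh, hnone] at hγ; cases hγ
    have hγβ : γ ≠ β := fun hh => hw₁ (hc hw hv₁ hγ (hh ▸ hβ))
    refine ⟨⟨hw, y, γ, hy, hγok, fun e' he' hce' => hγm he' (hsub _ _ hγβ hce'), ?_⟩, ?_⟩
    · rw [hoff w hw₀ hw₁, hγ]
    · simp [hw₁, hwZ]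
  have hlt : (insert e₁ Z)ᶜ.ncard < n := by
    rw [← hn]
    refine Set.ncard_lt_ncard ?_ (Set.toFinite _)
    refine ⟨Set.compl_subset_compl.2 (Set.subset_insert _ _), fun h => ?_⟩
    exact h (show e₁ ∈ Zᶜ from h₁Z) (Set.mem_insert _ _)
  obtain ⟨c', hc', hve, hoffv, hdom, hmv', hnok⟩ := ih _ hlt _ rfl c₁ e₁ hc₁ h₁ hv₁ hr₁
  refine ⟨c', hc', hve, fun e' he' => ?_, fun e' => ?_, fun t => (hmv' t).trans (hmv t), ?_⟩
  · rw [hoffv e' he', hoff]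
    · rintro rfl; exact he' hv
    · rintro rfl; exact he' hv₁
  · rw [hdom]
    by_cases hh₀ : e' = e₀
    · subst hh₀; simp [h₀]
    by_cases hh₁ : e' = e₁
    · subst hh₁; simp [hβ]
    · simp [hoff e' hh₀ hh₁, hh₀, hh₁]
  · intro e' t ht h
    exact hsub _ _ (fun hh => ht (hh ▸ hok)) (hnok _ _ ht h)

end EdgeColoring

/-! ### Extending a partial coloring to one more edge without changing kinds far away -/

section EdgeColoring

variable {V E κ : Type*} {ends : E → Sym2 V} {c : E → Option κ}

/-- A partial edge coloring is extended to the edge `e₀`; the kinds of the colors change only at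
edges meeting `N`. -/
def ExtendsTo {τ : Type*} (ends : E → Sym2 V) (kind : κ → τ) (c : E → Option κ) (e₀ : E)
    (N : Set V) : Prop :=
  ∃ c', ProperPartial ends c' ∧ (∀ e, c' e = none ↔ c e = none ∧ e ≠ e₀) ∧
    ∀ e, (∀ v ∈ ends e, v ∉ N) → (c' e).map kind = (c e).map kind

/-- If a color is missing at both ends of an edge of a fan, then a shift colors the fan. -/
theorem extendsTo_of_missing [Finite E] {τ : Type*} (kind : κ → τ) {v : V} {ok : κ → Prop}
    {e₀ e : E} {y : V} {a : κ} (hc : ProperPartial ends c) (h₀ : c e₀ = none) (hv : v ∈ ends e₀)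
    (hr : Relation.ReflTransGen (FanStep ends c v ok) e₀ e) (hy : ends e = s(v, y))
    (hva : MissingAt ends c v a) (hya : MissingAt ends c y a) :
    ExtendsTo ends kind c e₀ {v} := by
  classical
  have hr' : Relation.ReflTransGen (fun x y => FanStep ends c v ok x y ∧ y ∉ (∅ : Set E)) e₀ e := by
    simpa using hr
  obtain ⟨c', hc', -, hoff, hdom, hmv, -⟩ := exists_shift ∅ c e₀ hc h₀ hv hr'
  -- The shift changes only edges at `v`, and the set of colors missing at `v` stays the same, so
  -- `a` is still missing at both ends.
  have hya' : MissingAt ends c' y a := by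
    intro e' he' hce'
    by_cases hve : v ∈ ends e'
    · exact (hmv a).2 hva hve hce'
    · rw [hoff e' hve] at hce'
      exact hya he' hce'
  have hfree : ∀ e' u, u ∈ ends e → u ∈ ends e' → c' e' ≠ some a := by
    intro e' u hu hu'
    rw [hy, Sym2.mem_iff] at hu
    rcases hu with rfl | rfl
    · exact (hmv a).2 hva hu'
    · exact hya' hu'
  refine ⟨Function.update c' e (some a), ?_, fun e' => ?_, fun e' he' => ?_⟩
  · intro e' e'' u t hu hu' h h'
    by_cases h1 : e' = e <;> by_cases h2 : e'' = e
    · rw [h1, h2]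
    · subst h1
      rw [Function.update_self] at h
      rw [Function.update_of_ne h2, ← h] at h'
      exact absurd h' (hfree _ _ hu hu')
    · subst h2
      rw [Function.update_self] at h'
      rw [Function.update_of_ne h1, ← h'] at h
      exact absurd h (hfree _ _ hu' hu)
    · rw [Function.update_of_ne h1] at h
      rw [Function.update_of_ne h2] at h'
      exact hc' hu hu' h h'
  · by_cases h1 : e' = e
    · subst h1
      rw [Function.update_self]
      simp only [reduceCtorEq, ne_eq, false_iff, not_and, not_not]
      intro hn
      rcases hr.cases_tail with rfl | ⟨_, _, _, _, _, _, _, _, h⟩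
      · rfl
      · rw [h] at hn; cases hn
    · rw [Function.update_of_ne h1, hdom]
      simp [h1]
  · have hne : v ∉ ends e' := fun h => he' v h rfl
    rw [Function.update_of_ne, hoff e' hne]
    rintro rfl
    exact hne (by simp [hy])

/-- A fan argument in which colors are exchanged only with colors of the same kind. -/
theorem extendsTo_of_fan [Finite V] [Finite E] [Finite κ] {τ : Type*} (kind : κ → τ) {v : V}
    {ok : κ → Prop} {e₀ : E} {p : ℕ} (hloop : ∀ e, ¬ (ends e).IsDiag)
    (hmult : ∀ y, {e | ends e = s(v, y)}.ncard ≤ p)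
    (hc : ProperPartial ends c) (h₀ : c e₀ = none) (hv : v ∈ ends e₀)
    (h1 : ∀ β, ok β → ∃ a, MissingAt ends c v a ∧ kind a = kind β)
    (h2 : ∀ e y, Relation.ReflTransGen (FanStep ends c v ok) e₀ e → ends e = s(v, y) →
      p ≤ {β | ok β ∧ MissingAt ends c y β}.ncard) :
    ExtendsTo ends kind c e₀ {v} := by
  classical
  by_cases hA : ∃ e y β, Relation.ReflTransGen (FanStep ends c v ok) e₀ e ∧ ends e = s(v, y) ∧
      MissingAt ends c y β ∧ MissingAt ends c v β
  · obtain ⟨e, y, β, hr, hy, hyβ, hvβ⟩ := hA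
    exact extendsTo_of_missing kind hc h₀ hv hr hy hvβ hyβ
  push Not at hA
  have hrv : ∀ e, Relation.ReflTransGen (FanStep ends c v ok) e₀ e → v ∈ ends e := by
    intro e hr
    rcases hr.cases_tail with rfl | ⟨_, _, h⟩
    · exact hv
    · exact h.1
  -- two leaves miss a common color
  have hB : ∃ e y e' y' β, Relation.ReflTransGen (FanStep ends c v ok) e₀ e ∧ ends e = s(v, y) ∧
      Relation.ReflTransGen (FanStep ends c v ok) e₀ e' ∧ ends e' = s(v, y') ∧ y ≠ y' ∧ ok β ∧
      MissingAt ends c y β ∧ MissingAt ends c y' β := by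
    -- Otherwise the sets of admissible colors missing at the leaves are disjoint and contain at
    -- least p|Y| colors in all. None of these is missing at `v`, so each occurs on an edge of the
    -- fan other than `e₀`. But with `e₀` the fan has at most p|Y| edges.
    by_contra hno
    push Not at hno
    have : Fintype V := Fintype.ofFinite V
    have : Fintype E := Fintype.ofFinite E
    have : Fintype κ := Fintype.ofFinite κ
    let F : Finset E := Finset.univ.filter fun e => Relation.ReflTransGen (FanStep ends c v ok) e₀ e
    let Y : Finset V := Finset.univ.filter fun y => ∃ e ∈ F, ends e = s(v, y)
    let M : V → Finset κ := fun y => Finset.univ.filter fun β => ok β ∧ MissingAt ends c y β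
    have hM : ∀ y ∈ Y, p ≤ (M y).card := by
      intro y hy
      simp only [Y, F, Finset.mem_filter, Finset.mem_univ, true_and] at hy
      obtain ⟨e, hr, he⟩ := hy
      refine (h2 e y hr he).trans_eq ?_
      rw [Set.ncard_eq_toFinset_card']
      congr 1
      ext β
      simp [M]
    have hdisj : ∀ y ∈ Y, ∀ y' ∈ Y, y ≠ y' → Disjoint (M y) (M y') := by
      intro y hy y' hy' hne
      simp only [Y, F, Finset.mem_filter, Finset.mem_univ, true_and] at hy hy'
      obtain ⟨e, hr, he⟩ := hy
      obtain ⟨e', hr', he'⟩ := hy'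
      rw [Finset.disjoint_left]
      intro β hβ hβ'
      simp only [M, Finset.mem_filter, Finset.mem_univ, true_and] at hβ hβ'
      exact hno e y e' y' β hr he hr' he' hne hβ.1 hβ.2 hβ'.2
    have hcardM : Y.card * p ≤ (Y.biUnion M).card := by
      rw [Finset.card_biUnion hdisj, ← smul_eq_mul, ← Finset.sum_const]
      exact Finset.sum_le_sum hM
    have hsub : (Y.biUnion M).image some ⊆ (F.erase e₀).image c := by
      intro o ho
      simp only [Finset.mem_image, Finset.mem_biUnion] at ho
      obtain ⟨β, ⟨y, hy, hβ⟩, rfl⟩ := ho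
      simp only [Y, F, M, Finset.mem_filter, Finset.mem_univ, true_and] at hy hβ
      obtain ⟨e, hr, he⟩ := hy
      have hp := hA e y β hr he hβ.2
      unfold MissingAt at hp
      push Not at hp
      obtain ⟨e', hve', hce'⟩ := hp
      refine Finset.mem_image.2 ⟨e', Finset.mem_erase.2 ⟨?_, ?_⟩, hce'⟩
      · rintro rfl; rw [h₀] at hce'; cases hce'
      · simp only [F, Finset.mem_filter, Finset.mem_univ, true_and]
        exact hr.tail ⟨hve', y, β, he, hβ.1, hβ.2, hce'⟩
    have hc1 : (Y.biUnion M).card ≤ (F.erase e₀).card := by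
      rw [← Finset.card_image_of_injective _ (Option.some_injective κ)]
      exact (Finset.card_le_card hsub).trans Finset.card_image_le
    have hF : F ⊆ Y.biUnion fun y => Finset.univ.filter fun e => ends e = s(v, y) := by
      intro e he
      have hr : Relation.ReflTransGen (FanStep ends c v ok) e₀ e := by simpa [F] using he
      obtain ⟨y, hy⟩ := hrv e hr
      refine Finset.mem_biUnion.2 ⟨y, ?_, by simpa using hy⟩
      simp only [Y, Finset.mem_filter, Finset.mem_univ, true_and]
      exact ⟨e, he, hy⟩
    have hFc : F.card ≤ Y.card * p := by
      refine (Finset.card_le_card hF).trans (Finset.card_biUnion_le_card_mul _ _ _ fun y _ => ?_)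
      refine le_trans (le_of_eq ?_) (hmult y)
      rw [Set.ncard_eq_toFinset_card']
      congr 1
      ext e
      simp
    have he₀ : e₀ ∈ F := by
      simp only [F, Finset.mem_filter, Finset.mem_univ, true_and]
      exact .refl
    have := Finset.card_erase_lt_of_mem he₀
    omega
  obtain ⟨e₁, y₁, e₂, y₂, β, hr₁, hy₁, hr₂, hy₂, hne, hok, hm₁, hm₂⟩ := hB
  obtain ⟨a, hva, hkind⟩ := h1 β hok
  have hvy : ∀ e y, ends e = s(v, y) → v ≠ y := by
    rintro e y he rfl
    exact hloop e (by rw [he]; exact Sym2.mk_isDiag_iff.2 rfl)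
  -- one of the two leaves is not in the component of `v`
  obtain ⟨e, y, hr, hy, hm, hnr⟩ : ∃ e y, Relation.ReflTransGen (FanStep ends c v ok) e₀ e ∧
      ends e = s(v, y) ∧ MissingAt ends c y β ∧ ¬ (kempeGraph ends c a β).Reachable y v := by
    by_contra hno
    push Not at hno
    exact not_all_reachable_of_degree_le (kempeGraph ends c a β)
      (fun u => (kempeGraph_neighborSet_ncard_le hc u).1) (hvy _ _ hy₁) (hvy _ _ hy₂) hne
      ((kempeGraph_neighborSet_ncard_le hc v).2 (Or.inl hva))
      ((kempeGraph_neighborSet_ncard_le hc y₁).2 (Or.inr hm₁))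
      ((kempeGraph_neighborSet_ncard_le hc y₂).2 (Or.inr hm₂))
      (hno e₁ y₁ hr₁ hy₁ hm₁).symm (hno e₂ y₂ hr₂ hy₂ hm₂).symm
  let S : Set V := {w | (kempeGraph ends c a β).Reachable y w}
  have hcl : KempeClosed ends c a β S := kempeClosed_component y
  have hvS : v ∉ S := hnr
  let c₂ := kempeSwap ends c a β S
  have hc₂ : ProperPartial ends c₂ := kempeSwap_proper hc hcl
  have h₂v : ∀ e', v ∈ ends e' → c₂ e' = c e' := fun e' he' => kempeSwap_of_notMem hcl he' hvS
  -- The exchange can break the fan only at a step that uses `β` at a leaf in `S`; the color `a`,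
  -- missing at `v`, is not used by any step. The first such leaf is as good as `y`: the fan up to
  -- it is intact, and after the exchange it misses `a`.
  have hclaim : ∀ e', Relation.ReflTransGen (FanStep ends c v ok) e₀ e' →
      Relation.ReflTransGen (FanStep ends c₂ v ok) e₀ e' ∨
      ∃ e'' z, Relation.ReflTransGen (FanStep ends c₂ v ok) e₀ e'' ∧ ends e'' = s(v, z) ∧ z ∈ S ∧
        MissingAt ends c z β := by
    intro e' hr'
    induction hr' with
    | refl => exact Or.inl .refl
    | @tail e' e'' hr' hstep ih =>
      rcases ih with ih | ih
      · obtain ⟨hve, z, γ, hz, hγok, hγm, hγ⟩ := hstep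
        by_cases hzS : z ∈ S ∧ MissingAt ends c z β
        · exact Or.inr ⟨e', z, ih, hz, hzS⟩
        · refine Or.inl (ih.tail ⟨hve, z, γ, hz, hγok, ?_, (h₂v _ hve).trans hγ⟩)
          by_cases hzS' : z ∈ S
          · rw [missingAt_kempeSwap_of_mem hzS', Equiv.swap_apply_of_ne_of_ne]
            · exact hγm
            · rintro rfl; exact hva hve hγ
            · rintro rfl; exact hzS ⟨hzS', hγm⟩
          · exact (missingAt_kempeSwap_of_notMem hcl hzS').2 hγm
      · exact Or.inr ih
  obtain ⟨e₃, z, hr₃, hz, hzS, hzm⟩ : ∃ e'' z, Relation.ReflTransGen (FanStep ends c₂ v ok) e₀ e'' ∧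
      ends e'' = s(v, z) ∧ z ∈ S ∧ MissingAt ends c z β := by
    rcases hclaim e hr with h | h
    · exact ⟨e, y, h, hy, SimpleGraph.Reachable.refl _, hm⟩
    · exact h
  obtain ⟨c', hc', hdom, hk⟩ := extendsTo_of_missing kind (a := a) hc₂
    (kempeSwap_eq_none_iff.2 h₀) hv hr₃ hz ((missingAt_kempeSwap_of_notMem hcl hvS).2 hva)
    ((missingAt_kempeSwap_of_mem hzS).2 (by rwa [Equiv.swap_apply_left]))
  refine ⟨c', hc', fun e' => ?_, fun e' he' => ?_⟩
  · rw [hdom, kempeSwap_eq_none_iff]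
  · rw [hk e' he', kempeSwap_kind kind hkind]

/-- Every color is missing at `v` or belongs to one of the colored edges at `v`. -/
theorem card_le_missing_add [Finite E] [Finite κ] (c : E → Option κ) (v : V) :
    Nat.card κ ≤ {a | MissingAt ends c v a}.ncard + {e | v ∈ ends e ∧ c e ≠ none}.ncard := by
  classical
  have : Fintype κ := Fintype.ofFinite κ
  have hsub : {a | MissingAt ends c v a}ᶜ ⊆
      some ⁻¹' (c '' {e | v ∈ ends e ∧ c e ≠ none}) := by
    intro a ha
    have ha' : ¬ MissingAt ends c v a := ha
    unfold MissingAt at ha'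
    push Not at ha'
    obtain ⟨e, he, hce⟩ := ha'
    exact ⟨e, ⟨he, by simp [hce]⟩, hce⟩
  have h1 := Set.ncard_le_ncard hsub (Set.toFinite _)
  have h2 : (some ⁻¹' (c '' {e | v ∈ ends e ∧ c e ≠ none}) : Set κ).ncard ≤
      (c '' {e | v ∈ ends e ∧ c e ≠ none}).ncard := by
    rw [← Set.ncard_image_of_injective _ (Option.some_injective κ)]
    exact Set.ncard_le_ncard (Set.image_preimage_subset _ _) (Set.toFinite _)
  have h3 := Set.ncard_image_le (f := c) (Set.toFinite {e | v ∈ ends e ∧ c e ≠ none})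
  have h4 := Set.ncard_add_ncard_compl {a | MissingAt ends c v a}
  omega

end EdgeColoring

/-! ### Two kinds of colors: completing a partial coloring locally -/

section EdgeColoring

variable {V E κ : Type*} {ends : E → Sym2 V} {c : E → Option κ}

theorem card_le_missing_add_of_degree_le [Finite E] [Finite κ] {v : V} {q : ℕ}
    (hdeg : {e | v ∈ ends e}.ncard ≤ q) : Nat.card κ ≤ {a | MissingAt ends c v a}.ncard + q := by
  refine (card_le_missing_add c v).trans (Nat.add_le_add_left (le_trans ?_ hdeg) _)
  exact Set.ncard_le_ncard (fun e he => he.1) (Set.toFinite _)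

/-- The uncolored edge counts for the degree but does not use up a color; this gains one over
`card_le_missing_add_of_degree_le`. -/
theorem card_lt_missing_add_of_degree_le [Finite E] [Finite κ] {v : V} {q : ℕ} {e₀ : E}
    (hv : v ∈ ends e₀) (h₀ : c e₀ = none) (hdeg : {e | v ∈ ends e}.ncard ≤ q) :
    Nat.card κ < {a | MissingAt ends c v a}.ncard + q := by
  refine (card_le_missing_add c v).trans_lt (Nat.add_lt_add_left (lt_of_lt_of_le ?_ hdeg) _)
  refine Set.ncard_lt_ncard ⟨fun e he => he.1, fun h => ?_⟩ (Set.toFinite _)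
  exact (h (show e₀ ∈ {e | v ∈ ends e} from hv)).2 h₀

/-- If the colors are divided into two kinds, where the number of colors of the second kind is at
least the edge multiplicity and the number of colors of the first kind is at least the degree of the
vertices close to `v`, then an uncolored edge at `v` can be colored so that kinds change only at
edges meeting the closed neighborhood of `v`. -/
theorem extendsTo_of_split [Finite V] [Finite E] [Finite κ] (kind : κ → Bool) {v : V} {e₀ : E}
    {p q : ℕ} (hloop : ∀ e, ¬ (ends e).IsDiag)
    (hmult : ∀ x y, {e | ends e = s(x, y)}.ncard ≤ p)
    (hp : {a | kind a = false}.ncard = p) (hq : Nat.card κ = q + p)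
    (hdeg : ∀ y e, ends e = s(v, y) → {e | y ∈ ends e}.ncard ≤ q ∧
      ∀ z e', ends e' = s(y, z) → {e | z ∈ ends e}.ncard ≤ q)
    (hc : ProperPartial ends c) (h₀ : c e₀ = none) (hv : v ∈ ends e₀) :
    ExtendsTo ends kind c e₀ ({v} ∪ {y | ∃ e, ends e = s(v, y)}) := by
  classical
  -- More than p colors are missing at an end of an uncolored edge, and only p colors have kind
  -- `false`.
  have htrue : ∀ (c' : E → Option κ) (u : V) (e : E), u ∈ ends e → c' e = none →
      {e | u ∈ ends e}.ncard ≤ q → ∃ a, MissingAt ends c' u a ∧ kind a = true := by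
    intro c' u e hu hce hd
    by_contra hno
    push Not at hno
    have h1 := card_lt_missing_add_of_degree_le hu hce hd
    have h2 : {a | MissingAt ends c' u a}.ncard ≤ {a | kind a = false}.ncard :=
      Set.ncard_le_ncard (fun a ha => by simpa using hno a ha) (Set.toFinite _)
    omega
  -- The first fan uses only colors of kind `true`. If some leaf `y` misses a color of the other
  -- kind, the uncolored edge is shifted to `y`; then `y` misses colors of both kinds and can be the
  -- center of a second fan, with all colors admitted. Otherwise all of the at least p colors
  -- missing at a leaf have kind `true`, and the first fan suffices. The second fan is why kinds may
  -- change at edges meeting a neighbor of `v`.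
  by_cases hcase : ∃ e y γ, Relation.ReflTransGen (FanStep ends c v fun β => kind β = true) e₀ e ∧
      ends e = s(v, y) ∧ kind γ = false ∧ MissingAt ends c y γ
  · obtain ⟨e, y, γ, hr, hy, hγ, hyγ⟩ := hcase
    have hr' : Relation.ReflTransGen
        (fun x y => FanStep ends c v (fun β => kind β = true) x y ∧ y ∉ (∅ : Set E)) e₀ e := by
      simpa using hr
    obtain ⟨c₁, hc₁, -, hoff, hdom, -, hnok⟩ := exists_shift ∅ c e₀ hc h₀ hv hr'
    have h₁ : c₁ e = none := (hdom e).2 (Or.inr rfl)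
    have hye : y ∈ ends e := by simp [hy]
    -- The shift moves only colors of kind `true`, so no new edge gets the color `γ`.
    have hyγ' : MissingAt ends c₁ y γ := fun e' he' hce' =>
      hyγ he' (hnok e' γ (by simp [hγ]) hce')
    obtain ⟨c', hc', hdom', hk⟩ := extendsTo_of_fan (p := p) (ok := fun _ => True) kind hloop
      (hmult y) hc₁ h₁ hye (fun β _ => by
        rcases hβ : kind β with - | -
        · exact ⟨γ, hyγ', hγ⟩
        · exact htrue c₁ y e hye h₁ (hdeg y e hy).1)
      (fun e' z _ hz => by
        have := card_le_missing_add_of_degree_le (κ := κ) (c := c₁) ((hdeg y e hy).2 z e' hz)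
        simp only [true_and]
        omega)
    refine ⟨c', hc', fun e' => ?_, fun e' he' => ?_⟩
    · rw [hdom', hdom]
      rcases hr.cases_tail with rfl | ⟨_, _, _, _, _, _, _, _, h⟩
      · grind
      · constructor
        · rintro ⟨h1 | h1, h2⟩
          · exact h1
          · exact absurd h1 h2
        · rintro h1
          refine ⟨Or.inl h1, ?_⟩
          rintro rfl
          rw [h] at h1; cases h1.1
    · rw [hk e' (fun u hu huy => he' u hu (Or.inr ⟨e, by rw [huy]; exact hy⟩)), hoff]
      exact fun h => he' v h (Or.inl rfl)
  · push Not at hcase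
    obtain ⟨w, hw⟩ := hv
    have hdv := (hdeg w e₀ hw).2 v e₀ (hw.trans Sym2.eq_swap)
    obtain ⟨c', hc', hdom, hk⟩ := extendsTo_of_fan (p := p) (ok := fun β => kind β = true) kind
      hloop (hmult v) hc h₀ ⟨w, hw⟩
      (fun β hβ => by rw [hβ]; exact htrue c v e₀ ⟨w, hw⟩ h₀ hdv)
      (fun e y hr hy => by
        have := card_le_missing_add_of_degree_le (κ := κ) (c := c) (hdeg y e hy).1
        have heq : {β | kind β = true ∧ MissingAt ends c y β} = {β | MissingAt ends c y β} := by
          ext β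
          refine ⟨fun h => h.2, fun h => ⟨?_, h⟩⟩
          by_contra hb
          exact hcase e y β hr hy (by simpa using hb) h
        rw [heq]
        omega)
    exact ⟨c', hc', hdom, fun e he => hk e fun u hu huv => he u hu (Or.inl huv)⟩

/-- A partial edge coloring with colors of two kinds, such that every uncolored edge meets `Z`, can
be completed so that the kinds change only at edges close to `Z`, provided that the number of
colors of the second kind is at least the edge multiplicity, and the number of colors of the first
kind is at least the degree of the vertices close to `Z`. -/
theorem exists_complete_of_split [Finite V] [Finite E] [Finite κ] (kind : κ → Bool) {Z : Set V}
    {p q : ℕ} (hloop : ∀ e, ¬ (ends e).IsDiag)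
    (hmult : ∀ x y, {e | ends e = s(x, y)}.ncard ≤ p)
    (hp : {a | kind a = false}.ncard = p) (hq : Nat.card κ = q + p)
    (hdeg : ∀ v ∈ Z, ∀ y e, ends e = s(v, y) → {e | y ∈ ends e}.ncard ≤ q ∧
      ∀ z e', ends e' = s(y, z) → {e | z ∈ ends e}.ncard ≤ q) :
    ∀ c : E → Option κ, ProperPartial ends c → (∀ e, c e = none → ∃ v ∈ ends e, v ∈ Z) →
    ∃ g : E → κ, (∀ ⦃e e' v⦄, v ∈ ends e → v ∈ ends e' → g e = g e' → e = e') ∧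
      ∀ e, c e ≠ none → (∀ v ∈ ends e, v ∉ Z ∧ ∀ w ∈ Z, ∀ e', ends e' ≠ s(w, v)) →
        ∃ a, c e = some a ∧ kind (g e) = kind a := by
  intro c hc hZ
  induction hn : {e | c e = none}.ncard using Nat.strong_induction_on generalizing c with
  | _ n ih =>
  by_cases hall : ∀ e, c e ≠ none
  · choose g hg using fun e => Option.ne_none_iff_exists'.1 (hall e)
    refine ⟨g, fun e e' v hv hv' h => hc hv hv' (hg e) (by rw [hg e', h]), fun e _ _ => ?_⟩
    exact ⟨g e, hg e, rfl⟩
  · push Not at hall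
    obtain ⟨e₀, h₀⟩ := hall
    obtain ⟨v, hv, hvZ⟩ := hZ e₀ h₀
    obtain ⟨c', hc', hdom, hk⟩ := extendsTo_of_split kind hloop hmult hp hq (hdeg v hvZ) hc h₀ hv
    have hlt : {e | c' e = none}.ncard < n := by
      rw [← hn]
      refine Set.ncard_lt_ncard ⟨fun e he => ((hdom e).1 he).1, fun h => ?_⟩ (Set.toFinite _)
      exact ((hdom e₀).1 (h h₀)).2 rfl
    obtain ⟨g, hg, hgk⟩ := ih _ hlt c' hc' (fun e he => hZ e ((hdom e).1 he).1) rfl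
    refine ⟨g, hg, fun e he hfar => ?_⟩
    obtain ⟨a, ha, hga⟩ := hgk e (fun h => he ((hdom e).1 h).1) hfar
    have := hk e (by
      rintro u hu (rfl | ⟨e', he'⟩)
      · exact (hfar u hu).1 hvZ
      · exact (hfar u hu).2 v hvZ e' he')
    obtain ⟨b, hb⟩ := Option.ne_none_iff_exists'.1 he
    refine ⟨b, hb, hga.trans ?_⟩
    rw [ha, hb] at this
    simpa using this

end EdgeColoring

/-! ### Pasting two edge colorings in a zone of bounded width -/

section Paste

variable {V E : Type*} {ends : E → Sym2 V}

/-- On the set `A` of edges, the edge coloring `f` is proper. -/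
def ProperOn (ends : E → Sym2 V) (A : Set E) (f : E → ℕ) : Prop :=
  ∀ ⦃e e' v⦄, e ∈ A → e' ∈ A → v ∈ ends e → v ∈ ends e' → f e = f e' → e = e'

/-- The width of the zone that is needed to pass from one edge coloring with `K` colors to
another. -/
def pasteRadius : ℕ → ℕ
  | 0 => 2
  | K + 1 => 2 * pasteRadius K + 8

theorem pasteRadius_mono : Monotone pasteRadius :=
  monotone_nat_of_le_succ fun K => by simp only [pasteRadius]; omega

theorem two_le_pasteRadius (K : ℕ) : 2 ≤ pasteRadius K :=
  pasteRadius_mono (Nat.zero_le K)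

/-- In a zone of bounded width where two colorings `f` and `h` by `K` colors agree with prescribed
sets of colors, the first `p` color classes of `f` can be kept, and the first `p` color classes of
`h` be replaced by `p` additional colors, so that the remaining edges have a proper coloring with
`K - p` colors. -/
theorem exists_split_coloring [Finite V] [Finite E] {p q : ℕ} (hloop : ∀ e, ¬ (ends e).IsDiag)
    (hmult : ∀ x y, {e | ends e = s(x, y)}.ncard ≤ p) {d : E → ℕ}
    (hd : ∀ ⦃e e' v⦄, v ∈ ends e → v ∈ ends e' → d e ≤ d e' + 1) (A : Set E) (ℓ : ℕ)
    (f h : E → ℕ) (hf : ProperOn ends {e ∈ A | ℓ ≤ d e} f) (hfK : ∀ e ∈ A, ℓ ≤ d e → f e < q + p)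
    (hh : ProperOn ends A h) (hhK : ∀ e ∈ A, h e < q + p)
    (hfp : ∀ e ∈ A, ℓ ≤ d e → p ≤ f e) :
    ∃ g : E → ℕ, ProperOn ends A g ∧ (∀ e ∈ A, g e < q + p) ∧
      (∀ e ∈ A, d e ≤ ℓ → (g e < q ↔ p ≤ h e)) ∧ ∀ e ∈ A, ℓ + 6 ≤ d e → g e < q := by
  classical
  let ends' : A → Sym2 V := fun e => ends e
  let kind : Fin (q + p) → Bool := fun a => decide ((a : ℕ) < q)
  -- Below level `ℓ + 3` this is `h`, with its first p classes renamed to the p colors of kind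
  -- `false`. Above, it is `f` lowered by p, entirely of kind `true`. Levels of incident edges
  -- differ by at most one, so leaving out level `ℓ + 3` keeps the two apart.
  let c : A → Option (Fin (q + p)) := fun e =>
    if d e = ℓ + 3 then none
    else if hlt : d e < ℓ + 3 then
      if hp : h e < p then some ⟨q + h e, by omega⟩
      else some ⟨h e - p, by have := hhK e e.2; omega⟩
    else some ⟨f e - p, by have := hfK e e.2 (by omega); omega⟩
  have hcnone : ∀ e, c e = none ↔ d e = ℓ + 3 := by
    intro e
    simp only [c]
    split_ifs <;> simp_all
  have hclow : ∀ e : A, d e < ℓ + 3 → ∃ a, c e = some a ∧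
      ((h e < p ∧ (a : ℕ) = q + h e) ∨ (p ≤ h e ∧ (a : ℕ) = h e - p)) := by
    intro e he
    simp only [c]
    rw [if_neg (by omega), dif_pos he]
    split_ifs with hp
    · exact ⟨_, rfl, Or.inl ⟨hp, rfl⟩⟩
    · exact ⟨_, rfl, Or.inr ⟨by omega, rfl⟩⟩
  have hchigh : ∀ e : A, ℓ + 3 < d e → ∃ a, c e = some a ∧ (a : ℕ) = f e - p := by
    intro e he
    simp only [c]
    rw [if_neg (by omega), dif_neg (by omega)]
    exact ⟨_, rfl, rfl⟩
  have hc : ProperPartial ends' c := by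
    intro e e' v a hv hv' he he'
    have h1 := hd hv hv'
    have h2 := hd hv' hv
    have hn : d e ≠ ℓ + 3 := fun hh => by rw [(hcnone e).2 hh] at he; cases he
    have hn' : d e' ≠ ℓ + 3 := fun hh => by rw [(hcnone e').2 hh] at he'; cases he'
    rcases lt_or_gt_of_ne hn with hlt | hgt
    · obtain ⟨b, hb, hb'⟩ := hclow e hlt
      obtain ⟨b₁, hb₁, hb₁'⟩ := hclow e' (by omega)
      have hab : b = a := Option.some.inj (hb.symm.trans he)
      have hab₁ : b₁ = a := Option.some.inj (hb₁.symm.trans he')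
      subst hab; subst hab₁
      have h3 := hhK e e.2
      have h4 := hhK e' e'.2
      exact Subtype.ext (hh e.2 e'.2 hv hv' (by omega))
    · obtain ⟨b, hb, hb'⟩ := hchigh e hgt
      obtain ⟨b₁, hb₁, hb₁'⟩ := hchigh e' (by omega)
      have hab : b = a := Option.some.inj (hb.symm.trans he)
      have hab₁ : b₁ = a := Option.some.inj (hb₁.symm.trans he')
      subst hab; subst hab₁
      have h3 := hfp e e.2 (by omega)
      have h4 := hfp e' e'.2 (by omega)
      exact Subtype.ext (hf ⟨e.2, by omega⟩ ⟨e'.2, by omega⟩ hv hv' (by omega))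
  let Z : Set V := {v | ∃ e : A, v ∈ ends' e ∧ d e = ℓ + 3}
  have hmult' : ∀ x y, {e : A | ends' e = s(x, y)}.ncard ≤ p := by
    intro x y
    refine le_trans ?_ (hmult x y)
    rw [← Set.ncard_image_of_injective _ Subtype.val_injective]
    refine Set.ncard_le_ncard ?_ (Set.toFinite _)
    rintro _ ⟨e, he, rfl⟩
    exact he
  have hcardp : {a | kind a = false}.ncard = p := by
    have : {a | kind a = false} = Set.range (Fin.natAdd q : Fin p → Fin (q + p)) := by
      ext a
      simp only [kind, decide_eq_false_iff_not, not_lt, Set.mem_ofPred_eq, Set.mem_range]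
      constructor
      · intro ha
        exact ⟨⟨a - q, by omega⟩, Fin.ext (by simp; omega)⟩
      · rintro ⟨b, rfl⟩
        simp
    rw [this, ← Set.image_univ, Set.ncard_image_of_injective _ (Fin.natAdd_injective _ _),
      Set.ncard_univ, Nat.card_fin]
  -- Where all levels are at least `ℓ`, the edges at a vertex have different values of `f - p`, and
  -- there are only q such values.
  have hdegu : ∀ u : V, (∀ e : A, u ∈ ends' e → ℓ ≤ d e) → {e : A | u ∈ ends' e}.ncard ≤ q := by
    intro u hu
    have hinj : Set.InjOn (fun e : A => f e - p) {e : A | u ∈ ends' e} := by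
      intro e he e' he' hee
      have h3 := hfp e e.2 (hu e he)
      have h4 := hfp e' e'.2 (hu e' he')
      exact Subtype.ext (hf ⟨e.2, hu e he⟩ ⟨e'.2, hu e' he'⟩ he he' (by simp only at hee; omega))
    rw [← hinj.ncard_image]
    refine le_trans (Set.ncard_le_ncard (t := Set.Iio q) ?_ (Set.finite_Iio q)) ?_
    · rintro _ ⟨e, he, rfl⟩
      have h3 := hfp e e.2 (hu e he)
      have h4 := hfK e e.2 (hu e he)
      simp only [Set.mem_Iio]
      omega
    · rw [Set.ncard_eq_toFinset_card']
      simp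
  obtain ⟨g, hg, hgk⟩ := exists_complete_of_split (ends := ends') (q := q) (Z := Z) kind (fun e => hloop e) hmult' hcardp
    (by simp) (by
      -- Each step away from `Z` costs one level: the edges at `v` have level at least `ℓ + 2`,
      -- those at `y` at least `ℓ + 1`, those at `z` at least `ℓ`.
      rintro v ⟨e₀, hv₀, hd₀⟩ y e he
      have h1 := hd (e := e₀) (e' := e) hv₀ (show v ∈ ends' e by simp [he])
      have hye : y ∈ ends' e := by simp [he]
      refine ⟨hdegu y fun e₁ he₁ => ?_, fun z e' he' => hdegu z fun e₁ he₁ => ?_⟩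
      · have h2 := hd (e := e) (e' := e₁) hye he₁
        omega
      · have h2 := hd (e := e) (e' := e') hye (show y ∈ ends' e' by simp [he'])
        have h3 := hd (e := e') (e' := e₁) (show z ∈ ends' e' by simp [he']) he₁
        omega) c hc (by
      intro e he
      have hv : (Quot.out (ends' e)).1 ∈ ends' e := Sym2.out_fst_mem _
      exact ⟨_, hv, e, hv, (hcnone e).1 he⟩)
  -- An edge that meets `Z` or a neighbor of `Z` has a level between `ℓ + 1` and `ℓ + 5`; all other
  -- edges keep their kinds.
  have hfar : ∀ e : A, (d e ≤ ℓ ∨ ℓ + 6 ≤ d e) → ∃ a, c e = some a ∧ kind (g e) = kind a := by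
    intro e he
    refine hgk e (fun h => by have := (hcnone e).1 h; omega) fun v hv => ⟨?_, ?_⟩
    · rintro ⟨e₀, hv₀, hd₀⟩
      have h1 := hd (e := e₀) (e' := e) hv₀ hv
      have h2 := hd (e := e) (e' := e₀) hv hv₀
      omega
    · rintro w ⟨e₀, hw₀, hd₀⟩ e' he'
      have hwe' : w ∈ ends' e' := by simp [he']
      have hve' : v ∈ ends' e' := by simp [he']
      have h1 := hd (e := e₀) (e' := e') hw₀ hwe'
      have h2 := hd (e := e') (e' := e₀) hwe' hw₀
      have h3 := hd (e := e) (e' := e') hv hve'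
      have h4 := hd (e := e') (e' := e) hve' hv
      omega
  obtain ⟨g', hg'⟩ : ∃ g' : E → ℕ, ∀ e (he : e ∈ A), g' e = g ⟨e, he⟩ :=
    ⟨fun e => if he : e ∈ A then (g ⟨e, he⟩ : ℕ) else 0, fun e he => dif_pos he⟩
  refine ⟨g', ?_, ?_, ?_, ?_⟩
  · intro e e' v he he' hv hv' hee
    rw [hg' e he, hg' e' he'] at hee
    exact congrArg Subtype.val (hg (e := ⟨e, he⟩) (e' := ⟨e', he'⟩) hv hv' (Fin.ext hee))
  · intro e he
    rw [hg' e he]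
    exact (g ⟨e, he⟩).2
  · intro e he hde
    rw [hg' e he]
    obtain ⟨a, ha, hka⟩ := hfar ⟨e, he⟩ (Or.inl hde)
    obtain ⟨b, hb, hb'⟩ := hclow ⟨e, he⟩ (by simp only; omega)
    have hab : b = a := Option.some.inj (hb.symm.trans ha)
    subst hab
    simp only [kind, decide_eq_decide] at hka
    have := hhK e he
    simp only at hb'
    omega
  · intro e he hde
    rw [hg' e he]
    obtain ⟨a, ha, hka⟩ := hfar ⟨e, he⟩ (Or.inr hde)
    obtain ⟨b, hb, hb'⟩ := hchigh ⟨e, he⟩ (by simp only; omega)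
    have hab : b = a := Option.some.inj (hb.symm.trans ha)
    subst hab
    simp only [kind, decide_eq_decide] at hka
    have h3 := hfp e he (by omega)
    have h4 := hfK e he (by omega)
    simp only at hb'
    omega

/-- Two proper edge colorings with `K` colors can be pasted together in a zone of bounded width,
where `p` additional colors may be used. -/
theorem exists_paste [Finite V] [Finite E] {p : ℕ} (hp : 1 ≤ p) (hloop : ∀ e, ¬ (ends e).IsDiag)
    (hmult : ∀ x y, {e | ends e = s(x, y)}.ncard ≤ p) {d : E → ℕ}
    (hd : ∀ ⦃e e' v⦄, v ∈ ends e → v ∈ ends e' → d e ≤ d e' + 1) (K : ℕ) :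
    ∀ (A : Set E) (L R : ℕ) (f h : E → ℕ), pasteRadius K ≤ R →
      ProperOn ends {e ∈ A | L < d e} f → (∀ e ∈ A, L < d e → f e < K) →
      ProperOn ends A h → (∀ e ∈ A, h e < K) →
      ∃ g : E → ℕ, ProperOn ends A g ∧ (∀ e ∈ A, g e < K + p) ∧
        (∀ e ∈ A, d e ≤ L → g e = h e) ∧ ∀ e ∈ A, L + R ≤ d e → g e = f e := by
  classical
  induction K using Nat.strong_induction_on with
  | _ K ih =>
  intro A L R f h hR hf hfK hh hhK
  by_cases hKp : K ≤ p
  · have h2 := two_le_pasteRadius K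
    -- The edges of level `L + 1` separate `h` from `f`. The colors of `f` raised by K are disjoint
    -- from those of `f` and `h`, and they stay below `K + p` because `K ≤ p`.
    refine ⟨fun e => if d e ≤ L then h e else if d e = L + 1 then K + f e else f e, ?_, ?_, ?_, ?_⟩
    · intro e e' v he he' hv hv' hee
      have h3 := hd hv hv'
      have h4 := hd hv' hv
      have h5 := hhK e he
      have h6 := hhK e' he'
      have h7 := hfK e he
      have h8 := hfK e' he'
      simp only at hee
      split_ifs at hee
      · exact hh he he' hv hv' hee
      all_goals
        exact hf ⟨he, show L < d e by omega⟩ ⟨he', show L < d e' by omega⟩ hv hv' (by omega)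
    · intro e he
      have h5 := hhK e he
      have h7 := hfK e he
      simp only
      split_ifs <;> omega
    · intro e he hde
      simp only
      rw [if_pos hde]
    · intro e he hde
      simp only
      rw [if_neg (by omega), if_neg (by omega)]
  · obtain ⟨q, rfl⟩ : ∃ q, K = q + p := ⟨K - p, by omega⟩
    obtain ⟨m, hm⟩ : ∃ m, q + p = m + 1 := ⟨q + p - 1, by omega⟩
    have hqm : pasteRadius q ≤ pasteRadius m := pasteRadius_mono (by omega)
    rw [hm, pasteRadius] at hR
    set R' := pasteRadius m with hR'
    have hR2 : 2 ≤ R' := two_le_pasteRadius m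
    -- The zone has three parts: `R'` levels to pass from `h` to `G`, eight levels around the strip
    -- where `G` sheds its upper classes, and `R'` levels to pass from `G` to `f`; this gives `2 *
    -- R' + 8`. The edges of `P` keep their `f`-colors below p. They begin at level `L + R' + 2`, so
    -- that they do not meet the edges of level at most `L + R'`, where `h` is still using these
    -- colors.
    let P : Set E := {e | f e < p ∧ L + R' + 2 ≤ d e}
    obtain ⟨G, hG, hGK, hGlow, hGhigh⟩ := exists_split_coloring (p := p) (q := q) hloop hmult hd
      (A \ P) (L + R' + 2) f h
      (fun e e' v he he' => hf ⟨he.1.1, show L < d e by have : L + R' + 2 ≤ d e := he.2; omega⟩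
        ⟨he'.1.1, show L < d e' by have : L + R' + 2 ≤ d e' := he'.2; omega⟩)
      (fun e he hde => hfK e he.1 (by omega)) (fun e e' v he he' => hh he.1 he'.1)
      (fun e he => hhK e he.1) (fun e he hde => by
        by_contra hlt
        exact he.2 ⟨by omega, hde⟩)
    -- Both recursive calls concern only edges with `G e < q`. Here `G` is the lower coloring and `f
    -- - p` the upper one; in the next call these are `h - p` and `G`.
    obtain ⟨g₁, hg₁, hg₁K, hg₁low, hg₁high⟩ := ih q (by omega)
      {e ∈ A \ P | G e < q ∧ L + R' + 8 ≤ d e} (L + R' + 8) R' (fun e => f e - p) G hqm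
      (by
        rintro e e' v ⟨he, hde⟩ ⟨he', hde'⟩ hv hv' hee
        have h1 : p ≤ f e := by
          by_contra hlt
          exact he.1.2 ⟨by omega, by omega⟩
        have h2 : p ≤ f e' := by
          by_contra hlt
          exact he'.1.2 ⟨by omega, by omega⟩
        simp only at hee
        exact hf ⟨he.1.1, by omega⟩ ⟨he'.1.1, by omega⟩ hv hv' (by omega))
      (fun e he hde => by
        have h1 : p ≤ f e := by
          by_contra hlt
          exact he.1.2 ⟨by omega, by omega⟩
        have := hfK e he.1.1 (by omega)
        omega)
      (fun e e' v he he' => hG he.1 he'.1) (fun e he => he.2.1)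
    obtain ⟨g₂, hg₂, hg₂K, hg₂low, hg₂high⟩ := ih q (by omega)
      {e ∈ A \ P | G e < q ∧ d e ≤ L + R'} L R' G (fun e => h e - p) hqm
      (fun e e' v he he' => hG he.1.1 he'.1.1) (fun e he _ => he.2.1)
      (by
        rintro e e' v he he' hv hv' hee
        have h1 := (hGlow e he.1 (by have := he.2.2; omega)).1 he.2.1
        have h2 := (hGlow e' he'.1 (by have := he'.2.2; omega)).1 he'.2.1
        simp only at hee
        exact hh he.1.1 he'.1.1 hv hv' (by omega))
      (fun e he => by
        have h1 := (hGlow e he.1 (by have := he.2.2; omega)).1 he.2.1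
        have := hhK e he.1.1
        omega)
    let cc : E → ℕ := fun e =>
      if L + R' + 8 ≤ d e then g₁ e else if d e ≤ L + R' then g₂ e else G e
    have hcc : ∀ e ∈ A \ P, G e < q → L + R' ≤ d e → d e ≤ L + R' + 8 → cc e = G e := by
      intro e he hGe h1 h2
      simp only [cc]
      split_ifs with h3 h4
      · exact hg₁low e ⟨he, hGe, h3⟩ h2
      · exact hg₂high e ⟨he, hGe, h4⟩ h1
      · rfl
    have hccq : ∀ e ∈ A \ P, G e < q → cc e < q + p ∧
        (q ≤ cc e → d e < L + R' ∨ L + R' + 8 < d e) := by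
      intro e he hGe
      constructor
      · simp only [cc]
        split_ifs with h3 h4
        · exact hg₁K e ⟨he, hGe, h3⟩
        · exact hg₂K e ⟨he, hGe, h4⟩
        · omega
      · intro hq
        by_contra hno
        rw [hcc e he hGe (by omega) (by omega)] at hq
        omega
    have hccproper : ∀ ⦃e e' v⦄, e ∈ A \ P → e' ∈ A \ P → G e < q → G e' < q → v ∈ ends e →
        v ∈ ends e' → cc e = cc e' → e = e' := by
      intro e e' v he he' hGe hGe' hv hv' hee
      have h3 := hd hv hv'
      have h4 := hd hv' hv
      by_cases h5 : L + R' + 8 ≤ d e ∧ L + R' + 8 ≤ d e'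
      · simp only [cc] at hee
        rw [if_pos h5.1, if_pos h5.2] at hee
        exact hg₁ ⟨he, hGe, h5.1⟩ ⟨he', hGe', h5.2⟩ hv hv' hee
      by_cases h6 : d e ≤ L + R' ∧ d e' ≤ L + R'
      · simp only [cc] at hee
        rw [if_neg (by omega), if_pos h6.1, if_neg (by omega), if_pos h6.2] at hee
        exact hg₂ ⟨he, hGe, h6.1⟩ ⟨he', hGe', h6.2⟩ hv hv' hee
      rw [hcc e he hGe (by omega) (by omega), hcc e' he' hGe' (by omega) (by omega)] at hee
      exact hG he he' hv hv' hee
    -- The colors below p serve for `P` and for the first p classes of `h`. In the middle the upper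
    -- classes of `G` move to the top p colors, from `q + p` on; everything else is `cc + p`. The
    -- latter reaches the top colors only where `cc` is at least q, that is, outside the levels from
    -- `L + R'` to `L + R' + 8`, and hence not next to an edge of the middle.
    let g : E → ℕ := fun e =>
      if e ∈ P then f e else if q ≤ G e then (if d e ≤ L + R' then h e else p + G e)
      else cc e + p
    have hcases : ∀ e ∈ A, (e ∈ P ∧ g e = f e) ∨
        (e ∈ A \ P ∧ q ≤ G e ∧ d e ≤ L + R' ∧ g e = h e ∧ h e < p) ∨
        (e ∈ A \ P ∧ q ≤ G e ∧ L + R' < d e ∧ d e < L + R' + 8 ∧ g e = p + G e) ∨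
        (e ∈ A \ P ∧ G e < q ∧ g e = cc e + p) := by
      intro e he
      by_cases hP : e ∈ P
      · exact Or.inl ⟨hP, if_pos hP⟩
      refine Or.inr ?_
      have hg' : g e = if q ≤ G e then (if d e ≤ L + R' then h e else p + G e) else cc e + p :=
        if_neg hP
      by_cases hq : q ≤ G e
      · rw [if_pos hq] at hg'
        by_cases hde : d e ≤ L + R'
        · rw [if_pos hde] at hg'
          have := hGlow e ⟨he, hP⟩ (by omega)
          exact Or.inl ⟨⟨he, hP⟩, hq, hde, hg', by omega⟩
        · rw [if_neg hde] at hg'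
          refine Or.inr (Or.inl ⟨⟨he, hP⟩, hq, by omega, ?_, hg'⟩)
          by_contra hge
          have := hGhigh e ⟨he, hP⟩ (by omega)
          omega
      · rw [if_neg hq] at hg'
        exact Or.inr (Or.inr ⟨⟨he, hP⟩, by omega, hg'⟩)
    refine ⟨g, ?_, ?_, ?_, ?_⟩
    · intro e e' v he he' hv hv' hee
      have h3 := hd hv hv'
      have h4 := hd hv' hv
      rcases hcases e he with ⟨hP, hge⟩ | ⟨hP, hGe, hde, hge, hhe⟩ | ⟨hP, hGe, hde, hde2, hge⟩ |
          ⟨hP, hGe, hge⟩ <;>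
        rcases hcases e' he' with ⟨hP', hge'⟩ | ⟨hP', hGe', hde', hge', hhe'⟩ |
          ⟨hP', hGe', hde', hde2', hge'⟩ | ⟨hP', hGe', hge'⟩
      · exact hf ⟨he, by have := hP.2; omega⟩ ⟨he', by have := hP'.2; omega⟩ hv hv' (by omega)
      · have := hP.2; omega
      · have := hP.1; omega
      · have := hP.1; omega
      · have := hP'.2; omega
      · exact hh he he' hv hv' (by omega)
      · omega
      · omega
      · have := hP'.1; omega
      · omega
      · exact hG hP hP' hv hv' (by omega)
      · have := (hccq e' hP' hGe').2 (by omega); omega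
      · have := hP'.1; omega
      · omega
      · have := (hccq e hP hGe).2 (by omega); omega
      · exact hccproper hP hP' hGe hGe' hv hv' (by omega)
    · intro e he
      rcases hcases e he with ⟨hP, hge⟩ | ⟨hP, hGe, hde, hge, hhe⟩ | ⟨hP, hGe, hde, hde2, hge⟩ |
          ⟨hP, hGe, hge⟩
      · have := hP.1; omega
      · omega
      · have := hGK e hP; omega
      · have := (hccq e hP hGe).1; omega
    · intro e he hde
      rcases hcases e he with ⟨hP, hge⟩ | ⟨hP, hGe, hde', hge, hhe⟩ | ⟨hP, hGe, hde', hde2, hge⟩ |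
          ⟨hP, hGe, hge⟩
      · have := hP.2; omega
      · exact hge
      · omega
      · have h1 := (hGlow e hP (by omega)).1 hGe
        have h2 := hg₂low e ⟨hP, hGe, by omega⟩ hde
        rw [hge]
        simp only [cc]
        rw [if_neg (by omega), if_pos (by omega), h2]
        omega
    · intro e he hde
      rcases hcases e he with ⟨hP, hge⟩ | ⟨hP, hGe, hde', hge, hhe⟩ | ⟨hP, hGe, hde', hde2, hge⟩ |
          ⟨hP, hGe, hge⟩
      · exact hge
      · omega
      · omega
      · have h1 : p ≤ f e := by
          by_contra hlt
          exact hP.2 ⟨by omega, by omega⟩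
        have h2 := hg₁high e ⟨hP, hGe, by omega⟩ (by omega)
        rw [hge]
        simp only [cc]
        rw [if_pos (by omega), h2]
        omega

end Paste

/-! ### Colex-least functions and the exchange principle -/

section Colex

variable {S S' : Type*} [LinearOrder S] [LinearOrder S']

/-- The function `c` satisfies `P`, has values less than `B` on the set `A` of slots, and among
these functions, it has the least values, where larger slots matter more. -/
def IsColexLeast (A : Set S) (B : ℕ) (P : (S → ℕ) → Prop) (c : S → ℕ) : Prop :=
  P c ∧ (∀ a ∈ A, c a < B) ∧ ∀ c', P c' → (∀ a ∈ A, c' a < B) →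
    ∀ a ∈ A, (∀ b ∈ A, a < b → c' b = c b) → c a ≤ c' a

open Classical in
/-- If two colex-least functions can be exchanged on a set of slots, then they agree there. -/
theorem IsColexLeast.eqOn_of_exchange {A₁ A₂ : Set S} {B : ℕ} {P₁ P₂ : (S → ℕ) → Prop}
    {c₁ c₂ : S → ℕ} (h₁ : IsColexLeast A₁ B P₁ c₁) (h₂ : IsColexLeast A₂ B P₂ c₂) {X : Set S}
    (hX : X.Finite) (hX₁ : X ⊆ A₁) (hX₂ : X ⊆ A₂) (hP₁ : P₁ (X.piecewise c₂ c₁))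
    (hP₂ : P₂ (X.piecewise c₁ c₂)) : Set.EqOn c₁ c₂ X := by
  by_contra hne
  simp only [Set.EqOn] at hne
  push Not at hne
  have hne' : {a ∈ X | c₁ a ≠ c₂ a}.Nonempty := hne
  -- At the largest slot of `X` where they differ, each exchanged function competes with the
  -- original one and agrees with it at all larger slots. So each of the two values is at most the
  -- other.
  obtain ⟨a, ⟨haX, ha⟩, hmax⟩ :=
    (hX.subset (Set.sep_subset X _)).exists_maximal hne'
  have heq : ∀ b ∈ X, a < b → c₁ b = c₂ b := by
    intro b hb hab
    by_contra hne
    exact absurd (hmax ⟨hb, hne⟩ hab.le) (not_le.2 hab)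
  have key : ∀ {A : Set S} {P : (S → ℕ) → Prop} {c d : S → ℕ}, IsColexLeast A B P c →
      (∀ b ∈ X, d b < B) → X ⊆ A → P (X.piecewise d c) → (∀ b ∈ X, a < b → c b = d b) →
      c a ≤ d a := by
    intro A P c d h hd hXA hP heq
    have := h.2.2 _ hP (fun b hb => ?_) a (hXA haX) (fun b hb hab => ?_)
    · rwa [Set.piecewise_eq_of_mem _ _ _ haX] at this
    · by_cases hbX : b ∈ X
      · rw [Set.piecewise_eq_of_mem _ _ _ hbX]
        exact hd b hbX
      · rw [Set.piecewise_eq_of_notMem _ _ _ hbX]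
        exact h.2.1 b hb
    · by_cases hbX : b ∈ X
      · rw [Set.piecewise_eq_of_mem _ _ _ hbX]
        exact (heq b hbX hab).symm
      · rw [Set.piecewise_eq_of_notMem _ _ _ hbX]
  exact ha (le_antisymm
    (key h₁ (fun b hb => h₂.2.1 b (hX₂ hb)) hX₁ hP₁ heq)
    (key h₂ (fun b hb => h₁.2.1 b (hX₁ hb)) hX₂ hP₂ fun b hb hab => (heq b hb hab).symm))

/-- Transport of colex-least functions along an order isomorphism of the sets of slots. -/
theorem IsColexLeast.comp {A : Set S} {A' : Set S'} {B : ℕ} {P : (S → ℕ) → Prop}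
    {P' : (S' → ℕ) → Prop} {c : S' → ℕ} (h : IsColexLeast A' B P' c) {φ : S → S'} {ψ : S' → S}
    (hφ : ∀ a ∈ A, φ a ∈ A') (hψ : ∀ a ∈ A', ψ a ∈ A) (hψφ : ∀ a ∈ A, ψ (φ a) = a)
    (hφψ : ∀ a ∈ A', φ (ψ a) = a) (hmono : ∀ a ∈ A, ∀ b ∈ A, a < b → φ a < φ b)
    (hP : P' c → P (c ∘ φ)) (hP' : ∀ d, P d → P' (d ∘ ψ)) : IsColexLeast A B P (c ∘ φ) := by
  refine ⟨hP h.1, fun a ha => h.2.1 _ (hφ a ha), fun d hd hdB a ha heq => ?_⟩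
  have := h.2.2 _ (hP' d hd) (fun b hb => hdB _ (hψ b hb)) (φ a) (hφ a ha) (fun b hb hab => ?_)
  · simpa [hψφ a ha] using this
  · have hlt : a < ψ b := by
      rcases lt_trichotomy a (ψ b) with h1 | h1 | h1
      · exact h1
      · rw [h1, hφψ b hb] at hab
        exact absurd hab (lt_irrefl _)
      · have := hmono _ (hψ b hb) _ ha h1
        rw [hφψ b hb] at this
        exact absurd (hab.trans this) (lt_irrefl _)
    have := heq _ (hψ b hb) hlt
    simpa [hφψ b hb] using this

theorem exists_digits_eq {B : ℕ} (d : ℕ → ℕ) (t : ℕ) (hd : ∀ u < t, d u < B) :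
    ∃ v < B ^ t, ∀ u < t, v / B ^ u % B = d u := by
  induction t with
  | zero => exact ⟨0, by simp, by simp⟩
  | succ t ih =>
    obtain ⟨v, hv, hvd⟩ := ih fun u hu => hd u (by omega)
    have hB : 0 < B := Nat.zero_lt_of_lt (hd t (by omega))
    have hdt := hd t (by omega)
    refine ⟨v + B ^ t * d t, ?_, fun u hu => ?_⟩
    · calc v + B ^ t * d t < B ^ t + B ^ t * d t := by omega
        _ = B ^ t * (d t + 1) := by ring
        _ ≤ B ^ t * B := Nat.mul_le_mul_left _ hdt
        _ = B ^ (t + 1) := by ring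
    · rcases Nat.lt_succ_iff_lt_or_eq.1 hu with hu | rfl
      · obtain ⟨a, rfl⟩ : ∃ a, t = u + (a + 1) := ⟨t - u - 1, by omega⟩
        have : v + B ^ (u + (a + 1)) * d (u + (a + 1)) =
            v + B ^ u * (B * (B ^ a * d (u + (a + 1)))) := by ring
        rw [this, Nat.add_mul_div_left _ _ (pow_pos hB u), Nat.add_mul_mod_self_left]
        exact hvd u hu
      · rw [Nat.add_mul_div_left _ _ (pow_pos hB u), Nat.div_eq_of_lt hv, zero_add,
          Nat.mod_eq_of_lt hdt]

/-- The digits of the least number whose digits satisfy `P` are colex-least. -/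
theorem isColexLeast_digits {N B w : ℕ} {P : (ℕ → ℕ) → Prop} (hB : 0 < B)
    (hcongr : ∀ c c', (∀ t < N, c t = c' t) → P c → P c')
    (hP : P fun t => w / B ^ t % B)
    (hmin : ∀ w' < w, ¬ P fun t => w' / B ^ t % B) :
    IsColexLeast (Set.Iio N) B P fun t => w / B ^ t % B := by
  refine ⟨hP, fun t _ => Nat.mod_lt _ hB, fun c hc hcB t ht heq => ?_⟩
  by_contra hlt
  push Not at hlt
  obtain ⟨v, hv, hvd⟩ := exists_digits_eq c t fun u hu => hcB u (lt_trans hu ht)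
  have hpt := pow_pos hB t
  have hlow : v + B ^ t * c t < B ^ (t + 1) := by
    have : c t + 1 ≤ B := hcB t ht
    calc v + B ^ t * c t < B ^ t + B ^ t * c t := by omega
        _ = B ^ t * (c t + 1) := by ring
        _ ≤ B ^ t * B := Nat.mul_le_mul_left _ this
        _ = B ^ (t + 1) := by ring
  -- The digits of `c` up to position t, followed by those of `w`. Its digit at t is smaller than
  -- that of `w`, hence so is the number.
  set w' := v + B ^ t * c t + B ^ (t + 1) * (w / B ^ (t + 1)) with hw'
  have hdiv : w' / B ^ (t + 1) = w / B ^ (t + 1) := by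
    rw [hw', Nat.add_mul_div_left _ _ (pow_pos hB _), Nat.div_eq_of_lt hlow, zero_add]
  have hlt' : w' < w := by
    have h1 : w / B ^ t / B = w / B ^ (t + 1) := by rw [Nat.div_div_eq_div_mul, pow_succ]
    have h2 := Nat.div_add_mod w (B ^ t)
    have h3 := Nat.div_add_mod (w / B ^ t) B
    rw [h1] at h3
    calc w' < B ^ t + B ^ t * c t + B ^ (t + 1) * (w / B ^ (t + 1)) := by omega
      _ = B ^ t * (c t + 1 + B * (w / B ^ (t + 1))) := by ring
      _ ≤ B ^ t * (w / B ^ t % B + B * (w / B ^ (t + 1))) := Nat.mul_le_mul_left _ (by omega)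
      _ = B ^ t * (w / B ^ t) := by rw [add_comm, h3]
      _ ≤ w := Nat.mul_div_le w _
  refine hmin w' hlt' (hcongr c _ (fun u hu => ?_) hc)
  rcases lt_trichotomy u t with h | rfl | h
  · obtain ⟨a, rfl⟩ : ∃ a, t = u + (a + 1) := ⟨t - u - 1, by omega⟩
    have : w' = v + B ^ u * (B * (B ^ a * c (u + (a + 1)) +
        B ^ (a + 1) * (w / B ^ (u + (a + 1) + 1)))) := by rw [hw']; ring
    rw [this, Nat.add_mul_div_left _ _ (pow_pos hB u), Nat.add_mul_mod_self_left]
    exact (hvd u h).symm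
  · have : w' = v + B ^ u * (c u + B * (w / B ^ (u + 1))) := by rw [hw']; ring
    rw [this, Nat.add_mul_div_left _ _ (pow_pos hB u), Nat.div_eq_of_lt hv, zero_add,
      Nat.add_mul_mod_self_left, Nat.mod_eq_of_lt (hcB u ht)]
  · obtain ⟨a, rfl⟩ : ∃ a, u = t + 1 + a := ⟨u - (t + 1), by omega⟩
    rw [heq _ hu h]
    simp only
    rw [pow_add, ← Nat.div_div_eq_div_mul, ← Nat.div_div_eq_div_mul, hdiv]

end Colex

/-! ### Admissible colorings of a stage, admissible names, and their existence -/

section Stages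

variable {V V' : Type*}

/-- `Near W E p pt i t x`: in the part `W` of the graph, the vertex `x` has distance at most `t`
from the vertices whose part is less than `i`. -/
def Near (W : Set V) (E : V → V → ℕ → Prop) (p : ℕ) (pt : V → ℕ) (i : ℕ) : ℕ → V → Prop
  | 0, x => x ∈ W ∧ pt x < i
  | t + 1, x => Near W E p pt i t x ∨
      (x ∈ W ∧ ∃ y ∈ W, (∃ j < p, E x y j) ∧ Near W E p pt i t y)

/-- The edges with both ends in `D` are properly colored with `K` colors by `c`, and `c` extends
the coloring `prev` of the edges with both ends in `F`. -/
def StageValid (W : Set V) (E : V → V → ℕ → Prop) (p : ℕ) (D F : V → Prop) (K : ℕ)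
    (prev c : V → V → ℕ → ℕ) : Prop :=
  ∀ x ∈ W, ∀ y ∈ W, ∀ j < p, E x y j → D x → D y →
    c x y j < K ∧ c x y j = c y x j ∧ (F x → F y → c x y j = prev x y j) ∧
    ∀ y' ∈ W, ∀ j' < p, E x y' j' → D y' → c x y j = c x y' j' → y = y' ∧ j = j'

/-- The numbers `c x x 0` are less than `K`, and they distinguish any two vertices in the same part
that have a common neighbor. -/
def NameValid (W : Set V) (E : V → V → ℕ → Prop) (p : ℕ) (pt : V → ℕ) (K : ℕ)
    (c : V → V → ℕ → ℕ) : Prop :=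
  ∀ x ∈ W, c x x 0 < K ∧ ∀ y ∈ W, x ≠ y → pt x = pt y →
    (∃ z ∈ W, (∃ j < p, E z x j) ∧ ∃ j < p, E z y j) → c x x 0 ≠ c y y 0

variable {W : Set V} {W' : Set V'} {E : V → V → ℕ → Prop} {E' : V' → V' → ℕ → Prop} {p : ℕ}
  {pt : V → ℕ} {pt' : V' → ℕ} {i t : ℕ}

theorem not_near_zero {x : V} : ¬ Near W E p pt 0 t x := by
  induction t generalizing x with
  | zero => exact fun h => absurd h.2 (Nat.not_lt_zero _)
  | succ t ih =>
    rintro (h | ⟨-, y, -, -, h⟩)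
    · exact ih h
    · exact ih h

theorem Near.mono {t' : ℕ} (ht : t ≤ t') {x : V} (h : Near W E p pt i t x) :
    Near W E p pt i t' x := by
  induction ht with
  | refl => exact h
  | step _ ih => exact Or.inl ih

theorem near_map {φ : V → V'} (hφ : Set.SurjOn φ W W') (hmem : ∀ x ∈ W, φ x ∈ W')
    (hE : ∀ x ∈ W, ∀ y ∈ W, ∀ j, E x y j ↔ E' (φ x) (φ y) j)
    (hpt : ∀ x ∈ W, pt x = pt' (φ x)) {x : V} (hx : x ∈ W) :
    Near W E p pt i t x ↔ Near W' E' p pt' i t (φ x) := by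
  induction t generalizing x with
  | zero => simp only [Near, hx, hmem x hx, hpt x hx]
  | succ t ih =>
    simp only [Near, hx, hmem x hx, true_and]
    refine or_congr (ih hx) ⟨?_, ?_⟩
    · rintro ⟨y, hy, ⟨j, hj, he⟩, h⟩
      exact ⟨φ y, hmem y hy, ⟨j, hj, (hE x hx y hy j).1 he⟩, (ih hy).1 h⟩
    · rintro ⟨y', hy', ⟨j, hj, he⟩, h⟩
      obtain ⟨y, hy, rfl⟩ := hφ hy'
      exact ⟨y, hy, ⟨j, hj, (hE x hx y hy j).2 he⟩, (ih hy).2 h⟩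

/-- Validity is a universal statement about vertices of the window, so it is pulled back along
injections. This serves to pass between a window and its numbering, in both directions, and with the
identity it shows that only the values on the window matter. -/
theorem StageValid.comp {φ : V → V'} (hmem : ∀ x ∈ W, φ x ∈ W') (hinj : Set.InjOn φ W)
    (hE : ∀ x ∈ W, ∀ y ∈ W, ∀ j, E x y j ↔ E' (φ x) (φ y) j) {D F : V → Prop} {D' F' : V' → Prop}
    (hD : ∀ x ∈ W, D x ↔ D' (φ x)) (hF : ∀ x ∈ W, F x ↔ F' (φ x)) {K : ℕ}
    {prev c : V → V → ℕ → ℕ} {prev' c' : V' → V' → ℕ → ℕ}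
    (hprev : ∀ x ∈ W, ∀ y ∈ W, ∀ j < p, prev x y j = prev' (φ x) (φ y) j)
    (hc : ∀ x ∈ W, ∀ y ∈ W, ∀ j < p, c x y j = c' (φ x) (φ y) j)
    (h : StageValid W' E' p D' F' K prev' c') : StageValid W E p D F K prev c := by
  intro x hx y hy j hj he hDx hDy
  obtain ⟨h1, h2, h3, h4⟩ := h _ (hmem x hx) _ (hmem y hy) j hj ((hE x hx y hy j).1 he)
    ((hD x hx).1 hDx) ((hD y hy).1 hDy)
  rw [hc x hx y hy j hj, hc y hy x hx j hj, hprev x hx y hy j hj]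
  refine ⟨h1, h2, fun hFx hFy => h3 ((hF x hx).1 hFx) ((hF y hy).1 hFy), ?_⟩
  intro y' hy' j' hj' he' hDy' heq
  rw [hc x hx y' hy' j' hj'] at heq
  obtain ⟨h5, h6⟩ := h4 _ (hmem y' hy') j' hj' ((hE x hx y' hy' j').1 he') ((hD y' hy').1 hDy') heq
  exact ⟨hinj hy hy' h5, h6⟩

theorem NameValid.comp {φ : V → V'} (hmem : ∀ x ∈ W, φ x ∈ W') (hinj : Set.InjOn φ W)
    (hE : ∀ x ∈ W, ∀ y ∈ W, ∀ j, E x y j ↔ E' (φ x) (φ y) j)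
    (hpt : ∀ x ∈ W, pt x = pt' (φ x)) {K : ℕ} {c : V → V → ℕ → ℕ} {c' : V' → V' → ℕ → ℕ}
    (hc : ∀ x ∈ W, c x x 0 = c' (φ x) (φ x) 0)
    (h : NameValid W' E' p pt' K c') : NameValid W E p pt K c := by
  intro x hx
  rw [hc x hx]
  refine ⟨(h _ (hmem x hx)).1, ?_⟩
  rintro y hy hxy hpxy ⟨z, hz, ⟨j, hj, he⟩, j', hj', he'⟩
  rw [hc y hy]
  exact (h _ (hmem x hx)).2 _ (hmem y hy) (fun h => hxy (hinj hx hy h))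
    (by rw [← hpt x hx, ← hpt y hy, hpxy])
    ⟨_, hmem z hz, ⟨j, hj, (hE z hz x hx j).1 he⟩, j', hj', (hE z hz y hy j').1 he'⟩

theorem StageValid.congr {D F : V → Prop} {K : ℕ} {prev c c' : V → V → ℕ → ℕ}
    (hc : ∀ x ∈ W, ∀ y ∈ W, ∀ j < p, c x y j = c' x y j) (h : StageValid W E p D F K prev c) :
    StageValid W E p D F K prev c' :=
  h.comp (φ := id) (fun _ hx => hx) (Set.injOn_id _) (fun _ _ _ _ _ => Iff.rfl) (fun _ _ => Iff.rfl)
    (fun _ _ => Iff.rfl) (fun _ _ _ _ _ _ => rfl) fun x hx y hy j hj => (hc x hx y hy j hj).symm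

theorem NameValid.congr {K : ℕ} {c c' : V → V → ℕ → ℕ} (hc : ∀ x ∈ W, c x x 0 = c' x x 0)
    (h : NameValid W E p pt K c) : NameValid W E p pt K c' :=
  h.comp (φ := id) (fun _ hx => hx) (Set.injOn_id _) (fun _ _ _ _ _ => Iff.rfl) (fun _ _ => rfl)
    fun x hx => (hc x hx).symm

/-- A proper edge coloring of the multigraph on `W` with `k` colors. -/
def IsProperOn (W : Set V) (E : V → V → ℕ → Prop) (p k : ℕ) (χ : V → V → ℕ → ℕ) : Prop :=
  StageValid W E p (fun _ => True) (fun _ => False) k χ χ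

/-- Nothing is fixed, so a proper coloring is admissible whatever `prev` is. Truncating it at k does
not affect edges, but bounds the irrelevant values, as is needed for coding by digits. -/
theorem exists_stageValid_zero {k : ℕ} {χ : V → V → ℕ → ℕ} (hχ : IsProperOn W E p k χ)
    (D F : V → Prop) (hF : ∀ x, ¬ F x) (prev : V → V → ℕ → ℕ) :
    ∃ c, StageValid W E p D F k prev c ∧ ∀ x y j, c x y j < k + 1 := by
  refine ⟨fun x y j => min (χ x y j) k, ?_, fun x y j => by simp only; omega⟩
  intro x hx y hy j hj he hDx hDy
  obtain ⟨h1, h2, -, h4⟩ := hχ x hx y hy j hj he trivial trivial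
  refine ⟨?_, ?_, fun h => absurd h (hF x), ?_⟩
  · simp only; omega
  · simp only; rw [h2]
  · intro y' hy' j' hj' he' hDy' heq
    have h5 := (hχ x hx y' hy' j' hj' he' trivial trivial).1
    simp only at heq
    exact h4 y' hy' j' hj' he' trivial (by omega)

/-! ### The edges of a window as a type, for use with the pasting lemma -/

/-- The edges of the multigraph on `W`, oriented from their smaller to their larger end. -/
abbrev OrientedEdge [LinearOrder V] (W : Set V) (E : V → V → ℕ → Prop) (p : ℕ) : Type _ :=
  {e : W × W × Fin p // e.1 < e.2.1 ∧ E e.1 e.2.1 e.2.2}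

namespace OrientedEdge

variable [LinearOrder V]

/-- The ends of an edge. -/
def ends (e : OrientedEdge W E p) : Sym2 W := s(e.1.1, e.1.2.1)

/-- The values of an edge coloring on the oriented edges. -/
def restrict (c : V → V → ℕ → ℕ) (e : OrientedEdge W E p) : ℕ := c e.1.1 e.1.2.1 e.1.2.2

open Classical in
/-- The value at the edge with ends `z` and number `j` of the edge coloring given by its values on
the oriented edges. -/
noncomputable def valueAt (g : OrientedEdge W E p → ℕ) (z : Sym2 V) (j : ℕ) : ℕ :=
  if h : ∃ e : OrientedEdge W E p, (ends e).map Subtype.val = z ∧ (e.1.2.2 : ℕ) = j then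
    g h.choose else 0

/-- The edge coloring given by its values on the oriented edges. -/
noncomputable def extend (g : OrientedEdge W E p → ℕ) (x y : V) (j : ℕ) : ℕ :=
  valueAt g s(x, y) j

theorem eq_of_ends {e e' : OrientedEdge W E p} (h : ends e = ends e')
    (hj : (e.1.2.2 : ℕ) = e'.1.2.2) : e = e' := by
  obtain ⟨⟨x, y, j⟩, hxy, he⟩ := e
  obtain ⟨⟨x', y', j'⟩, hxy', he'⟩ := e'
  simp only [ends, Sym2.eq_iff] at h
  have hj' : j = j' := Fin.ext hj
  rcases h with ⟨rfl, rfl⟩ | ⟨rfl, rfl⟩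
  · subst hj'; rfl
  · exact absurd (lt_trans hxy hxy') (lt_irrefl _)

theorem extend_symm (g : OrientedEdge W E p → ℕ) (x y : V) (j : ℕ) :
    extend g x y j = extend g y x j := by
  rw [extend, extend, Sym2.eq_swap]

theorem extend_eq (g : OrientedEdge W E p → ℕ) (e : OrientedEdge W E p) {x y : W}
    (h : ends e = s(x, y)) : extend g x y e.1.2.2 = g e := by
  have hex : ∃ e' : OrientedEdge W E p, (ends e').map Subtype.val = s((x : V), (y : V)) ∧
      (e'.1.2.2 : ℕ) = e.1.2.2 := ⟨e, by rw [h]; rfl, rfl⟩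
  rw [extend, valueAt, dif_pos hex]
  congr 1
  refine eq_of_ends (Sym2.map.injective Subtype.val_injective ?_) hex.choose_spec.2
  rw [hex.choose_spec.1, h]
  rfl

theorem extend_le {g : OrientedEdge W E p → ℕ} {K : ℕ} (hg : ∀ e, g e ≤ K) (x y : V) (j : ℕ) :
    extend g x y j ≤ K := by
  unfold extend valueAt
  split_ifs
  · exact hg _
  · exact Nat.zero_le _

theorem restrict_eq {c : V → V → ℕ → ℕ} {e : OrientedEdge W E p} {x y : W}
    (h : ends e = s(x, y)) (hc : c x y e.1.2.2 = c y x e.1.2.2) :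
    restrict c e = c x y e.1.2.2 := by
  obtain ⟨⟨a, b, j⟩, hxy, he⟩ := e
  simp only [ends, Sym2.eq_iff] at h
  rcases h with ⟨rfl, rfl⟩ | ⟨rfl, rfl⟩
  · rfl
  · exact hc.symm

theorem exists_other (hsymm : ∀ x ∈ W, ∀ y ∈ W, ∀ j, E x y j → E y x j)
    {e : OrientedEdge W E p} {v : W} (hv : v ∈ ends e) :
    ∃ u : W, ends e = s(v, u) ∧ E v u e.1.2.2 := by
  obtain ⟨⟨a, b, j⟩, hxy, he⟩ := e
  rcases Sym2.mem_iff.1 hv with rfl | rfl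
  · exact ⟨b, rfl, he⟩
  · exact ⟨a, Sym2.eq_swap, hsymm _ a.2 _ v.2 _ he⟩

theorem exists_of_edge (hsymm : ∀ x ∈ W, ∀ y ∈ W, ∀ j, E x y j → E y x j)
    (hloop : ∀ x ∈ W, ∀ j, ¬ E x x j) (x y : W) {j : ℕ} (hj : j < p) (he : E x y j) :
    ∃ e : OrientedEdge W E p, ends e = s(x, y) ∧ (e.1.2.2 : ℕ) = j := by
  rcases lt_trichotomy x y with h | rfl | h
  · exact ⟨⟨⟨x, y, j, hj⟩, h, he⟩, rfl, rfl⟩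
  · exact absurd he (hloop _ x.2 _)
  · exact ⟨⟨⟨y, x, j, hj⟩, h, hsymm _ x.2 _ y.2 _ he⟩, Sym2.eq_swap, rfl⟩

/-- With `stageValid_extend`, this translates between stage colorings, which are functions of two
vertices and a number, and colorings of an edge type, to which fans and pasting apply. -/
theorem properOn_restrict (hsymm : ∀ x ∈ W, ∀ y ∈ W, ∀ j, E x y j → E y x j) {D F : V → Prop}
    {K : ℕ} {prev c : V → V → ℕ → ℕ} (h : StageValid W E p D F K prev c) :
    ProperOn ends {e : OrientedEdge W E p | ∀ v ∈ ends e, D v} (restrict c) ∧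
      ∀ e : OrientedEdge W E p, (∀ v ∈ ends e, D v) → restrict c e < K := by
  constructor
  · intro e e' v he he' hv hv' hee
    obtain ⟨u, hu, hEu⟩ := exists_other hsymm hv
    obtain ⟨u', hu', hEu'⟩ := exists_other hsymm hv'
    obtain ⟨-, h2, -, h4⟩ := h v v.2 u u.2 _ e.1.2.2.2 hEu (he v hv) (he u (by simp [hu]))
    obtain ⟨-, h2', -, -⟩ := h v v.2 u' u'.2 _ e'.1.2.2.2 hEu' (he' v hv') (he' u' (by simp [hu']))
    rw [restrict_eq hu h2, restrict_eq hu' h2'] at hee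
    obtain ⟨h5, h6⟩ := h4 u' u'.2 _ e'.1.2.2.2 hEu' (he' u' (by simp [hu'])) hee
    exact eq_of_ends (by rw [hu, hu', Subtype.ext h5]) h6
  · intro e he
    exact (h _ e.1.1.2 _ e.1.2.1.2 _ e.1.2.2.2 e.2.2 (he _ (Sym2.mem_mk_left _ _))
      (he _ (Sym2.mem_mk_right _ _))).1

theorem stageValid_extend (hsymm : ∀ x ∈ W, ∀ y ∈ W, ∀ j, E x y j → E y x j)
    (hloop : ∀ x ∈ W, ∀ j, ¬ E x x j) {D F : V → Prop} {K : ℕ} {prev : V → V → ℕ → ℕ}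
    (hprev : ∀ x ∈ W, ∀ y ∈ W, ∀ j < p, E x y j → F x → F y → prev x y j = prev y x j)
    {g : OrientedEdge W E p → ℕ}
    (hg : ProperOn ends {e | ∀ v ∈ ends e, D v} g) (hK : ∀ e, (∀ v ∈ ends e, D v) → g e < K)
    (hF : ∀ e, (∀ v ∈ ends e, F v) → g e = restrict prev e) :
    StageValid W E p D F K prev (extend g) := by
  intro x hx y hy j hj he hDx hDy
  obtain ⟨e, hends, rfl⟩ := exists_of_edge hsymm hloop ⟨x, hx⟩ ⟨y, hy⟩ hj he
  have hval := extend_eq g e hends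
  have hDe : ∀ v ∈ ends e, D v := by
    intro v hv
    rw [hends, Sym2.mem_iff] at hv
    rcases hv with rfl | rfl
    · exact hDx
    · exact hDy
  simp only at hval
  refine ⟨by rw [hval]; exact hK e hDe, extend_symm _ _ _ _, fun hFx hFy => ?_, ?_⟩
  · rw [hval, hF e]
    · exact restrict_eq hends (hprev x hx y hy _ hj he hFx hFy)
    · intro v hv
      rw [hends, Sym2.mem_iff] at hv
      rcases hv with rfl | rfl
      · exact hFx
      · exact hFy
  · intro y' hy' j' hj' he' hDy' heq
    obtain ⟨e', hends', rfl⟩ := exists_of_edge hsymm hloop ⟨x, hx⟩ ⟨y', hy'⟩ hj' he'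
    have hval' := extend_eq g e' hends'
    have hDe' : ∀ v ∈ ends e', D v := by
      intro v hv
      rw [hends', Sym2.mem_iff] at hv
      rcases hv with rfl | rfl
      · exact hDx
      · exact hDy'
    simp only at hval'
    rw [hval, hval'] at heq
    have hee : e = e' := hg (v := ⟨x, hx⟩) hDe hDe' (by simp [hends]) (by simp [hends']) heq
    subst hee
    rw [hends] at hends'
    simp only [Sym2.eq_iff, true_and, Subtype.mk.injEq] at hends'
    exact ⟨by rcases hends' with h | ⟨rfl, rfl⟩ <;> [exact h; rfl], rfl⟩

end OrientedEdge

/-- A stage can be continued to the next one, with `p` additional colors, as long as the fixed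
zone is shrunk sufficiently. -/
theorem exists_stageValid_succ [LinearOrder V] (hW : W.Finite)
    (hsymm : ∀ x ∈ W, ∀ y ∈ W, ∀ j, E x y j → E y x j) (hloop : ∀ x ∈ W, ∀ j, ¬ E x x j) {k K : ℕ}
    {χ : V → V → ℕ → ℕ} (hχ : IsProperOn W E p k χ) (hk : k ≤ K) {T T' : ℕ}
    (hT : T + pasteRadius K ≤ T') {D F₀ : V → Prop}
    {prev₀ prev : V → V → ℕ → ℕ}
    (hprev : StageValid W E p (Near W E p pt i T') F₀ K prev₀ prev) :
    ∃ c, StageValid W E p D (Near W E p pt i T) (K + p) prev c ∧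
      ∀ x y j, c x y j < K + p + 1 := by
  classical
  rcases Nat.eq_zero_or_pos p with rfl | hp
  · exact ⟨fun _ _ _ => 0, fun _ _ _ _ j hj => absurd hj (Nat.not_lt_zero j),
      fun _ _ _ => Nat.succ_pos _⟩
  have := hW.to_subtype
  let N : OrientedEdge W E p → ℕ → Prop := fun e t => ∀ v ∈ OrientedEdge.ends e, Near W E p pt i t v
  -- The level of an edge counts the radii up to `T'` at which both of its ends are near. It is 0
  -- outside the zone where `prev` is known to be proper, and at least `T' - T` in the fixed zone.
  -- Since near at radius t implies near at radius t + 1 for neighbors, it changes by at most one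
  -- between incident edges. So `prev` can be pasted to the coloring `χ` of the window with `L = 0`.
  let d : OrientedEdge W E p → ℕ := fun e => ((Finset.range (T' + 1)).filter (N e)).card
  have hd : ∀ ⦃e e' : OrientedEdge W E p⦄ ⦃v⦄, v ∈ OrientedEdge.ends e →
      v ∈ OrientedEdge.ends e' → d e ≤ d e' + 1 := by
    intro e e' v hv hv'
    have hstep : ∀ t, N e t → N e' (t + 1) := by
      intro t ht u hu
      have hNv := ht v hv
      obtain ⟨w, hw, hEw⟩ := OrientedEdge.exists_other hsymm hv'
      rw [hw, Sym2.mem_iff] at hu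
      rcases hu with rfl | rfl
      · exact Or.inl hNv
      · exact Or.inr ⟨u.2, v, v.2, ⟨_, e'.1.2.2.2, hsymm _ v.2 _ u.2 _ hEw⟩, hNv⟩
    calc d e ≤ ((Finset.range T').filter (N e)).card + 1 := by
          simp only [d, Finset.range_add_one, Finset.filter_insert]
          split_ifs
          · exact Finset.card_insert_le _ _
          · exact Nat.le_succ _
      _ ≤ d e' + 1 := by
          refine Nat.succ_le_succ (Finset.card_le_card_of_injOn (· + 1) ?_
            (fun a _ b _ h => by simpa using h))
          intro t ht
          simp only [Finset.coe_filter, Finset.mem_range, Set.mem_ofPred_eq] at ht ⊢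
          exact ⟨by omega, hstep t ht.2⟩
  have hdpos : ∀ e, 0 < d e → N e T' := by
    intro e he
    obtain ⟨t, ht⟩ := Finset.card_pos.1 he
    rw [Finset.mem_filter, Finset.mem_range] at ht
    exact fun v hv => (ht.2 v hv).mono (by omega)
  have hdR : ∀ e, N e T → 0 + pasteRadius K ≤ d e := by
    intro e he
    have : Finset.Icc (T + 1) T' ⊆ (Finset.range (T' + 1)).filter (N e) := by
      intro t ht
      rw [Finset.mem_Icc] at ht
      rw [Finset.mem_filter, Finset.mem_range]
      exact ⟨by omega, fun v hv => (he v hv).mono (by omega)⟩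
    have := Finset.card_le_card this
    rw [Nat.card_Icc] at this
    change _ ≤ ((Finset.range (T' + 1)).filter (N e)).card
    omega
  obtain ⟨hf, hfK⟩ := OrientedEdge.properOn_restrict hsymm hprev
  obtain ⟨hh, hhK⟩ := OrientedEdge.properOn_restrict hsymm hχ
  obtain ⟨g, hg, hgK, -, hgf⟩ := exists_paste (ends := OrientedEdge.ends (W := W) (E := E) (p := p))
    hp (fun e he => (ne_of_lt e.2.1) (by simpa [OrientedEdge.ends] using he))
    (fun x y => by
      have hinj : Set.InjOn (fun e : OrientedEdge W E p => e.1.2.2)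
          {e | OrientedEdge.ends e = s(x, y)} := fun e he e' he' h =>
        OrientedEdge.eq_of_ends (he.trans he'.symm) (congrArg Fin.val h)
      rw [← hinj.ncard_image]
      exact (Set.ncard_le_card _).trans_eq (Nat.card_fin p))
    hd K Set.univ 0 (pasteRadius K) (OrientedEdge.restrict prev) (OrientedEdge.restrict χ) le_rfl
    (fun e e' v he he' => hf (hdpos e he.2) (hdpos e' he'.2)) (fun e _ he => hfK e (hdpos e he))
    (fun e e' v _ _ => hh (fun _ _ => trivial) (fun _ _ => trivial))
    (fun e _ => (hhK e fun _ _ => trivial).trans_le hk)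
  refine ⟨OrientedEdge.extend g, OrientedEdge.stageValid_extend hsymm hloop ?_
    (fun e e' v _ _ => hg trivial trivial) (fun e _ => hgK e trivial)
    (fun e he => hgf e trivial (hdR e he)), fun x y j =>
      Nat.lt_succ_of_le (OrientedEdge.extend_le (fun e => (hgK e trivial).le) x y j)⟩
  intro x hx y hy j hj he hFx hFy
  exact (hprev x hx y hy j hj he (hFx.mono (by omega)) (hFy.mono (by omega))).2.1

/-- Greedy coloring of a finite set. -/
theorem exists_greedy_coloring (R : V → V → Prop) (hR : ∀ x y, R x y → R y x) {d : ℕ}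
    (s : Finset V) (hd : ∀ x ∈ s, ∃ t : Finset V, t.card ≤ d ∧ ∀ y ∈ s, R x y → y ∈ t) :
    ∃ f : V → ℕ, (∀ x, f x < d + 1) ∧ ∀ x ∈ s, ∀ y ∈ s, x ≠ y → R x y → f x ≠ f y := by
  classical
  induction s using Finset.induction_on with
  | empty => exact ⟨fun _ => 0, fun _ => Nat.succ_pos _, by simp⟩
  | insert a s ha ih =>
    obtain ⟨f, hf, hfR⟩ := ih fun x hx => by
      obtain ⟨t, ht, h⟩ := hd x (Finset.mem_insert_of_mem hx)
      exact ⟨t, ht, fun y hy => h y (Finset.mem_insert_of_mem hy)⟩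
    obtain ⟨t, ht, hta⟩ := hd a (Finset.mem_insert_self a s)
    obtain ⟨b, hb, hbt⟩ := Finset.exists_mem_notMem_of_card_lt_card
      (s := t.image f) (t := Finset.range (d + 1))
      (by rw [Finset.card_range]; exact Finset.card_image_le.trans_lt (Nat.lt_succ_of_le ht))
    have hkey : ∀ y ∈ s, R a y → f y ≠ b := by
      rintro y hy hay rfl
      exact hbt (Finset.mem_image_of_mem f (hta y (Finset.mem_insert_of_mem hy) hay))
    have hne : ∀ y ∈ s, y ≠ a := by
      rintro y hy rfl
      exact ha hy
    refine ⟨Function.update f a b, fun x => ?_, ?_⟩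
    · by_cases hx : x = a
      · subst hx
        rw [Function.update_self]
        exact Finset.mem_range.1 hb
      · rw [Function.update_of_ne hx]
        exact hf x
    · intro x hx y hy hxy hRxy
      rcases Finset.mem_insert.1 hx with hx' | hx' <;> rcases Finset.mem_insert.1 hy with hy' | hy'
      · exact absurd (hx'.trans hy'.symm) hxy
      · subst hx'
        rw [Function.update_self, Function.update_of_ne (hne y hy')]
        exact (hkey y hy' hRxy).symm
      · subst hy'
        rw [Function.update_self, Function.update_of_ne (hne x hx')]
        exact hkey x hx' (hR _ _ hRxy)
      · rw [Function.update_of_ne (hne x hx'), Function.update_of_ne (hne y hy')]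
        exact hfR x hx' y hy' hxy hRxy

/-- A vertex y with a common neighbor z of x and y is determined by the colors of the edges xz and
zy. So each vertex has at most k² conflicts, and greedy coloring needs k² + 1 names. Asking for
different names only within a part weakens the requirement; this is done for the sake of locality.
-/
theorem exists_nameValid (hW : W.Finite)
    (hsymm : ∀ x ∈ W, ∀ y ∈ W, ∀ j, E x y j → E y x j) {k : ℕ}
    {χ : V → V → ℕ → ℕ} (hχ : IsProperOn W E p k χ) (pt : V → ℕ) :
    ∃ c, NameValid W E p pt (k * k + 1) c ∧ ∀ x y j, c x y j < k * k + 1 := by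
  classical
  let R : V → V → Prop := fun x y =>
    x ∈ W ∧ y ∈ W ∧ ∃ z ∈ W, (∃ j < p, E z x j) ∧ ∃ j < p, E z y j
  obtain ⟨f, hf, hfR⟩ := exists_greedy_coloring R
    (fun x y ⟨hx, hy, z, hz, h1, h2⟩ => ⟨hy, hx, z, hz, h2, h1⟩) (d := k * k) hW.toFinset (by
      intro x hx
      have hRx : ∀ y : {y | R x y}, ∃ q : V × ℕ × ℕ, q.1 ∈ W ∧ q.2.1 < p ∧ q.2.2 < p ∧
          E q.1 x q.2.1 ∧ E q.1 y q.2.2 := by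
        rintro ⟨y, -, -, z, hz, ⟨j, hj, he⟩, j', hj', he'⟩
        exact ⟨⟨z, j, j'⟩, hz, hj, hj', he, he'⟩
      choose q hq using hRx
      have hfin : {y | R x y}.Finite := hW.subset fun y hy => hy.2.1
      refine ⟨hfin.toFinset, ?_, fun y _ hy => by simpa using hy⟩
      let code : {y | R x y} → Finset.range k × Finset.range k := fun y =>
        ⟨⟨χ x (q y).1 (q y).2.1, Finset.mem_range.2 (hχ x y.2.1 _ (hq y).1 _ (hq y).2.1
            (hsymm _ (hq y).1 _ y.2.1 _ (hq y).2.2.2.1) trivial trivial).1⟩,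
          ⟨χ (q y).1 y (q y).2.2, Finset.mem_range.2 (hχ _ (hq y).1 y y.2.2.1 _ (hq y).2.2.1
            (hq y).2.2.2.2 trivial trivial).1⟩⟩
      have hcode : Function.Injective code := by
        intro y y' h
        simp only [code, Prod.mk.injEq, Subtype.mk.injEq] at h
        obtain ⟨h1, h2⟩ := (hχ x y.2.1 _ (hq y).1 _ (hq y).2.1
            (hsymm _ (hq y).1 _ y.2.1 _ (hq y).2.2.2.1) trivial trivial).2.2.2 _ (hq y').1 _
            (hq y').2.1 (hsymm _ (hq y').1 _ y.2.1 _ (hq y').2.2.2.1) trivial h.1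
        have h4 := (hq y').2.2.2.2
        have h5 := h.2
        rw [← h1] at h4 h5
        exact Subtype.ext ((hχ _ (hq y).1 y y.2.2.1 _ (hq y).2.2.1
            (hq y).2.2.2.2 trivial trivial).2.2.2 _ y'.2.2.1 _ (hq y').2.2.1 h4 trivial h5).1
      have := Nat.card_le_card_of_injective code hcode
      rw [Nat.card_prod, Nat.card_coe_set_eq {y | R x y}, Set.ncard_eq_toFinset_card _ hfin,
        Nat.card_eq_fintype_card, Fintype.card_coe, Finset.card_range] at this
      exact this)
  refine ⟨fun x _ _ => f x, fun x hx => ⟨hf x, fun y hy hxy _ h => ?_⟩, fun x _ _ => hf x⟩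
  exact hfR x (hW.mem_toFinset.2 hx) y (hW.mem_toFinset.2 hy) hxy ⟨hx, hy, h⟩

end Stages

/-! ### Exchanging admissible choices between two windows -/

section Exchange

variable {V : Type*}

open Classical in
/-- A valid stage coloring `c₁` remains valid when it is replaced, on a set `X` of edges, by another
one, if the edges of `X` are free and meet only edges of `X` and fixed edges. -/
theorem StageValid.exchange {W₁ W₂ : Set V} {E : V → V → ℕ → Prop} {p K : ℕ}
    {D₁ D₂ F₁ F₂ : V → Prop} {prev₁ prev₂ c₁ c₂ : V → V → ℕ → ℕ}
    (h₁ : StageValid W₁ E p D₁ F₁ K prev₁ c₁) (h₂ : StageValid W₂ E p D₂ F₂ K prev₂ c₂)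
    (X : V → V → ℕ → Prop) (hsymm : ∀ a b j, X a b j → X b a j)
    (hX : ∀ a b j, X a b j → a ∈ W₂ ∧ D₂ a ∧ ¬ (F₁ a ∧ F₁ b))
    (hadj : ∀ a b j, X a b j → ∀ b' ∈ W₁, ∀ j' < p, E a b' j' → D₁ b' → X a b' j' ∨
      (F₁ a ∧ F₁ b' ∧ F₂ a ∧ F₂ b' ∧ b' ∈ W₂ ∧ D₂ b' ∧ prev₁ a b' j' = prev₂ a b' j')) :
    StageValid W₁ E p D₁ F₁ K prev₁ fun a b j => if X a b j then c₂ a b j else c₁ a b j := by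
  -- An edge outside `X` that meets an edge of `X` is fixed in both windows, with the same previous
  -- color. Its color under `c₁` is thus also its color under `c₂`, and `c₂` is proper.
  have key : ∀ a b j, X a b j → j < p → E a b j → ∀ b' ∈ W₁, a ∈ W₁ → D₁ a → ∀ j' < p,
      E a b' j' → D₁ b' → ¬ X a b' j' → c₂ a b j = c₁ a b' j' → b = b' ∧ j = j' := by
    intro a b j hXab hj he b' hb' ha hDa j' hj' he' hDb' hX' heq
    have hXa := hX a b j hXab
    have hXb := hX b a j (hsymm _ _ _ hXab)
    rcases hadj a b j hXab b' hb' j' hj' he' hDb' with h | ⟨f1, f2, f3, f4, hbW, hbD, hpr⟩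
    · exact absurd h hX'
    · have h3 := (h₁ a ha b' hb' j' hj' he' hDa hDb').2.2.1 f1 f2
      have h4 := (h₂ a hXa.1 b' hbW j' hj' he' hXa.2.1 hbD).2.2.1 f3 f4
      refine (h₂ a hXa.1 b hXb.1 j hj he hXa.2.1 hXb.2.1).2.2.2 b' hbW j' hj' he' hbD ?_
      rw [heq, h3, h4, hpr]
  intro a ha b hb j hj he hDa hDb
  by_cases hXab : X a b j
  · have hXa := hX a b j hXab
    have hXb := hX b a j (hsymm _ _ _ hXab)
    obtain ⟨g1, g2, -, g4⟩ := h₂ a hXa.1 b hXb.1 j hj he hXa.2.1 hXb.2.1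
    simp only [if_pos hXab, if_pos (hsymm _ _ _ hXab)]
    refine ⟨g1, g2, fun f1 f2 => absurd ⟨f1, f2⟩ hXa.2.2, fun b' hb' j' hj' he' hDb' heq => ?_⟩
    by_cases hX' : X a b' j'
    · rw [if_pos hX'] at heq
      have hXb' := hX b' a j' (hsymm _ _ _ hX')
      exact g4 b' hXb'.1 j' hj' he' hXb'.2.1 heq
    · rw [if_neg hX'] at heq
      exact key a b j hXab hj he b' hb' ha hDa j' hj' he' hDb' hX' heq
  · obtain ⟨g1, g2, g3, g4⟩ := h₁ a ha b hb j hj he hDa hDb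
    simp only [if_neg hXab, if_neg (fun h => hXab (hsymm _ _ _ h))]
    refine ⟨g1, g2, g3, fun b' hb' j' hj' he' hDb' heq => ?_⟩
    by_cases hX' : X a b' j'
    · rw [if_pos hX'] at heq
      obtain ⟨h5, h6⟩ := key a b' j' hX' hj' he' b hb ha hDa j hj he hDb hXab heq.symm
      exact ⟨h5.symm, h6.symm⟩
    · rw [if_neg hX'] at heq
      exact g4 b' hb' j' hj' he' hDb' heq

open Classical in
/-- Valid names remain valid when they are replaced by others on a set that is a union of classes
of the relation between vertices that need different names. -/
theorem NameValid.exchange {W₁ W₂ : Set V} {E : V → V → ℕ → Prop} {p K : ℕ} {pt : V → ℕ}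
    {c₁ c₂ : V → V → ℕ → ℕ} (h₁ : NameValid W₁ E p pt K c₁) (h₂ : NameValid W₂ E p pt K c₂)
    (X : V → Prop) (hX : ∀ a, X a → a ∈ W₂ ∧ ∀ z ∈ W₁, ∀ j < p, E z a j → z ∈ W₂)
    (hadj : ∀ a b z, pt a = pt b → (∃ j < p, E z a j) → (∃ j < p, E z b j) → X a → X b) :
    NameValid W₁ E p pt K fun a b j => if X a then c₂ a b j else c₁ a b j := by
  intro a ha
  by_cases hXa : X a
  · simp only [if_pos hXa]
    refine ⟨(h₂ a (hX a hXa).1).1, ?_⟩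
    rintro b hb hab hpt ⟨z, hz, h3, h4⟩
    have hXb := hadj a b z hpt h3 h4 hXa
    rw [if_pos hXb]
    have hzW : z ∈ W₂ := by
      obtain ⟨j, hj, he⟩ := h3
      exact (hX a hXa).2 z hz j hj he
    exact (h₂ a (hX a hXa).1).2 b (hX b hXb).1 hab hpt ⟨z, hzW, h3, h4⟩
  · simp only [if_neg hXa]
    refine ⟨(h₁ a ha).1, ?_⟩
    rintro b hb hab hpt ⟨z, hz, h3, h4⟩
    rw [if_neg fun hXb => hXa (hadj b a z hpt.symm h4 h3 hXb)]
    exact (h₁ a ha).2 b hb hab hpt ⟨z, hz, h3, h4⟩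

end Exchange

/-! ### Edge colorings as functions on a linearly ordered set -/

section Slots

variable {V : Type*}

/-- The arguments `x`, `y`, `j` of an edge coloring, ordered lexicographically. -/
abbrev Slot (V : Type*) : Type _ := V ×ₗ V ×ₗ ℕ

/-- The slot `(x, y, j)`. -/
def slot (x y : V) (j : ℕ) : Slot V := toLex (x, toLex (y, j))

/-- The slots of a multigraph on `W` with edge multiplicity at most `p`. -/
def slotsOn (W : Set V) (p : ℕ) : Set (Slot V) :=
  {a | ∃ x ∈ W, ∃ y ∈ W, ∃ j < p, a = slot x y j}

/-- An edge coloring as a function on the set of slots. -/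
def onSlots (c : V → V → ℕ → ℕ) (a : Slot V) : ℕ :=
  c (ofLex a).1 (ofLex (ofLex a).2).1 (ofLex (ofLex a).2).2

/-- A function on the set of slots as an edge coloring. -/
def ofSlots (u : Slot V → ℕ) (x y : V) (j : ℕ) : ℕ := u (slot x y j)

theorem slot_inj {x y x' y' : V} {j j' : ℕ} :
    slot x y j = slot x' y' j' ↔ x = x' ∧ y = y' ∧ j = j' := by
  simp [slot]

theorem slot_lt [LinearOrder V] {x y x' y' : V} {j j' : ℕ} :
    slot x y j < slot x' y' j' ↔ x < x' ∨ x = x' ∧ (y < y' ∨ y = y' ∧ j < j') := by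
  simp [slot, Prod.Lex.toLex_lt_toLex]

theorem slotsOn_finite {W : Set V} (hW : W.Finite) (p : ℕ) : (slotsOn W p).Finite := by
  refine ((hW.prod (hW.prod (Set.finite_Iio p))).image fun q => slot q.1 q.2.1 q.2.2).subset ?_
  rintro _ ⟨x, hx, y, hy, j, hj, rfl⟩
  exact ⟨(x, y, j), ⟨hx, hy, hj⟩, rfl⟩

/-- The edge coloring `c` is the colex-least one satisfying `P`. -/
def IsLeastColoring [LinearOrder V] (W : Set V) (p B : ℕ) (P : (V → V → ℕ → ℕ) → Prop) (c : V → V → ℕ → ℕ) :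
    Prop :=
  IsColexLeast (slotsOn W p) B (fun u => P (ofSlots u)) (onSlots c)

open Classical in
theorem IsLeastColoring.eq_of_exchange [LinearOrder V] {W₁ W₂ : Set V} {p B : ℕ}
    {P₁ P₂ : (V → V → ℕ → ℕ) → Prop} {c₁ c₂ : V → V → ℕ → ℕ}
    (h₁ : IsLeastColoring W₁ p B P₁ c₁) (h₂ : IsLeastColoring W₂ p B P₂ c₂)
    (hW₁ : W₁.Finite) (X : V → V → ℕ → Prop)
    (hX : ∀ a b j, X a b j → a ∈ W₁ ∧ b ∈ W₁ ∧ a ∈ W₂ ∧ b ∈ W₂ ∧ j < p)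
    (hP₁ : P₁ fun a b j => if X a b j then c₂ a b j else c₁ a b j)
    (hP₂ : P₂ fun a b j => if X a b j then c₁ a b j else c₂ a b j)
    {a b : V} {j : ℕ} (hab : X a b j) : c₁ a b j = c₂ a b j := by
  let Y : Set (Slot V) := {u | ∃ a b j, X a b j ∧ u = slot a b j}
  have hY : ∀ a b j, slot a b j ∈ Y ↔ X a b j := by
    intro a b j
    constructor
    · rintro ⟨a', b', j', h, he⟩
      obtain ⟨rfl, rfl, rfl⟩ := slot_inj.1 he
      exact h
    · exact fun h => ⟨a, b, j, h, rfl⟩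
  have hYW₁ : Y ⊆ slotsOn W₁ p := by
    rintro _ ⟨a, b, j, h, rfl⟩
    obtain ⟨h1, h2, h3, h4, h5⟩ := hX a b j h
    exact ⟨a, h1, b, h2, j, h5, rfl⟩
  have hYW₂ : Y ⊆ slotsOn W₂ p := by
    rintro _ ⟨a, b, j, h, rfl⟩
    obtain ⟨h1, h2, h3, h4, h5⟩ := hX a b j h
    exact ⟨a, h3, b, h4, j, h5, rfl⟩
  have hpw : ∀ c d : V → V → ℕ → ℕ, ofSlots (Y.piecewise (onSlots d) (onSlots c)) =
      fun a b j => if X a b j then d a b j else c a b j := by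
    intro c d
    funext a b j
    by_cases h : X a b j
    · rw [ofSlots, Set.piecewise_eq_of_mem _ _ _ ((hY a b j).2 h), if_pos h]
      rfl
    · rw [ofSlots, Set.piecewise_eq_of_notMem _ _ _ (fun h' => h ((hY a b j).1 h')), if_neg h]
      rfl
  exact IsColexLeast.eqOn_of_exchange h₁ h₂ ((slotsOn_finite hW₁ p).subset hYW₁) hYW₁ hYW₂
    (by rw [hpw]; exact hP₁) (by rw [hpw]; exact hP₂) ((hY a b j).2 hab)

end Slots

/-! ### Depth in a window, and agreement of the choices made in two windows -/

section Deep

open ASI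

variable {V : Type u} {G : SimpleGraph V} {E : V → V → ℕ → Prop} {p : ℕ}

theorem edist_le_succ_iff {x u : V} {t : ℕ} :
    G.edist x u ≤ (t + 1 : ℕ) ↔ G.edist x u ≤ t ∨ ∃ y, G.Adj x y ∧ G.edist y u ≤ t := by
  constructor
  · intro h
    have hne : G.edist x u ≠ ⊤ := fun h' => by
      rw [h'] at h
      exact absurd (top_le_iff.1 h) (ENat.natCast_ne_top _)
    obtain ⟨w, hw⟩ := (SimpleGraph.reachable_of_edist_ne_top hne).exists_walk_length_eq_edist
    cases w with
    | nil => left; simp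
    | cons hadj w =>
      right
      refine ⟨_, hadj, w.edist_le.trans ?_⟩
      rw [← hw, SimpleGraph.Walk.length_cons] at h
      have : w.length + 1 ≤ t + 1 := by exact_mod_cast h
      exact_mod_cast Nat.le_of_succ_le_succ this
  · rintro (h | ⟨y, hy, h⟩)
    · exact h.trans (by exact_mod_cast Nat.le_succ t)
    · refine (G.edist_triangle (v := y)).trans ?_
      rw [SimpleGraph.edist_eq_one_iff_adj.2 hy, add_comm]
      push_cast
      gcongr

theorem edist_le_add {x y z : V} {a b : ℕ} (h : G.edist x y ≤ a) (h' : G.edist y z ≤ b) :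
    G.edist x z ≤ (a + b : ℕ) := by
  refine (G.edist_triangle (v := y)).trans ?_
  push_cast
  gcongr

theorem edist_le_mono {x y : V} {a b : ℕ} (h : G.edist x y ≤ a) (hab : a ≤ b) :
    G.edist x y ≤ b :=
  h.trans (by exact_mod_cast hab)

theorem edist_le_one {x y : V} (h : G.Adj x y) : G.edist x y ≤ (1 : ℕ) :=
  (SimpleGraph.edist_eq_one_iff_adj.2 h).le

theorem edist_symm_le {x y : V} {a : ℕ} (h : G.edist x y ≤ a) : G.edist y x ≤ a := by
  rwa [SimpleGraph.edist_comm]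

/-- The vertex `x` has distance at most `t` from the vertices whose part is less than `i`. -/
def NearDist (G : SimpleGraph V) (pt : V → ℕ) (i t : ℕ) (x : V) : Prop :=
  ∃ u, pt u < i ∧ G.edist x u ≤ t

/-- A path from `x` of length at most `t` stays in the ball that is assumed to lie in `W`. Near the
boundary of a window, paths may leave it, and only the implication from left to right remains. -/
theorem near_iff_nearDist (hE : ∀ x y, G.Adj x y ↔ ∃ j < p, E x y j) {W : Set V} {pt : V → ℕ}
    {i t : ℕ} {x : V} (hx : ∀ y, G.edist x y ≤ t → y ∈ W) :
    Near W E p pt i t x ↔ NearDist G pt i t x := by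
  constructor
  · intro h
    clear hx
    induction t generalizing x with
    | zero => exact ⟨x, h.2, by simp⟩
    | succ t ih =>
      rcases h with h | ⟨hx, y, hy, he, h⟩
      · obtain ⟨u, hu, hxu⟩ := ih h
        exact ⟨u, hu, edist_le_succ_iff.2 (Or.inl hxu)⟩
      · obtain ⟨u, hu, hxu⟩ := ih h
        exact ⟨u, hu, edist_le_succ_iff.2 (Or.inr ⟨y, (hE x y).2 he, hxu⟩)⟩
  · rintro ⟨u, hu, hxu⟩
    induction t generalizing x with
    | zero =>
      have h : x = u := SimpleGraph.edist_eq_zero_iff.1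
        (nonpos_iff_eq_zero.1 (by exact_mod_cast hxu))
      subst h
      exact ⟨hx x hxu, hu⟩
    | succ t ih =>
      rcases edist_le_succ_iff.1 hxu with h | ⟨y, hxy, h⟩
      · exact Or.inl (ih (fun y hy => hx y (edist_le_mono hy (Nat.le_succ t))) h)
      · have hsub : ∀ z, G.edist y z ≤ t → z ∈ W :=
          fun z hz => hx z (edist_le_succ_iff.2 (Or.inr ⟨y, hxy, hz⟩))
        exact Or.inr ⟨hx x (by simp), y, hsub y (by simp), (hE x y).1 hxy, ih hsub h⟩

variable {s : ℕ} {part : V → Fin (s + 1)} {r : ℕ}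

/-- All pieces at distance at most `n` from the piece of `x` lie in `A`. -/
def Deep (G : SimpleGraph V) (part : V → Fin (s + 1)) (r : ℕ) (A : Set V) (n : ℕ) (x : V) : Prop :=
  window G part r n ((pieceGraph G part r).connectedComponentMk x) ⊆ A

theorem deep_same {A : Set V} {n : ℕ} {x y : V}
    (hxy : (pieceGraph G part r).connectedComponentMk x =
      (pieceGraph G part r).connectedComponentMk y) :
    Deep G part r A n x ↔ Deep G part r A n y := by
  rw [Deep, Deep, hxy]

theorem tilde_edist_le_one {x y : V} (h : G.edist x y ≤ r) :
    (tildeGraph G part r).edist ((pieceGraph G part r).connectedComponentMk x)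
      ((pieceGraph G part r).connectedComponentMk y) ≤ (1 : ℕ) := by
  by_cases heq : (pieceGraph G part r).connectedComponentMk x =
      (pieceGraph G part r).connectedComponentMk y
  · rw [heq]; simp
  · exact edist_le_one ⟨heq, x, rfl, y, rfl, h⟩

/-- A step of length at most `r` leads to the same piece or to one adjacent in `tildeGraph`, so it
costs at most one layer. -/
theorem Deep.of_edist {A : Set V} {n : ℕ} {x y : V} (h : Deep G part r A (n + 1) x)
    (hxy : G.edist x y ≤ r) : Deep G part r A n y := by
  intro z hz
  refine h ?_
  change _ ≤ ((n + 1 : ℕ) : ℕ∞)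
  rw [add_comm]
  exact edist_le_add (tilde_edist_le_one hxy) hz

theorem Deep.mono {A : Set V} {n n' : ℕ} (hn : n ≤ n') {x : V} (h : Deep G part r A n' x) :
    Deep G part r A n x :=
  fun _ hz => h (edist_le_mono hz hn)

theorem Deep.mem {A : Set V} {n : ℕ} {x : V} (h : Deep G part r A n x) : x ∈ A :=
  h (by simp [window])

theorem Deep.ball {A : Set V} {n : ℕ} {x : V} (h : Deep G part r A (n + 1) x) {t : ℕ} (ht : t ≤ r)
    {y : V} (hy : G.edist x y ≤ t) : y ∈ A :=
  (h.of_edist (edist_le_mono hy ht)).mem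

theorem same_piece {x y : V} (hpt : part x = part y) (h : G.edist x y ≤ r) :
    (pieceGraph G part r).connectedComponentMk x =
      (pieceGraph G part r).connectedComponentMk y := by
  by_cases hxy : x = y
  · rw [hxy]
  · exact SimpleGraph.ConnectedComponent.sound
      (SimpleGraph.Adj.reachable (G := pieceGraph G part r) ⟨hxy, hpt, h⟩)

/-- The edge `(a, b, j)` is colored at stage `i`, and is close to the piece `C`. -/
def FreeNear (G : SimpleGraph V) (E : V → V → ℕ → Prop) (p : ℕ) (part : V → Fin (s + 1)) (r : ℕ)
    (i T : ℕ) (C : Piece G part r) (a b : V) (j : ℕ) : Prop :=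
  j < p ∧ E a b j ∧ NearDist G (fun x => (part x : ℕ)) (i + 1) T a ∧
    NearDist G (fun x => (part x : ℕ)) (i + 1) T b ∧
    ¬ (NearDist G (fun x => (part x : ℕ)) i T a ∧ NearDist G (fun x => (part x : ℕ)) i T b) ∧
    ∃ u, (pieceGraph G part r).connectedComponentMk u = C ∧ (part u : ℕ) = i ∧
      (G.edist a u ≤ T ∨ G.edist b u ≤ T)

/-- If no vertex of part exactly i were close to either end, the vertices that witness the first two
assumptions would have parts below i, and the edge would be fixed. -/
theorem exists_part_eq {i T : ℕ} {a b : V}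
    (ha : NearDist G (fun x => (part x : ℕ)) (i + 1) T a)
    (hb : NearDist G (fun x => (part x : ℕ)) (i + 1) T b)
    (hfree : ¬ (NearDist G (fun x => (part x : ℕ)) i T a ∧
      NearDist G (fun x => (part x : ℕ)) i T b)) :
    ∃ u, (part u : ℕ) = i ∧ (G.edist a u ≤ T ∨ G.edist b u ≤ T) := by
  obtain ⟨u, hu, hau⟩ := ha
  obtain ⟨v, hv, hbv⟩ := hb
  by_contra hcon
  push Not at hcon
  refine hfree ⟨⟨u, ?_, hau⟩, v, ?_, hbv⟩
  · have h1 : (part u : ℕ) ≠ i := fun h => (hcon u h).1.not_ge hau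
    have h2 : (part u : ℕ) < i + 1 := hu
    change (part u : ℕ) < i
    omega
  · have h1 : (part v : ℕ) ≠ i := fun h => (hcon v h).2.not_ge hbv
    have h2 : (part v : ℕ) < i + 1 := hv
    change (part v : ℕ) < i
    omega

theorem FreeNear.symm (hsymm : ∀ x y j, E x y j → E y x j) {i T : ℕ} {C : Piece G part r} {a b : V}
    {j : ℕ} (h : FreeNear G E p part r i T C a b j) : FreeNear G E p part r i T C b a j := by
  obtain ⟨hj, he, ha, hb, hf, u, hu, hui, hd⟩ := h
  exact ⟨hj, hsymm _ _ _ he, hb, ha, fun hf' => hf hf'.symm, u, hu, hui, hd.symm⟩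

theorem FreeNear.exists_edist_le (hE : ∀ x y, G.Adj x y ↔ ∃ j < p, E x y j) {i T : ℕ}
    {C : Piece G part r} {a b : V} {j : ℕ} (h : FreeNear G E p part r i T C a b j) :
    ∃ u, (pieceGraph G part r).connectedComponentMk u = C ∧ (part u : ℕ) = i ∧
      G.edist a u ≤ (T + 1 : ℕ) := by
  obtain ⟨hj, he, -, -, -, u, hu, hui, hd | hd⟩ := h
  · exact ⟨u, hu, hui, edist_le_mono hd (Nat.le_succ T)⟩
  · exact ⟨u, hu, hui, edist_le_succ_iff.2 (Or.inr ⟨b, (hE a b).2 ⟨j, hj, he⟩, hd⟩)⟩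

-- The free edges near one piece form a unit for the exchange. A free edge incident with one of them
-- is close to some vertex v of part i; both v and a vertex of `C` have distance at most T + 1 from
-- the common end, so v belongs to `C` because `2 * T + 2 ≤ r`. The depth of `C` guarantees that
-- both windows see the true zones around these edges and so agree about which of them are free.
open Classical in
theorem stageValid_exchange (hE : ∀ x y, G.Adj x y ↔ ∃ j < p, E x y j)
    (hsymm : ∀ x y j, E x y j → E y x j) {A W₁ W₂ : Set V} (hA₁ : A ⊆ W₁) (hA₂ : A ⊆ W₂)
    {i T K ρ : ℕ} (hT : 2 * T + 2 ≤ r) {prev₁ prev₂ c₁ c₂ : V → V → ℕ → ℕ}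
    (h₁ : StageValid W₁ E p (Near W₁ E p (fun x => (part x : ℕ)) (i + 1) T)
      (Near W₁ E p (fun x => (part x : ℕ)) i T) K prev₁ c₁)
    (h₂ : StageValid W₂ E p (Near W₂ E p (fun x => (part x : ℕ)) (i + 1) T)
      (Near W₂ E p (fun x => (part x : ℕ)) i T) K prev₂ c₂)
    (hprev : ∀ a b j, j < p → E a b j → Deep G part r A (ρ + 1) a →
      NearDist G (fun x => (part x : ℕ)) i T a → NearDist G (fun x => (part x : ℕ)) i T b →
      prev₁ a b j = prev₂ a b j)
    {C : Piece G part r}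
    (hC : ∀ u, (pieceGraph G part r).connectedComponentMk u = C → Deep G part r A (ρ + 2) u) :
    StageValid W₁ E p (Near W₁ E p (fun x => (part x : ℕ)) (i + 1) T)
      (Near W₁ E p (fun x => (part x : ℕ)) i T) K prev₁
      fun a b j => if FreeNear G E p part r i T C a b j then c₂ a b j else c₁ a b j := by
  have hdeep : ∀ {a b j}, FreeNear G E p part r i T C a b j → Deep G part r A (ρ + 1) a := by
    intro a b j h
    obtain ⟨u, hu, -, hau⟩ := h.exists_edist_le hE
    exact (hC u hu).of_edist (edist_symm_le (edist_le_mono hau (by omega)))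
  have hnear : ∀ {W : Set V} {x : V} {i' : ℕ}, A ⊆ W → (∀ z, G.edist x z ≤ T → z ∈ A) →
      (Near W E p (fun x => (part x : ℕ)) i' T x ↔ NearDist G (fun x => (part x : ℕ)) i' T x) :=
    fun hAW hx => near_iff_nearDist hE fun y hy => hAW (hx y hy)
  refine h₁.exchange h₂ _ (fun a b j h => h.symm hsymm) (fun a b j h => ?_) ?_
  · have hab : ∀ z, G.edist a z ≤ T → z ∈ A := fun z hz => (hdeep h).ball (by omega) hz
    have hba : ∀ z, G.edist b z ≤ T → z ∈ A :=
      fun z hz => (hdeep (h.symm hsymm)).ball (by omega) hz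
    refine ⟨hA₂ (hdeep h).mem, (hnear hA₂ hab).2 h.2.2.1, ?_⟩
    rw [hnear hA₁ hab, hnear hA₁ hba]
    exact h.2.2.2.2.1
  · intro a b j h b' hb' j' hj' he' hDb'
    have hadj := (hE a b').2 ⟨j', hj', he'⟩
    have hab : ∀ z, G.edist a z ≤ T → z ∈ A := fun z hz => (hdeep h).ball (by omega) hz
    have hba : ∀ z, G.edist b' z ≤ T → z ∈ A := fun z hz =>
      (hdeep h).ball (t := T + 1) (by omega) (edist_le_succ_iff.2 (Or.inr ⟨b', hadj, hz⟩))
    rw [hnear hA₁ hba] at hDb'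
    rw [hnear hA₁ hba, hnear hA₁ hab, hnear hA₂ hba, hnear hA₂ hab, hnear hA₂ hba]
    by_cases hf : NearDist G (fun x => (part x : ℕ)) i T a ∧
        NearDist G (fun x => (part x : ℕ)) i T b'
    · exact Or.inr ⟨hf.1, hf.2, hf.1, hf.2, hA₂ (hba b' (by simp)), hDb',
        hprev a b' j' hj' he' (hdeep h) hf.1 hf.2⟩
    · obtain ⟨v, hv, hav⟩ := exists_part_eq h.2.2.1 hDb' hf
      refine Or.inl ⟨hj', he', h.2.2.1, hDb', hf, v, ?_, hv, hav⟩
      obtain ⟨u, hu, hui, hau⟩ := h.exists_edist_le hE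
      have hav' : G.edist a v ≤ (T + 1 : ℕ) := by
        rcases hav with hav | hav
        · exact edist_le_mono hav (Nat.le_succ T)
        · exact edist_le_succ_iff.2 (Or.inr ⟨b', hadj, hav⟩)
      rw [← hu]
      exact same_piece (Fin.ext (hv.trans hui.symm))
        (edist_le_mono (edist_le_add (edist_symm_le hav') hau) (by omega))

/-- At edges deep in two windows, the least colorings in these windows agree. -/
theorem stage_eq [LinearOrder V] (hE : ∀ x y, G.Adj x y ↔ ∃ j < p, E x y j)
    (hsymm : ∀ x y j, E x y j → E y x j) {W₁ W₂ : Set V} (hW₁ : W₁.Finite)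
    {i T K B ρ : ℕ} (hT : 2 * T + 2 ≤ r) {prev₁ prev₂ c₁ c₂ : V → V → ℕ → ℕ}
    (h₁ : IsLeastColoring W₁ p B (StageValid W₁ E p
      (Near W₁ E p (fun x => (part x : ℕ)) (i + 1) T)
      (Near W₁ E p (fun x => (part x : ℕ)) i T) K prev₁) c₁)
    (h₂ : IsLeastColoring W₂ p B (StageValid W₂ E p
      (Near W₂ E p (fun x => (part x : ℕ)) (i + 1) T)
      (Near W₂ E p (fun x => (part x : ℕ)) i T) K prev₂) c₂)
    (hprev : ∀ a b j, j < p → E a b j → Deep G part r (W₁ ∩ W₂) (ρ + 1) a →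
      NearDist G (fun x => (part x : ℕ)) i T a → NearDist G (fun x => (part x : ℕ)) i T b →
      prev₁ a b j = prev₂ a b j)
    {x y : V} {j : ℕ} (hj : j < p) (he : E x y j) (hx : Deep G part r (W₁ ∩ W₂) (ρ + 3) x)
    (hNx : NearDist G (fun x => (part x : ℕ)) (i + 1) T x)
    (hNy : NearDist G (fun x => (part x : ℕ)) (i + 1) T y) : c₁ x y j = c₂ x y j := by
  have hadj := (hE x y).2 ⟨j, hj, he⟩
  -- A fixed edge inherits the agreement from the previous stage. A free edge is close to a piece of
  -- part i, where the exchange applies: one layer is lost from `x` to this piece, another from the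
  -- piece to its free edges, which leaves `ρ + 1` for comparing the previous colorings.
  by_cases hf : NearDist G (fun x => (part x : ℕ)) i T x ∧
      NearDist G (fun x => (part x : ℕ)) i T y
  · have hxb : ∀ z, G.edist x z ≤ T → z ∈ W₁ ∩ W₂ := fun z hz => hx.ball (by omega) hz
    have hyb : ∀ z, G.edist y z ≤ T → z ∈ W₁ ∩ W₂ := fun z hz =>
      hx.ball (t := T + 1) (by omega) (edist_le_succ_iff.2 (Or.inr ⟨y, hadj, hz⟩))
    have key : ∀ {W : Set V} {prev c : V → V → ℕ → ℕ}, W₁ ∩ W₂ ⊆ W →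
        StageValid W E p (Near W E p (fun x => (part x : ℕ)) (i + 1) T)
          (Near W E p (fun x => (part x : ℕ)) i T) K prev c → c x y j = prev x y j := by
      intro W prev c hW h
      refine (h x (hW (hxb x (by simp))) y (hW (hyb y (by simp))) j hj he ?_ ?_).2.2.1 ?_ ?_
      · exact (near_iff_nearDist hE fun z hz => hW (hxb z hz)).2 hNx
      · exact (near_iff_nearDist hE fun z hz => hW (hyb z hz)).2 hNy
      · exact (near_iff_nearDist hE fun z hz => hW (hxb z hz)).2 hf.1
      · exact (near_iff_nearDist hE fun z hz => hW (hyb z hz)).2 hf.2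
    have h3 : c₁ x y j = prev₁ x y j := key Set.inter_subset_left h₁.1
    have h4 : c₂ x y j = prev₂ x y j := key Set.inter_subset_right h₂.1
    rw [h3, h4]
    exact hprev x y j hj he (hx.mono (by omega)) hf.1 hf.2
  · obtain ⟨u, hu, hxu⟩ := exists_part_eq hNx hNy hf
    have hX : FreeNear G E p part r i T ((pieceGraph G part r).connectedComponentMk u) x y j :=
      ⟨hj, he, hNx, hNy, hf, u, rfl, hu, hxu⟩
    have hxu' : G.edist x u ≤ (T + 1 : ℕ) := by
      rcases hxu with h | h
      · exact edist_le_mono h (Nat.le_succ T)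
      · exact edist_le_succ_iff.2 (Or.inr ⟨y, hadj, h⟩)
    have hC : ∀ v, (pieceGraph G part r).connectedComponentMk v =
        (pieceGraph G part r).connectedComponentMk u → Deep G part r (W₁ ∩ W₂) (ρ + 2) v :=
      fun v hv => (deep_same hv).2 (hx.of_edist (edist_le_mono hxu' (by omega)))
    have hmem : ∀ a b j, FreeNear G E p part r i T
        ((pieceGraph G part r).connectedComponentMk u) a b j → a ∈ W₁ ∩ W₂ := by
      intro a b j h
      obtain ⟨v, hv, -, hav⟩ := h.exists_edist_le hE
      exact ((hC v hv).of_edist (edist_symm_le (edist_le_mono hav (by omega)))).mem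
    exact h₁.eq_of_exchange h₂ hW₁ _ (fun a b j h => ⟨(hmem a b j h).1,
        (hmem b a j (h.symm hsymm)).1, (hmem a b j h).2, (hmem b a j (h.symm hsymm)).2, h.1⟩)
      (stageValid_exchange hE hsymm Set.inter_subset_left Set.inter_subset_right hT h₁.1 h₂.1
        hprev hC)
      (stageValid_exchange hE hsymm Set.inter_subset_right Set.inter_subset_left hT h₂.1 h₁.1
        (fun a b j hj he ha h h' => (hprev a b j hj he ha h h').symm) hC) hX

/-- At vertices deep in two windows, the least names in these windows agree. -/
theorem name_eq [LinearOrder V] (hE : ∀ x y, G.Adj x y ↔ ∃ j < p, E x y j)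
    {W₁ W₂ : Set V} (hW₁ : W₁.Finite) (hp : 0 < p) (hr : 2 ≤ r)
    (hsymm : ∀ x y j, E x y j → E y x j)
    {K B : ℕ} {c₁ c₂ : V → V → ℕ → ℕ}
    (h₁ : IsLeastColoring W₁ p B (NameValid W₁ E p (fun x => (part x : ℕ)) K) c₁)
    (h₂ : IsLeastColoring W₂ p B (NameValid W₂ E p (fun x => (part x : ℕ)) K) c₂)
    {x : V} (hx : Deep G part r (W₁ ∩ W₂) 1 x) : c₁ x x 0 = c₂ x x 0 := by
  classical
  -- Names occupy the diagonal slots. Vertices that need different names lie in the same part at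
  -- distance at most 2 ≤ r, hence in the same piece, so the names of a whole piece can be
  -- exchanged.
  obtain ⟨X, hXiff⟩ : ∃ X : V → V → ℕ → Prop, ∀ a b j, X a b j ↔ a = b ∧ j = 0 ∧
      (pieceGraph G part r).connectedComponentMk a =
        (pieceGraph G part r).connectedComponentMk x := ⟨_, fun _ _ _ => Iff.rfl⟩
  have hX : ∀ {a b j}, X a b j → Deep G part r (W₁ ∩ W₂) 1 a :=
    fun h => (deep_same ((hXiff _ _ _).1 h).2.2).2 hx
  have key : ∀ {W W' : Set V} {c c' : V → V → ℕ → ℕ}, W₁ ∩ W₂ ⊆ W' →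
      NameValid W E p (fun x => (part x : ℕ)) K c → NameValid W' E p (fun x => (part x : ℕ)) K c' →
      NameValid W E p (fun x => (part x : ℕ)) K
        fun a b j => if X a b j then c' a b j else c a b j := by
    intro W W' c c' hW' h h'
    have := h.exchange h' (fun a => X a a 0) (fun a ha => ⟨hW' (hX ha).mem, ?_⟩) ?_
    · exact this
    · intro z _ j hj he
      exact hW' ((hX ha).ball (t := 1) (by omega) (edist_le_one ((hE a z).2 ⟨j, hj, hsymm _ _ _ he⟩)))
    · intro a b z hpt h3 h4 ha
      refine (hXiff _ _ _).2 ⟨rfl, rfl, (same_piece (Fin.ext hpt.symm) ?_).trans ((hXiff _ _ _).1 ha).2.2⟩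
      exact edist_le_mono (edist_le_add (edist_symm_le (edist_le_one ((hE z b).2 h4)))
        (edist_le_one ((hE z a).2 h3))) hr
  refine h₁.eq_of_exchange h₂ hW₁ X ?_ (key Set.inter_subset_right h₁.1 h₂.1)
    (key Set.inter_subset_left h₂.1 h₁.1) ((hXiff _ _ _).2 ⟨rfl, rfl, rfl⟩)
  intro a b j h
  have ha := (hX h).mem
  obtain ⟨rfl, rfl, -⟩ := (hXiff _ _ _).1 h
  exact ⟨ha.1, ha.1, ha.2, ha.2, hp⟩

end Deep

/-! ### Coding colorings of a numbered window by numbers -/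

section Codes

/-- The edge coloring coded by the digits of the number `w` in base `B`. -/
def digitColor (m p B w x y j : ℕ) : ℕ := w / B ^ ((x * m + y) * p + j) % B

open Classical in
/-- The least number less than `N` that satisfies `P`, or `N` if there is none. -/
noncomputable def leastBelow (N : ℕ) (P : ℕ → Prop) : ℕ :=
  (List.range N).findIdx fun w => decide (P w)

theorem leastBelow_spec {N : ℕ} {P : ℕ → Prop} (h : ∃ w < N, P w) :
    P (leastBelow N P) ∧ ∀ w < leastBelow N P, ¬ P w := by
  classical
  have hlt : (List.range N).findIdx (fun w => decide (P w)) < (List.range N).length := by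
    rw [List.findIdx_lt_length]
    obtain ⟨w, hw, hPw⟩ := h
    exact ⟨w, List.mem_range.2 hw, by simpa using hPw⟩
  constructor
  · have := List.findIdx_getElem (w := hlt)
    simpa [leastBelow] using this
  · intro w hw
    have := List.not_of_lt_findIdx (p := fun w => decide (P w)) (xs := List.range N) (i := w)
      (by unfold leastBelow at hw; convert hw)
    simpa using this

theorem slotIndex_div {x y j m p : ℕ} (hy : y < m) (hj : j < p) :
    ((x * m + y) * p + j) / p / m = x ∧ ((x * m + y) * p + j) / p % m = y ∧
      ((x * m + y) * p + j) % p = j := by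
  have h1 : ((x * m + y) * p + j) / p = x * m + y := by
    rw [mul_comm, Nat.mul_add_div (by omega), Nat.div_eq_of_lt hj, add_zero]
  have h2 : ((x * m + y) * p + j) % p = j := by
    rw [mul_comm, Nat.mul_add_mod, Nat.mod_eq_of_lt hj]
  refine ⟨?_, ?_, h2⟩
  · rw [h1, mul_comm, Nat.mul_add_div (by omega), Nat.div_eq_of_lt hy, add_zero]
  · rw [h1, mul_comm, Nat.mul_add_mod, Nat.mod_eq_of_lt hy]

theorem mul_add_lt {a b c d : ℕ} (hab : a < b) (hc : c < d) : a * d + c < b * d :=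
  calc a * d + c < a * d + d := by omega
    _ = (a + 1) * d := by ring
    _ ≤ b * d := Nat.mul_le_mul_right _ hab

theorem slotIndex_lt {x y j m p : ℕ} (hx : x < m) (hy : y < m) (hj : j < p) :
    (x * m + y) * p + j < m * m * p :=
  mul_add_lt (mul_add_lt hx hy) hj

theorem index_slot {t m p : ℕ} (ht : t < m * m * p) :
    t / p / m < m ∧ t / p % m < m ∧ t % p < p ∧ (t / p / m * m + t / p % m) * p + t % p = t := by
  have hp : 0 < p := Nat.pos_of_ne_zero (by rintro rfl; simp at ht)
  have hm : 0 < m := Nat.pos_of_ne_zero (by rintro rfl; simp at ht)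
  refine ⟨?_, Nat.mod_lt _ hm, Nat.mod_lt _ hp, ?_⟩
  · rw [Nat.div_lt_iff_lt_mul hm, Nat.div_lt_iff_lt_mul hp]
    exact ht
  · rw [Nat.div_add_mod', Nat.div_add_mod']

theorem exists_digitColor_eq {m p B : ℕ} {c : ℕ → ℕ → ℕ → ℕ} (hc : ∀ x y j, c x y j < B) :
    ∃ w < B ^ (m * m * p), ∀ x < m, ∀ y < m, ∀ j < p, digitColor m p B w x y j = c x y j := by
  obtain ⟨w, hw, h⟩ := exists_digits_eq (fun t => c (t / p / m) (t / p % m) (t % p)) (m * m * p)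
    fun u _ => hc _ _ _
  refine ⟨w, hw, fun x hx y hy j hj => ?_⟩
  rw [digitColor, h _ (slotIndex_lt hx hy hj)]
  obtain ⟨h1, h2, h3⟩ := slotIndex_div (x := x) hy hj
  rw [h1, h2, h3]

/-- An order isomorphism between `W` and `{0, …, m - 1}` with its inverse, both extended by
arbitrary values. -/
structure VertexNumbering {V : Type u} [LinearOrder V] (W : Set V) (m : ℕ) (φ : V → ℕ) (ψ : ℕ → V) :
    Prop where
  lt : ∀ x ∈ W, φ x < m
  mem : ∀ a < m, ψ a ∈ W
  left_inv : ∀ x ∈ W, ψ (φ x) = x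
  right_inv : ∀ a < m, φ (ψ a) = a
  mono : ∀ x ∈ W, ∀ y ∈ W, x < y → φ x < φ y

variable {V : Type u} [LinearOrder V] {W : Set V} {m : ℕ} {φ : V → ℕ} {ψ : ℕ → V}

/-- The index of a slot preserves the lexicographic order, so minimality of the code amounts to
colex-minimality for the order on `V` itself. In this form, choices made in windows with different
numberings can be compared. -/
theorem VertexNumbering.isLeastColoring (h : VertexNumbering W m φ ψ) {p B w : ℕ} (hB : 0 < B)
    {P : (V → V → ℕ → ℕ) → Prop} {Q : (ℕ → ℕ → ℕ → ℕ) → Prop}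
    (hcongr : ∀ c c', (∀ x < m, ∀ y < m, ∀ j < p, c x y j = c' x y j) → Q c → Q c')
    (hQP : ∀ c, Q c → P fun x y j => c (φ x) (φ y) j)
    (hPQ : ∀ c, P c → Q fun a b j => c (ψ a) (ψ b) j)
    (hw : Q (digitColor m p B w)) (hmin : ∀ w' < w, ¬ Q (digitColor m p B w')) :
    IsLeastColoring W p B P fun x y j => digitColor m p B w (φ x) (φ y) j := by
  let ι : (ℕ → ℕ) → ℕ → ℕ → ℕ → ℕ := fun u x y j => u ((x * m + y) * p + j)
  have hleast : IsColexLeast (Set.Iio (m * m * p)) B (fun u => Q (ι u))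
      fun t => w / B ^ t % B :=
    isColexLeast_digits hB (fun c c' hcc => hcongr _ _ fun x hx y hy j hj =>
      hcc _ (slotIndex_lt hx hy hj)) hw hmin
  refine hleast.comp (A := slotsOn W p)
    (φ := fun a => (φ (ofLex a).1 * m + φ (ofLex (ofLex a).2).1) * p + (ofLex (ofLex a).2).2)
    (ψ := fun t => slot (ψ (t / p / m)) (ψ (t / p % m)) (t % p)) ?_ ?_ ?_ ?_ ?_ ?_ ?_
  · rintro _ ⟨x, hx, y, hy, j, hj, rfl⟩
    exact slotIndex_lt (h.lt x hx) (h.lt y hy) hj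
  · intro t ht
    obtain ⟨h1, h2, h3, -⟩ := index_slot ht
    exact ⟨_, h.mem _ h1, _, h.mem _ h2, _, h3, rfl⟩
  · rintro _ ⟨x, hx, y, hy, j, hj, rfl⟩
    obtain ⟨h1, h2, h3⟩ := slotIndex_div (x := φ x) (h.lt y hy) hj
    change slot (ψ (((φ x * m + φ y) * p + j) / p / m)) (ψ (((φ x * m + φ y) * p + j) / p % m))
      (((φ x * m + φ y) * p + j) % p) = _
    rw [h1, h2, h3, h.left_inv x hx, h.left_inv y hy]
  · intro t ht
    obtain ⟨h1, h2, h3, h4⟩ := index_slot ht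
    change (φ (ψ (t / p / m)) * m + φ (ψ (t / p % m))) * p + t % p = t
    rw [h.right_inv _ h1, h.right_inv _ h2, h4]
  · rintro _ ⟨x, hx, y, hy, j, hj, rfl⟩ _ ⟨x', hx', y', hy', j', hj', rfl⟩ hlt
    change (φ x * m + φ y) * p + j < (φ x' * m + φ y') * p + j'
    rcases slot_lt.1 hlt with hlt | ⟨rfl, hlt | ⟨rfl, hlt⟩⟩
    · have h1 := mul_add_lt (h.mono x hx x' hx' hlt) (h.lt y hy)
      have h2 := mul_add_lt (b := φ x' * m + φ y') (h1.trans_le (Nat.le_add_right _ _)) hj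
      omega
    · have h2 := mul_add_lt (b := φ x * m + φ y')
        (Nat.add_lt_add_left (h.mono y hy y' hy' hlt) (φ x * m)) hj
      omega
    · omega
  · exact fun hc => hQP _ hc
  · intro d hd
    refine hcongr _ _ (fun x hx y hy j hj => ?_) (hPQ _ hd)
    obtain ⟨h1, h2, h3⟩ := slotIndex_div (x := x) hy hj
    change _ = d (slot _ _ _)
    rw [h1, h2, h3]
    rfl

end Codes

/-! ### The choices of the algorithm and their minimality -/

section Algorithm

/-- A bound for the colors and names that the algorithm uses. -/
def digitBase (k p s : ℕ) : ℕ := k * k + k + p * s + 2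

/-- The width of the zone around the first parts that is colored at stage `i`. -/
def zoneWidth (k p s i : ℕ) : ℕ := (s - i) * pasteRadius (k + p * s)

/-- The colorings that the algorithm may choose at stage `i`. -/
def StageSpec (k p s : ℕ) {V : Type*} (W : Set V) (E : V → V → ℕ → Prop) (pt : V → ℕ) (i : ℕ)
    (prev : V → V → ℕ → ℕ) : (V → V → ℕ → ℕ) → Prop :=
  StageValid W E p (Near W E p pt (i + 1) (zoneWidth k p s i))
    (Near W E p pt i (zoneWidth k p s i)) (k + p * i) prev

/-- The code of the coloring chosen before stage `i`. -/
noncomputable def stageCode (k p s m : ℕ) (E : ℕ → ℕ → ℕ → Prop) (pt : ℕ → ℕ) : ℕ → ℕ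
  -- An arbitrary value, since no edge is fixed at stage 0.
  | 0 => 0
  | i + 1 => leastBelow (digitBase k p s ^ (m * m * p)) fun w =>
      StageSpec k p s (Set.Iio m) E pt i
        (digitColor m p (digitBase k p s) (stageCode k p s m E pt i))
        (digitColor m p (digitBase k p s) w)

/-- The code of the names chosen by the algorithm. -/
noncomputable def nameCode (k p s m : ℕ) (E : ℕ → ℕ → ℕ → Prop) (pt : ℕ → ℕ) : ℕ :=
  leastBelow (digitBase k p s ^ (m * m * p)) fun w =>
    NameValid (Set.Iio m) E p pt (k * k + 1) (digitColor m p (digitBase k p s) w)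

/-- The name of a vertex. -/
noncomputable def vertexName (k p s m : ℕ) (E : ℕ → ℕ → ℕ → Prop) (pt : ℕ → ℕ) (x : ℕ) : ℕ :=
  Nat.pair (pt x) (digitColor m p (digitBase k p s) (nameCode k p s m E pt) x x 0)

open Classical in
/-- The label of a vertex: its name and the list of the names of its neighbors with the colors of
the edges to them. -/
noncomputable def vertexLabel (k p s m : ℕ) (E : ℕ → ℕ → ℕ → Prop) (pt : ℕ → ℕ) (x : ℕ) :
    ℕ × List (ℕ × ℕ) :=
  (vertexName k p s m E pt x, (List.range m).flatMap fun y =>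
    (List.range p).flatMap fun j => if E x y j then
      [(vertexName k p s m E pt y,
        digitColor m p (digitBase k p s) (stageCode k p s m E pt (s + 1)) x y j)] else [])

theorem mem_vertexLabel {k p s m : ℕ} {E : ℕ → ℕ → ℕ → Prop} {pt : ℕ → ℕ} {x b t : ℕ} :
    (b, t) ∈ (vertexLabel k p s m E pt x).2 ↔ ∃ y < m, ∃ j < p, E x y j ∧
      vertexName k p s m E pt y = b ∧
      digitColor m p (digitBase k p s) (stageCode k p s m E pt (s + 1)) x y j = t := by
  simp [vertexLabel, eq_comm]

/-- A valid choice at one stage makes a valid choice at the next one possible: the zone fixed at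
stage i + 1 is narrower by at least `pasteRadius (k + p * i)` than the zone colored at stage i.
Hence the search by `leastBelow` always succeeds. -/
theorem stageCode_spec {k p s m : ℕ} {E : ℕ → ℕ → ℕ → Prop} {pt : ℕ → ℕ}
    (hsymm : ∀ x ∈ Set.Iio m, ∀ y ∈ Set.Iio m, ∀ j, E x y j → E y x j)
    (hloop : ∀ x ∈ Set.Iio m, ∀ j, ¬ E x x j) {χ : ℕ → ℕ → ℕ → ℕ}
    (hχ : IsProperOn (Set.Iio m) E p k χ) {i : ℕ} (hi : i ≤ s) :
    StageSpec k p s (Set.Iio m) E pt i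
        (digitColor m p (digitBase k p s) (stageCode k p s m E pt i))
        (digitColor m p (digitBase k p s) (stageCode k p s m E pt (i + 1))) ∧
      ∀ w < stageCode k p s m E pt (i + 1), ¬ StageSpec k p s (Set.Iio m) E pt i
        (digitColor m p (digitBase k p s) (stageCode k p s m E pt i))
        (digitColor m p (digitBase k p s) w) := by
  induction i with
  | zero =>
    obtain ⟨c, hc, hcB⟩ := exists_stageValid_zero hχ
      (Near (Set.Iio m) E p pt (0 + 1) (zoneWidth k p s 0))
      (Near (Set.Iio m) E p pt 0 (zoneWidth k p s 0)) (fun x => not_near_zero)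
      (digitColor m p (digitBase k p s) (stageCode k p s m E pt 0))
    obtain ⟨w, hw, hwc⟩ := exists_digitColor_eq (m := m) (p := p) (B := digitBase k p s) (c := c)
      (fun x y j => (hcB x y j).trans_le (by unfold digitBase; omega))
    have hex : ∃ w < digitBase k p s ^ (m * m * p), StageSpec k p s (Set.Iio m) E pt 0
        (digitColor m p (digitBase k p s) (stageCode k p s m E pt 0))
        (digitColor m p (digitBase k p s) w) :=
      ⟨w, hw, hc.congr fun x hx y hy j hj => (hwc x hx y hy j hj).symm⟩
    exact leastBelow_spec hex
  | succ i ih =>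
    have hw : zoneWidth k p s (i + 1) + pasteRadius (k + p * i) ≤ zoneWidth k p s i := by
      have h1 : pasteRadius (k + p * i) ≤ pasteRadius (k + p * s) :=
        pasteRadius_mono (Nat.add_le_add_left (Nat.mul_le_mul_left _ (by omega)) _)
      have h2 : s - i = s - (i + 1) + 1 := by omega
      unfold zoneWidth
      rw [h2, Nat.add_mul, one_mul]
      omega
    obtain ⟨c, hc, hcB⟩ := exists_stageValid_succ (Set.finite_Iio m) hsymm hloop hχ
      (Nat.le_add_right k (p * i)) hw (D := Near (Set.Iio m) E p pt (i + 1 + 1)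
        (zoneWidth k p s (i + 1))) (ih (by omega)).1
    have hK : k + p * i + p = k + p * (i + 1) := by ring
    have hKs : p * (i + 1) ≤ p * s := Nat.mul_le_mul_left _ hi
    rw [hK] at hc
    obtain ⟨w, hw, hwc⟩ := exists_digitColor_eq (m := m) (p := p) (B := digitBase k p s) (c := c)
      (fun x y j => (hcB x y j).trans_le (by unfold digitBase; rw [hK]; nlinarith))
    have hex : ∃ w < digitBase k p s ^ (m * m * p), StageSpec k p s (Set.Iio m) E pt (i + 1)
        (digitColor m p (digitBase k p s) (stageCode k p s m E pt (i + 1)))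
        (digitColor m p (digitBase k p s) w) :=
      ⟨w, hw, hc.congr fun x hx y hy j hj => (hwc x hx y hy j hj).symm⟩
    exact leastBelow_spec hex

theorem nameCode_spec {k p s m : ℕ} (hp : 0 < p) {E : ℕ → ℕ → ℕ → Prop} {pt : ℕ → ℕ}
    (hsymm : ∀ x ∈ Set.Iio m, ∀ y ∈ Set.Iio m, ∀ j, E x y j → E y x j) {χ : ℕ → ℕ → ℕ → ℕ}
    (hχ : IsProperOn (Set.Iio m) E p k χ) :
    NameValid (Set.Iio m) E p pt (k * k + 1)
        (digitColor m p (digitBase k p s) (nameCode k p s m E pt)) ∧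
      ∀ w < nameCode k p s m E pt, ¬ NameValid (Set.Iio m) E p pt (k * k + 1)
        (digitColor m p (digitBase k p s) w) := by
  obtain ⟨c, hc, hcB⟩ := exists_nameValid (Set.finite_Iio m) hsymm hχ pt
  obtain ⟨w, hw, hwc⟩ := exists_digitColor_eq (m := m) (p := p) (B := digitBase k p s) (c := c)
      (fun x y j => (hcB x y j).trans_le (by unfold digitBase; omega))
  have hex : ∃ w < digitBase k p s ^ (m * m * p), NameValid (Set.Iio m) E p pt (k * k + 1)
      (digitColor m p (digitBase k p s) w) :=
    ⟨w, hw, hc.congr fun x hx => (hwc x hx x hx 0 hp).symm⟩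
  exact leastBelow_spec hex

section Pull

variable {V : Type u} [LinearOrder V] {W : Set V} {k p s m : ℕ} {φ : V → ℕ} {ψ : ℕ → V}
  {E : V → V → ℕ → Prop} {E' : ℕ → ℕ → ℕ → Prop} {pt : V → ℕ} {pt' : ℕ → ℕ}

/-- The coloring of a numbered window that is chosen before stage `i`. -/
noncomputable def windowColor (k p s m : ℕ) (E' : ℕ → ℕ → ℕ → Prop) (pt' : ℕ → ℕ) (φ : V → ℕ)
    (i : ℕ) (x y : V) (j : ℕ) : ℕ :=
  digitColor m p (digitBase k p s) (stageCode k p s m E' pt' i) (φ x) (φ y) j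

/-- The names chosen in a numbered window. -/
noncomputable def windowNames (k p s m : ℕ) (E' : ℕ → ℕ → ℕ → Prop) (pt' : ℕ → ℕ) (φ : V → ℕ)
    (x y : V) (j : ℕ) : ℕ :=
  digitColor m p (digitBase k p s) (nameCode k p s m E' pt') (φ x) (φ y) j

theorem VertexNumbering.injOn (h : VertexNumbering W m φ ψ) : Set.InjOn φ W := by
  intro x hx y hy hxy
  rw [← h.left_inv x hx, hxy, h.left_inv y hy]

theorem VertexNumbering.surjOn (h : VertexNumbering W m φ ψ) : Set.SurjOn φ W (Set.Iio m) :=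
  fun a ha => ⟨ψ a, h.mem a ha, h.right_inv a ha⟩

theorem VertexNumbering.injOn_inv (h : VertexNumbering W m φ ψ) : Set.InjOn ψ (Set.Iio m) := by
  intro a ha b hb hab
  rw [← h.right_inv a ha, hab, h.right_inv b hb]

theorem VertexNumbering.edge_inv (h : VertexNumbering W m φ ψ)
    (hE : ∀ x ∈ W, ∀ y ∈ W, ∀ j, E x y j ↔ E' (φ x) (φ y) j) :
    ∀ a ∈ Set.Iio m, ∀ b ∈ Set.Iio m, ∀ j, E' a b j ↔ E (ψ a) (ψ b) j := by
  intro a ha b hb j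
  rw [hE _ (h.mem a ha) _ (h.mem b hb), h.right_inv a ha, h.right_inv b hb]

theorem VertexNumbering.stageSpec_comp (h : VertexNumbering W m φ ψ)
    (hE : ∀ x ∈ W, ∀ y ∈ W, ∀ j, E x y j ↔ E' (φ x) (φ y) j) (hpt : ∀ x ∈ W, pt x = pt' (φ x))
    {i : ℕ} {prev c : ℕ → ℕ → ℕ → ℕ} (hc : StageSpec k p s (Set.Iio m) E' pt' i prev c) :
    StageSpec k p s W E pt i (fun x y j => prev (φ x) (φ y) j) fun x y j => c (φ x) (φ y) j :=
  StageValid.comp h.lt h.injOn hE (fun _ hx => near_map h.surjOn h.lt hE hpt hx)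
    (fun _ hx => near_map h.surjOn h.lt hE hpt hx) (fun _ _ _ _ _ _ => rfl)
    (fun _ _ _ _ _ _ => rfl) hc

theorem VertexNumbering.stageSpec_comp_inv (h : VertexNumbering W m φ ψ)
    (hE : ∀ x ∈ W, ∀ y ∈ W, ∀ j, E x y j ↔ E' (φ x) (φ y) j) (hpt : ∀ x ∈ W, pt x = pt' (φ x))
    {i : ℕ} {prev : ℕ → ℕ → ℕ → ℕ} {c : V → V → ℕ → ℕ}
    (hc : StageSpec k p s W E pt i (fun x y j => prev (φ x) (φ y) j) c) :
    StageSpec k p s (Set.Iio m) E' pt' i prev fun a b j => c (ψ a) (ψ b) j := by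
  have hpt' : ∀ a ∈ Set.Iio m, pt' a = pt (ψ a) := fun a ha => by
    rw [hpt _ (h.mem a ha), h.right_inv a ha]
  have hsurj : Set.SurjOn ψ (Set.Iio m) W := fun x hx => ⟨φ x, h.lt x hx, h.left_inv x hx⟩
  exact StageValid.comp h.mem h.injOn_inv (h.edge_inv hE)
    (fun _ ha => near_map hsurj h.mem (h.edge_inv hE) hpt' ha)
    (fun _ ha => near_map hsurj h.mem (h.edge_inv hE) hpt' ha)
    (fun a ha b hb j _ => by simp only [h.right_inv a ha, h.right_inv b hb])
    (fun _ _ _ _ _ _ => rfl) hc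

theorem VertexNumbering.isProperOn (h : VertexNumbering W m φ ψ)
    (hE : ∀ x ∈ W, ∀ y ∈ W, ∀ j, E x y j ↔ E' (φ x) (φ y) j) {χ : V → V → ℕ → ℕ}
    (hχ : IsProperOn W E p k χ) :
    IsProperOn (Set.Iio m) E' p k fun a b j => χ (ψ a) (ψ b) j :=
  StageValid.comp h.mem h.injOn_inv (h.edge_inv hE) (fun _ _ => Iff.rfl) (fun _ _ => Iff.rfl)
    (fun _ _ _ _ _ _ => rfl) (fun _ _ _ _ _ _ => rfl) hχ

theorem VertexNumbering.symm_inv (h : VertexNumbering W m φ ψ)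
    (hE : ∀ x ∈ W, ∀ y ∈ W, ∀ j, E x y j ↔ E' (φ x) (φ y) j)
    (hsymm : ∀ x y j, E x y j → E y x j) :
    ∀ a ∈ Set.Iio m, ∀ b ∈ Set.Iio m, ∀ j, E' a b j → E' b a j := by
  intro a ha b hb j he
  rw [h.edge_inv hE b hb a ha]
  exact hsymm _ _ _ ((h.edge_inv hE a ha b hb j).1 he)

theorem VertexNumbering.isLeast_windowColor (h : VertexNumbering W m φ ψ)
    (hE : ∀ x ∈ W, ∀ y ∈ W, ∀ j, E x y j ↔ E' (φ x) (φ y) j) (hpt : ∀ x ∈ W, pt x = pt' (φ x))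
    (hsymm : ∀ x y j, E x y j → E y x j) (hloop : ∀ x j, ¬ E x x j) {χ : V → V → ℕ → ℕ}
    (hχ : IsProperOn W E p k χ) {i : ℕ} (hi : i ≤ s) :
    IsLeastColoring W p (digitBase k p s)
      (StageSpec k p s W E pt i (windowColor k p s m E' pt' φ i))
      (windowColor k p s m E' pt' φ (i + 1)) := by
  obtain ⟨h1, h2⟩ := stageCode_spec (pt := pt') (h.symm_inv hE hsymm)
    (fun a ha j he => hloop _ _ ((h.edge_inv hE a ha a ha j).1 he)) (h.isProperOn hE hχ) hi
  refine h.isLeastColoring (by unfold digitBase; omega) (Q := StageSpec k p s (Set.Iio m) E' pt' i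
      (digitColor m p (digitBase k p s) (stageCode k p s m E' pt' i)))
    (fun c c' hcc hc => ?_) (fun c hc => h.stageSpec_comp hE hpt hc)
    (fun c hc => h.stageSpec_comp_inv hE hpt hc) h1 h2
  exact StageValid.congr hcc hc

theorem VertexNumbering.isLeast_windowNames (h : VertexNumbering W m φ ψ) (hp : 0 < p)
    (hE : ∀ x ∈ W, ∀ y ∈ W, ∀ j, E x y j ↔ E' (φ x) (φ y) j) (hpt : ∀ x ∈ W, pt x = pt' (φ x))
    (hsymm : ∀ x y j, E x y j → E y x j) {χ : V → V → ℕ → ℕ} (hχ : IsProperOn W E p k χ) :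
    IsLeastColoring W p (digitBase k p s) (NameValid W E p pt (k * k + 1))
      (windowNames k p s m E' pt' φ) := by
  obtain ⟨h1, h2⟩ := nameCode_spec (s := s) hp (pt := pt') (h.symm_inv hE hsymm)
    (h.isProperOn hE hχ)
  have hpt' : ∀ a ∈ Set.Iio m, pt' a = pt (ψ a) := fun a ha => by
    rw [hpt _ (h.mem a ha), h.right_inv a ha]
  refine h.isLeastColoring (by unfold digitBase; omega)
    (Q := NameValid (Set.Iio m) E' p pt' (k * k + 1)) (fun c c' hcc hc => ?_)
    (fun c hc => NameValid.comp h.lt h.injOn hE hpt (fun _ _ => rfl) hc)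
    (fun c hc => NameValid.comp h.mem h.injOn_inv (h.edge_inv hE) hpt' (fun _ _ => rfl) hc) h1 h2
  exact NameValid.congr (fun x hx => hcc x hx x hx 0 hp) hc

end Pull

end Algorithm

open ASI

/-! ### The algorithm as an isomorphism-invariant function of its input -/

section Run

variable {p s : ℕ} {V V' : Type u}

/-- The edges of a numbered input: the edge with number `j` joins the vertices with numbers `a`
and `b`. -/
def inputEdge (I : Input (multigraphSignature p) s V) {m : ℕ} (e : V ≃ Fin m) (a b j : ℕ) : Prop :=
  j < p ∧ ∃ x y, I.graph.graph.Adj x y ∧ (∃ i : Fin p, (i : ℕ) = j ∧ I.graph.rel i ![x, y]) ∧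
    (e x : ℕ) = a ∧ (e y : ℕ) = b

/-- The parts of the vertices of a numbered input. -/
def inputPart (I : Input (multigraphSignature p) s V) {m : ℕ} (e : V ≃ Fin m) (a : ℕ) : ℕ :=
  if h : a < m then I.part (e.symm ⟨a, h⟩) else 0

theorem exists_increasing_equiv [Finite V] (ord : LinearOrder V) :
    ∃ e : V ≃ Fin (Nat.card V), ∀ x y, ord.le x y ↔ e x ≤ e y := by
  have := Fintype.ofFinite V
  have e := Fintype.orderIsoFinOfCardEq V (Nat.card_eq_fintype_card (α := V)).symm
  exact ⟨e.symm.toEquiv, fun x y => (e.symm.le_iff_le).symm⟩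

/-- A finite linear order has just one increasing numbering. Hence the numbering chosen in
`edgeColoringRun` can be replaced by any other; isomorphism invariance and computability both rest
on this. -/
theorem increasing_equiv_unique {ord : LinearOrder V} {m m' : ℕ} (e : V ≃ Fin m)
    (e' : V ≃ Fin m') (he : ∀ x y, ord.le x y ↔ e x ≤ e y)
    (he' : ∀ x y, ord.le x y ↔ e' x ≤ e' y) : m = m' ∧ ∀ x, (e x : ℕ) = e' x := by
  have hm : m = m' := by simpa using Fintype.card_congr (e.symm.trans e')
  subst hm
  refine ⟨rfl, fun x => ?_⟩
  let f : V ≃o Fin m := ⟨e, fun {a b} => (he a b).symm⟩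
  let f' : V ≃o Fin m := ⟨e', fun {a b} => (he' a b).symm⟩
  have : f = f' := Subsingleton.elim _ _
  exact congrArg (fun g : V ≃o Fin m => (g x : ℕ)) this

/-- The algorithm. -/
noncomputable def edgeColoringRun (k : ℕ) [Finite V] (I : Input (multigraphSignature p) s V)
    (x : V) : HF :=
  let e := (exists_increasing_equiv I.order).choose
  Encodable.encode (vertexLabel k p s (Nat.card V) (inputEdge I e) (inputPart I e) (e x))

theorem edgeColoringRun_eq (k : ℕ) [Finite V] (I : Input (multigraphSignature p) s V) {m : ℕ}
    (e : V ≃ Fin m) (he : ∀ x y, I.order.le x y ↔ e x ≤ e y) (x : V) :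
    edgeColoringRun k I x =
      Encodable.encode (vertexLabel k p s m (inputEdge I e) (inputPart I e) (e x)) := by
  have h := (exists_increasing_equiv I.order).choose_spec
  obtain ⟨hm, hx⟩ := increasing_equiv_unique _ e h he
  subst hm
  have : (exists_increasing_equiv I.order).choose = e := Equiv.ext fun x => Fin.ext (hx x)
  rw [edgeColoringRun, this]

/-- The ASI algorithm for edge coloring. -/
noncomputable def edgeColoringAlgorithm (k p s : ℕ) :
    ASI.Algorithm.{u} (multigraphSignature p) s where
  run I x := edgeColoringRun k I x
  run_iso := by
    intro V V' _ _ I I' φ x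
    obtain ⟨e', he'⟩ := exists_increasing_equiv I'.order
    have he : ∀ x y, I.order.le x y ↔ φ.toEquiv.trans e' x ≤ φ.toEquiv.trans e' y :=
      fun x y => (φ.le_iff x y).trans (he' _ _)
    rw [edgeColoringRun_eq k I _ he, edgeColoringRun_eq k I' e' he']
    have hrel : ∀ (i : Fin p) (x y : V), I.graph.rel i ![x, y] ↔
        I'.graph.rel i ![φ.toEquiv x, φ.toEquiv y] := fun i x y =>
      (φ.rel_iff i ![x, y]).trans (iff_of_eq (congrArg (I'.graph.rel i) (by
        funext c
        change Fin 2 at c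
        fin_cases c <;> rfl)))
    have h1 : inputEdge I (φ.toEquiv.trans e') = inputEdge I' e' := by
      funext a b j
      refine propext (and_congr_right fun _ => ⟨?_, ?_⟩)
      · rintro ⟨x, y, hxy, ⟨i, hi, hr⟩, ha, hb⟩
        refine ⟨φ.toEquiv x, φ.toEquiv y, (φ.adj_iff x y).1 hxy, ⟨i, hi, (hrel i x y).1 hr⟩,
          ha, hb⟩
      · rintro ⟨x', y', hxy, ⟨i, hi, hr⟩, ha, hb⟩
        obtain ⟨x, rfl⟩ := φ.toEquiv.surjective x'
        obtain ⟨y, rfl⟩ := φ.toEquiv.surjective y'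
        refine ⟨x, y, (φ.adj_iff x y).2 hxy, ⟨i, hi, (hrel i x y).2 hr⟩, ha, hb⟩
    have h2 : inputPart I (φ.toEquiv.trans e') = inputPart I' e' := by
      funext a
      unfold inputPart
      split_ifs with h
      · rw [φ.part_eq]
        simp
      · rfl
    rw [h1, h2]
    rfl

theorem edgeColoringAlgorithm_run (k : ℕ) [Finite V] (I : Input (multigraphSignature p) s V)
    (x : I.target) : (edgeColoringAlgorithm k p s).run I x = edgeColoringRun k I x := rfl

end Run

/-! ### Correctness of the algorithm -/

section Solves

variable {k p s : ℕ} {V : Type u} {G : StructuredGraph (multigraphSignature p) V}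

/-- The label at `x` is computed from a numbering of the window around `x`. -/
theorem exists_numbering {M : Multigraph V} (hM : Represents G M) (hG : G.LocFinite)
    (ord : LinearOrder V) (part : V → Fin (s + 1)) {r n : ℕ} (hU : IsWitness G.graph part r)
    (x : V) :
    let W := window G.graph part r n ((pieceGraph G.graph part r).connectedComponentMk x)
    ∃ (m : ℕ) (φ : V → ℕ) (ψ : ℕ → V) (E' : ℕ → ℕ → ℕ → Prop) (pt' : ℕ → ℕ),
      VertexNumbering W m φ ψ ∧
      (∀ a ∈ W, ∀ b ∈ W, ∀ j, j < M.mult a b ↔ E' (φ a) (φ b) j) ∧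
      (∀ a ∈ W, (part a : ℕ) = pt' (φ a)) ∧
      label ((edgeColoringAlgorithm k p s).apply n r G hG ord part hU x) =
        vertexLabel k p s m E' pt' (φ x) := by
  classical
  intro W
  set C : Piece G.graph part r := (pieceGraph G.graph part r).connectedComponentMk x
  have hfin : Finite W := finite_window G.graph hG part r n hU C
  have hxW : x ∈ W := by simp [W, window]
  obtain ⟨m, e, he⟩ : ∃ m, ∃ e : W ≃ Fin m,
      ∀ x y, (localInput G ord part r n C).order.le x y ↔ e x ≤ e y :=
    ⟨_, exists_increasing_equiv _⟩
  let φ : V → ℕ := fun a => if h : a ∈ W then (e ⟨a, h⟩ : ℕ) else 0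
  let ψ : ℕ → V := fun t => if h : t < m then (e.symm ⟨t, h⟩ : V) else x
  have hφ : ∀ a (h : a ∈ W), φ a = e ⟨a, h⟩ := fun a h => dif_pos h
  have hψ : ∀ t (h : t < m), ψ t = e.symm ⟨t, h⟩ := fun a h => dif_pos h
  refine ⟨m, φ, ψ, inputEdge (localInput G ord part r n C) e,
    inputPart (localInput G ord part r n C) e, ?_, ?_, ?_, ?_⟩
  · refine ⟨fun a ha => ?_, fun t ht => ?_, fun a ha => ?_, fun t ht => ?_, fun a ha b hb hab => ?_⟩
    · rw [hφ a ha]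
      exact (e _).2
    · rw [hψ t ht]
      exact (e.symm _).2
    · rw [hφ a ha, hψ _ (e _).2]
      simp
    · rw [hψ t ht, hφ _ (e.symm _).2]
      simp
    · rw [hφ a ha, hφ b hb]
      by_contra hlt
      have h1 : e ⟨b, hb⟩ ≤ e ⟨a, ha⟩ := Fin.le_def.2 (not_lt.1 hlt)
      have h2 : b ≤ a := (he ⟨b, hb⟩ ⟨a, ha⟩).2 h1
      exact absurd hab (not_lt.2 h2)
  · intro a ha b hb j
    rw [hφ a ha, hφ b hb]
    constructor
    · intro hj
      have hjp : j < p := hj.trans_le (hM.mult_le a b)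
      have hadj : G.graph.Adj a b := (hM.adj_iff a b).2 (Nat.zero_lt_of_lt hj)
      refine ⟨hjp, ⟨a, ha⟩, ⟨b, hb⟩, hadj, ⟨⟨j, hjp⟩, rfl, ?_⟩, rfl, rfl⟩
      exact ((hM.induce W).rel_iff ⟨j, hjp⟩ ![⟨a, ha⟩, ⟨b, hb⟩] hadj).2 hj
    · rintro ⟨hjp, a', b', hadj, ⟨i, rfl, hr⟩, h1, h2⟩
      have h1' : a' = ⟨a, ha⟩ := e.injective (Fin.ext h1)
      have h2' : b' = ⟨b, hb⟩ := e.injective (Fin.ext h2)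
      subst h1' h2'
      exact ((hM.induce W).rel_iff i ![⟨a, ha⟩, ⟨b, hb⟩] hadj).1 hr
  · intro a ha
    rw [hφ a ha, inputPart, dif_pos (e _).2]
    simp [localInput]
  · have h1 : (edgeColoringAlgorithm k p s).apply n r G hG ord part hU x =
        edgeColoringRun k (localInput G ord part r n C) ⟨x, hxW⟩ := rfl
    rw [h1, edgeColoringRun_eq k _ e he, label, Denumerable.ofNat_encode, hφ x hxW]

theorem zoneWidth_antitone {k p s i i' : ℕ} (h : i ≤ i') :
    zoneWidth k p s i' ≤ zoneWidth k p s i :=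
  Nat.mul_le_mul_right _ (by omega)

/-- The edges at `x` get their colors from the window of `x`, so properness at `x` is a matter of a
single window. Different windows have to be compared only for the symmetry of the coloring and for
the names of neighbors, and then they belong to adjacent vertices. -/
theorem edgeColoringAlgorithm_solves (k p s : ℕ) :
    (edgeColoringAlgorithm.{u} k p s).Solves (edgeColoringProblem.{u} k p (k + p * s)) (2 * s + 4)
      (2 * zoneWidth k p s 0 + 2) := by
  rintro V G hG ord part hU ⟨M, hM, χ₀, hχ₀⟩
  set r := 2 * zoneWidth k p s 0 + 2 with hr
  set n := 2 * s + 4 with hn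
  let W : V → Set V := fun x =>
    window G.graph part r n ((pieceGraph G.graph part r).connectedComponentMk x)
  have hWfin : ∀ x, (W x).Finite := fun x => finite_window G.graph hG part r n hU _
  choose m φ ψ E' pt' hnum hE' hpt' hlabel using
    fun x => exists_numbering (k := k) (n := n) (r := r) hM hG ord part hU x
  let E : V → V → ℕ → Prop := fun a b j => j < M.mult a b
  have hE : ∀ x y, G.graph.Adj x y ↔ ∃ j < p, E x y j := by
    intro x y
    rw [hM.adj_iff]
    have := hM.mult_le x y
    exact ⟨fun h => ⟨0, by omega, h⟩, fun ⟨j, _, h⟩ => Nat.zero_lt_of_lt h⟩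
  have hsymm : ∀ x y j, E x y j → E y x j := by
    intro x y j h
    change j < _
    rw [M.symm]
    exact h
  have hloop : ∀ x j, ¬ E x x j := by
    intro x j h
    have : j < M.mult x x := h
    rw [M.loopless] at this
    exact absurd this (Nat.not_lt_zero j)
  have hproper : ∀ x, IsProperOn (W x) E p k χ₀ := by
    intro x a _ b _ j _ hab _ _
    refine ⟨hχ₀.lt a b j hab, hχ₀.symm a b j hab, fun h => absurd h id, ?_⟩
    intro b' _ j' _ hab' _ heq
    by_contra hne
    exact hχ₀.proper a b j b' j' hab hab' (fun h => hne (by simpa using h)) heq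
  let col : V → ℕ → V → V → ℕ → ℕ := fun x i =>
    windowColor k p s (m x) (E' x) (pt' x) (φ x) i
  let nam : V → V → V → ℕ → ℕ := fun x => windowNames k p s (m x) (E' x) (pt' x) (φ x)
  have hcol : ∀ x, ∀ i ≤ s, IsLeastColoring (W x) p (digitBase k p s)
      (StageSpec k p s (W x) E (fun a => (part a : ℕ)) i (col x i)) (col x (i + 1)) :=
    fun x i hi => (hnum x).isLeast_windowColor (hE' x) (hpt' x) hsymm hloop (hproper x) hi
  have hnam : 0 < p → ∀ x, IsLeastColoring (W x) p (digitBase k p s)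
      (NameValid (W x) E p (fun a => (part a : ℕ)) (k * k + 1)) (nam x) :=
    fun hp x => (hnum x).isLeast_windowNames hp (hE' x) (hpt' x) hsymm (hproper x)
  -- `stage_eq` with `ρ = 0` needs depth 3, and each later stage needs two layers more, whence `2 *
  -- i + 3`.
  have hcomp : ∀ x y, ∀ i ≤ s, ∀ a b j, j < p → E a b j →
      Deep G.graph part r (W x ∩ W y) (2 * i + 3) a →
      NearDist G.graph (fun x => (part x : ℕ)) (i + 1) (zoneWidth k p s i) a →
      NearDist G.graph (fun x => (part x : ℕ)) (i + 1) (zoneWidth k p s i) b →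
      col x (i + 1) a b j = col y (i + 1) a b j := by
    intro x y i
    induction i with
    | zero =>
      intro hi a b j hj he ha hNa hNb
      refine stage_eq (ρ := 0) hE hsymm (hWfin x) le_rfl (hcol x 0 hi) (hcol y 0 hi) ?_ hj he ha
        hNa hNb
      rintro _ _ _ _ _ _ ⟨u, hu, _⟩
      exact absurd hu (Nat.not_lt_zero _)
    | succ i ih =>
      intro hi a b j hj he ha hNa hNb
      have hz : zoneWidth k p s (i + 1) ≤ zoneWidth k p s i := zoneWidth_antitone (Nat.le_succ i)
      have hz0 : zoneWidth k p s (i + 1) ≤ zoneWidth k p s 0 := zoneWidth_antitone (Nat.zero_le _)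
      refine stage_eq (ρ := 2 * i + 2) hE hsymm (hWfin x) (by omega) (hcol x (i + 1) hi)
        (hcol y (i + 1) hi) ?_ hj he ha hNa hNb
      rintro a b j hj he ha ⟨u, hu, hau⟩ ⟨v, hv, hbv⟩
      exact ih (by omega) a b j hj he ha ⟨u, hu, edist_le_mono hau hz⟩ ⟨v, hv, edist_le_mono hbv hz⟩
  have hdeep_self : ∀ x, Deep G.graph part r (W x) n x := fun x => subset_rfl
  -- One of the `2 * s + 4` layers of the window of `y` is spent in passing from `y` to `x`; the
  -- remaining ones are just enough for stage s.
  have hdeep : ∀ x y, G.graph.edist x y ≤ r →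
      Deep G.graph part r (W x ∩ W y) (2 * s + 3) x := by
    intro x y hxy z hz
    exact ⟨(hdeep_self x).mono (by omega) hz, Deep.of_edist (n := 2 * s + 3) (hdeep_self y)
      (edist_symm_le hxy) hz⟩
  have hmem : ∀ x, x ∈ W x := fun x => (hdeep_self x).mem
  have hadj : ∀ {x y j}, j < M.mult x y → G.graph.edist x y ≤ (1 : ℕ) := fun hj =>
    edist_le_one ((hM.adj_iff _ _).2 (Nat.zero_lt_of_lt hj))
  have hadjr : ∀ {x y j}, j < M.mult x y → G.graph.edist x y ≤ r := fun hj =>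
    edist_le_mono (hadj hj) (by omega)
  have hmemadj : ∀ {x y j}, j < M.mult x y → y ∈ W x := fun hj =>
    ((hdeep_self _).of_edist (n := 2 * s + 3) (hadjr hj)).mem
  have hlt : ∀ {x y j}, j < M.mult x y → j < p := fun hj => hj.trans_le (hM.mult_le _ _)
  -- At the last stage every vertex of the window is in the zone, even at the boundary, since all
  -- parts are less than `s + 1`.
  have hnear : ∀ x, ∀ a ∈ W x, Near (W x) E p (fun a => (part a : ℕ)) (s + 1)
      (zoneWidth k p s s) a := by
    intro x a ha
    exact Near.mono (t := 0) (Nat.zero_le _) ⟨ha, (part a).2⟩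
  have hvalid : ∀ {x y j}, j < M.mult x y → _ := fun {x y j} hj =>
    (hcol x s le_rfl).1 x (hmem x) y (hmemadj hj) j (hlt hj) hj (hnear x x (hmem x))
      (hnear x y (hmemadj hj))
  have hcolsymm : ∀ {x y j}, j < M.mult x y → col x (s + 1) x y j = col y (s + 1) x y j := by
    intro x y j hj
    refine hcomp x y s le_rfl x y j (hlt hj) hj (hdeep x y (hadjr hj)) ?_ ?_
    · exact ⟨x, (part x).2, by simp⟩
    · exact ⟨y, (part y).2, by simp⟩
  have hname : ∀ x, (label ((edgeColoringAlgorithm k p s).apply n r G hG ord part hU x)).1 =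
      Nat.pair (part x) (nam x x x 0) := by
    intro x
    rw [hlabel x, hpt' x x (hmem x)]
    rfl
  have hnameeq : ∀ {x y j}, j < M.mult x y → nam y y y 0 = nam x y y 0 := by
    intro x y j hj
    have hp : 0 < p := Nat.zero_lt_of_lt (hlt hj)
    exact name_eq hE (hWfin y) hp (by omega) hsymm (hnam hp y) (hnam hp x)
      ((hdeep y x (edist_symm_le (hadjr hj))).mono (by omega))
  refine ⟨M, hM, fun x y j => col x (s + 1) x y j, ⟨?_, ?_, ?_⟩, ?_, ?_⟩
  · intro x y j hj
    exact (hvalid hj).1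
  · intro x y j hj
    exact (hvalid hj).2.1.trans (hcolsymm (hsymm _ _ _ hj)).symm
  · intro x y j y' j' hj hj' hne heq
    obtain ⟨h1, h2⟩ := (hvalid hj).2.2.2 y' (hmemadj hj') j' (hlt hj') hj'
      (hnear x y' (hmemadj hj')) heq
    exact hne (by rw [h1, h2])
  · intro x y y' hy hy' hne heq
    -- The part is a component of the name, so neighbors in different parts are told apart by it;
    -- the chosen numbers only have to distinguish neighbors in the same part.
    rw [hname, hname, hnameeq hy, hnameeq hy', Nat.pair_eq_pair] at heq
    have hp : 0 < p := hlt hy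
    exact ((hnam hp x).1 y (hmemadj hy)).2 y' (hmemadj hy') hne heq.1
      ⟨x, hmem x, ⟨0, hp, hy⟩, 0, hp, hy'⟩ heq.2
  · intro x b t
    rw [hlabel x, mem_vertexLabel]
    have hvn : ∀ {y j}, j < M.mult x y → vertexName k p s (m x) (E' x) (pt' x) (φ x y) =
        (label ((edgeColoringAlgorithm k p s).apply n r G hG ord part hU y)).1 := by
      intro y j hj
      rw [hname, hnameeq hj, hpt' x y (hmemadj hj)]
      rfl
    constructor
    · rintro ⟨a, ha, j, hj, he, hb, ht⟩
      have hy : ψ x a ∈ W x := (hnum x).mem a ha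
      have hφ : φ x (ψ x a) = a := (hnum x).right_inv a ha
      have he' : j < M.mult x (ψ x a) := by
        rw [hE' x x (hmem x) _ hy, hφ]
        exact he
      refine ⟨ψ x a, j, he', ?_, ?_⟩
      · rw [← hvn he', hφ, hb]
      · simp only [col, windowColor, hφ]
        exact ht
    · rintro ⟨y, j, hj, hb, ht⟩
      refine ⟨φ x y, (hnum x).lt y (hmemadj hj), j, hlt hj,
        (hE' x x (hmem x) y (hmemadj hj) j).1 hj, ?_, ht⟩
      rw [hvn hj, hb]

end Solves

/-! ### The algorithm is primitive recursive in the code of its input -/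

section Computability

theorem PrimrecPred.imp {α : Type*} [Primcodable α] {P Q : α → Prop} (hP : PrimrecPred P)
    (hQ : PrimrecPred Q) : PrimrecPred fun a => P a → Q a :=
  (hP.not.or hQ).of_eq fun _ => by tauto

theorem PrimrecPred.forall_lt_of {α : Type*} [Primcodable α] {f : α → ℕ} {P : α → ℕ → Prop}
    (hf : Primrec f) (hP : PrimrecPred fun q : α × ℕ => P q.1 q.2) :
    PrimrecPred fun a => ∀ x < f a, P a x := by
  have hR : PrimrecRel fun (x : ℕ) (a : α) => P a x :=
    hP.comp (Primrec.pair Primrec.snd Primrec.fst)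
  exact (hR.forall_mem_list.comp (Primrec.list_range.comp hf) Primrec.id).of_eq fun a => by simp

theorem PrimrecPred.exists_lt_of {α : Type*} [Primcodable α] {f : α → ℕ} {P : α → ℕ → Prop}
    (hf : Primrec f) (hP : PrimrecPred fun q : α × ℕ => P q.1 q.2) :
    PrimrecPred fun a => ∃ x < f a, P a x := by
  have hR : PrimrecRel fun (x : ℕ) (a : α) => P a x :=
    hP.comp (Primrec.pair Primrec.snd Primrec.fst)
  exact (hR.exists_mem_list.comp (Primrec.list_range.comp hf) Primrec.id).of_eq fun a => by simp

theorem PrimrecPred.mem_list {α β : Type*} [Primcodable α] [Primcodable β] {f : α → β}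
    {l : α → List β} (hf : Primrec f) (hl : Primrec l) : PrimrecPred fun a => f a ∈ l a :=
  ((Primrec.eq (α := β)).exists_mem_list.comp hl hf).of_eq fun a => by simp

theorem Primrec.nat_pow : Primrec₂ ((· ^ ·) : ℕ → ℕ → ℕ) :=
  Primrec₂.unpaired'.1 Nat.Primrec.pow

theorem Primrec.leastBelow {α : Type*} [Primcodable α] {N : α → ℕ} {P : α → ℕ → Prop}
    (hN : Primrec N) (hP : PrimrecPred fun q : α × ℕ => P q.1 q.2) :
    Primrec fun a => leastBelow (N a) (P a) := by
  classical
  have h : Primrec₂ fun (a : α) (w : ℕ) => decide (P a w) := hP.decide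
  refine (Primrec.list_findIdx (Primrec.list_range.comp hN) h).of_eq fun a => ?_
  unfold _root_.leastBelow
  congr

/-- The edges of the input with a given code. -/
def codeEdge (p : ℕ) (code : Code) (a b j : ℕ) : Prop :=
  j < p ∧ (a, b) ∈ code.2.1 ∧ (j, [a, b]) ∈ code.2.2.1

/-- The parts of the vertices of the input with a given code. -/
def codePart (code : Code) (a : ℕ) : ℕ := code.2.2.2.1.getD a 0

variable {α : Type} [Primcodable α] {cd : α → Code} {w prev x y j : α → ℕ} {k p s : ℕ}

theorem codeEdge_primrec (hcd : Primrec cd) (hx : Primrec x) (hy : Primrec y) (hj : Primrec j) :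
    PrimrecPred fun a => codeEdge p (cd a) (x a) (y a) (j a) := by
  refine (Primrec.nat_lt.comp hj (Primrec.const p)).and
    ((PrimrecPred.mem_list (hx.pair hy) ?_).and (PrimrecPred.mem_list (hj.pair ?_) ?_))
  · exact Primrec.fst.comp (Primrec.snd.comp hcd)
  · exact Primrec.list_cons.comp hx (Primrec.list_cons.comp hy (Primrec.const []))
  · exact Primrec.fst.comp (Primrec.snd.comp (Primrec.snd.comp hcd))

theorem codePart_primrec (hcd : Primrec cd) (hx : Primrec x) :
    Primrec fun a => codePart (cd a) (x a) :=
  (Primrec.list_getD 0).comp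
    (Primrec.fst.comp (Primrec.snd.comp (Primrec.snd.comp (Primrec.snd.comp hcd)))) hx

/-- The radius is a constant, so the recursion that defines `Near` is unfolded by an induction
outside the primitive recursive function. The same is done for the number of stages in
`stageCode_primrec`. -/
theorem near_primrec (hcd : Primrec cd) (hx : Primrec x) (i t : ℕ) :
    PrimrecPred fun a => Near (Set.Iio (cd a).1) (codeEdge p (cd a)) p (codePart (cd a)) i t
      (x a) := by
  have h : PrimrecPred fun q : Code × ℕ => Near (Set.Iio q.1.1) (codeEdge p q.1) p
      (codePart q.1) i t q.2 := by
    induction t with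
    | zero =>
      exact (Primrec.nat_lt.comp Primrec.snd (Primrec.fst.comp Primrec.fst)).and
        (Primrec.nat_lt.comp (codePart_primrec Primrec.fst Primrec.snd) (Primrec.const i))
    | succ t ih =>
      refine ih.or ((Primrec.nat_lt.comp Primrec.snd (Primrec.fst.comp Primrec.fst)).and ?_)
      refine PrimrecPred.exists_lt_of (Primrec.fst.comp Primrec.fst) (.and ?_ ?_)
      · refine PrimrecPred.exists_lt_of (Primrec.const p) ?_
        exact codeEdge_primrec (Primrec.fst.comp (Primrec.fst.comp Primrec.fst))
          (Primrec.snd.comp (Primrec.fst.comp Primrec.fst)) (Primrec.snd.comp Primrec.fst)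
          Primrec.snd
      · exact ih.comp ((Primrec.fst.comp Primrec.fst).pair Primrec.snd)
  exact h.comp (hcd.pair hx)

theorem digitColor_primrec (B : ℕ) (hcd : Primrec cd) (hw : Primrec w) (hx : Primrec x)
    (hy : Primrec y) (hj : Primrec j) :
    Primrec fun a => digitColor (cd a).1 p B (w a) (x a) (y a) (j a) := by
  have hm : Primrec fun a => (cd a).1 := Primrec.fst.comp hcd
  have hidx : Primrec fun a => (x a * (cd a).1 + y a) * p + j a :=
    Primrec.nat_add.comp (Primrec.nat_mul.comp (Primrec.nat_add.comp (Primrec.nat_mul.comp hx hm)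
      hy) (Primrec.const p)) hj
  exact Primrec.nat_mod.comp (Primrec.nat_div.comp hw
    (Primrec.nat_pow.comp (Primrec.const B) hidx)) (Primrec.const B)

theorem stageSpec_primrec (hcd : Primrec cd) (hprev : Primrec prev) (hw : Primrec w) (i : ℕ) :
    PrimrecPred fun a => StageSpec k p s (Set.Iio (cd a).1) (codeEdge p (cd a)) (codePart (cd a)) i
      (digitColor (cd a).1 p (digitBase k p s) (prev a))
      (digitColor (cd a).1 p (digitBase k p s) (w a)) := by
  have hm : Primrec fun a => (cd a).1 := Primrec.fst.comp hcd
  have p1 : Primrec fun q : ((α × ℕ) × ℕ) × ℕ => q.1.1.1 :=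
    Primrec.fst.comp (Primrec.fst.comp Primrec.fst)
  have hx : Primrec fun q : ((α × ℕ) × ℕ) × ℕ => q.1.1.2 :=
    Primrec.snd.comp (Primrec.fst.comp Primrec.fst)
  have hy : Primrec fun q : ((α × ℕ) × ℕ) × ℕ => q.1.2 := Primrec.snd.comp Primrec.fst
  have hj : Primrec fun q : ((α × ℕ) × ℕ) × ℕ => q.2 := Primrec.snd
  have p2 : Primrec fun q : ((((α × ℕ) × ℕ) × ℕ) × ℕ) × ℕ => q.1.1 := Primrec.fst.comp Primrec.fst
  have hy' : Primrec fun q : ((((α × ℕ) × ℕ) × ℕ) × ℕ) × ℕ => q.1.2 := Primrec.snd.comp Primrec.fst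
  have hj' : Primrec fun q : ((((α × ℕ) × ℕ) × ℕ) × ℕ) × ℕ => q.2 := Primrec.snd
  unfold StageSpec StageValid
  refine PrimrecPred.forall_lt_of hm (PrimrecPred.forall_lt_of (hm.comp Primrec.fst)
    (PrimrecPred.forall_lt_of (Primrec.const p) ?_))
  refine (codeEdge_primrec (hcd.comp p1) hx hy hj).imp ((near_primrec (hcd.comp p1) hx _ _).imp
    ((near_primrec (hcd.comp p1) hy _ _).imp ?_))
  have hc := digitColor_primrec (p := p) (digitBase k p s) (hcd.comp p1) (hw.comp p1) hx hy hj
  refine (Primrec.nat_lt.comp hc (Primrec.const _)).and ((Primrec.eq.comp hc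
    (digitColor_primrec _ (hcd.comp p1) (hw.comp p1) hy hx hj)).and (.and ?_ ?_))
  · exact (near_primrec (hcd.comp p1) hx _ _).imp ((near_primrec (hcd.comp p1) hy _ _).imp
      (Primrec.eq.comp hc (digitColor_primrec _ (hcd.comp p1) (hprev.comp p1) hx hy hj)))
  · refine PrimrecPred.forall_lt_of (hm.comp p1) (PrimrecPred.forall_lt_of (Primrec.const p) ?_)
    exact (codeEdge_primrec (hcd.comp (p1.comp p2)) (hx.comp p2) hy' hj').imp
      ((near_primrec (hcd.comp (p1.comp p2)) hy' _ _).imp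
      ((Primrec.eq.comp (hc.comp p2) (digitColor_primrec _ (hcd.comp (p1.comp p2))
        (hw.comp (p1.comp p2)) (hx.comp p2) hy' hj')).imp
      ((Primrec.eq.comp (hy.comp p2) hy').and (Primrec.eq.comp (hj.comp p2) hj'))))

theorem nameValid_primrec (K : ℕ) (hcd : Primrec cd) (hw : Primrec w) :
    PrimrecPred fun a => NameValid (Set.Iio (cd a).1) (codeEdge p (cd a)) p (codePart (cd a)) K
      (digitColor (cd a).1 p (digitBase k p s) (w a)) := by
  have hm : Primrec fun a => (cd a).1 := Primrec.fst.comp hcd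
  have p1 : Primrec fun q : (α × ℕ) × ℕ => q.1.1 := Primrec.fst.comp Primrec.fst
  have hx : Primrec fun q : (α × ℕ) × ℕ => q.1.2 := Primrec.snd.comp Primrec.fst
  have hy : Primrec fun q : (α × ℕ) × ℕ => q.2 := Primrec.snd
  have p2 : Primrec fun q : (((α × ℕ) × ℕ) × ℕ) × ℕ => q.1.1 := Primrec.fst.comp Primrec.fst
  have hz : Primrec fun q : (((α × ℕ) × ℕ) × ℕ) × ℕ => q.1.2 := Primrec.snd.comp Primrec.fst
  have hj : Primrec fun q : (((α × ℕ) × ℕ) × ℕ) × ℕ => q.2 := Primrec.snd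
  unfold NameValid
  refine PrimrecPred.forall_lt_of hm (.and ?_ (PrimrecPred.forall_lt_of (hm.comp Primrec.fst) ?_))
  · exact Primrec.nat_lt.comp (digitColor_primrec _ (hcd.comp Primrec.fst) (hw.comp Primrec.fst)
      Primrec.snd Primrec.snd (Primrec.const 0)) (Primrec.const K)
  · refine (Primrec.eq.comp hx hy).not.imp ((Primrec.eq.comp (codePart_primrec (hcd.comp p1) hx)
      (codePart_primrec (hcd.comp p1) hy)).imp (.imp ?_ ?_))
    · refine PrimrecPred.exists_lt_of (hm.comp p1) (.and ?_ ?_)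
      · exact PrimrecPred.exists_lt_of (Primrec.const p)
          (codeEdge_primrec (hcd.comp (p1.comp p2)) hz (hx.comp p2) hj)
      · exact PrimrecPred.exists_lt_of (Primrec.const p)
          (codeEdge_primrec (hcd.comp (p1.comp p2)) hz (hy.comp p2) hj)
    · exact (Primrec.eq.comp
        (digitColor_primrec _ (hcd.comp p1) (hw.comp p1) hx hx (Primrec.const 0))
        (digitColor_primrec _ (hcd.comp p1) (hw.comp p1) hy hy (Primrec.const 0))).not

theorem codeBound_primrec : Primrec fun code : Code => digitBase k p s ^ (code.1 * code.1 * p) :=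
  Primrec.nat_pow.comp (Primrec.const _) (Primrec.nat_mul.comp
    (Primrec.nat_mul.comp Primrec.fst Primrec.fst) (Primrec.const p))

theorem stageCode_primrec (i : ℕ) : Primrec fun code : Code =>
    stageCode k p s code.1 (codeEdge p code) (codePart code) i := by
  induction i with
  | zero => exact Primrec.const 0
  | succ i ih =>
    exact Primrec.leastBelow codeBound_primrec
      (stageSpec_primrec Primrec.fst (ih.comp Primrec.fst) Primrec.snd i)

theorem nameCode_primrec : Primrec fun code : Code =>
    nameCode k p s code.1 (codeEdge p code) (codePart code) :=
  Primrec.leastBelow codeBound_primrec (nameValid_primrec _ Primrec.fst Primrec.snd)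

theorem vertexName_primrec (hcd : Primrec cd) (hx : Primrec x) : Primrec fun a =>
    vertexName k p s (cd a).1 (codeEdge p (cd a)) (codePart (cd a)) (x a) :=
  Primrec₂.natPair.comp (codePart_primrec hcd hx)
    (digitColor_primrec _ hcd (nameCode_primrec.comp hcd) hx hx (Primrec.const 0))

theorem vertexLabel_primrec : Primrec fun q : Code × ℕ =>
    vertexLabel k p s q.1.1 (codeEdge p q.1) (codePart q.1) q.2 := by
  classical
  refine Primrec.pair (vertexName_primrec Primrec.fst Primrec.snd) ?_
  have p1 : Primrec fun q : ((Code × ℕ) × ℕ) × ℕ => q.1.1.1 :=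
    Primrec.fst.comp (Primrec.fst.comp Primrec.fst)
  have hx : Primrec fun q : ((Code × ℕ) × ℕ) × ℕ => q.1.1.2 :=
    Primrec.snd.comp (Primrec.fst.comp Primrec.fst)
  have hy : Primrec fun q : ((Code × ℕ) × ℕ) × ℕ => q.1.2 := Primrec.snd.comp Primrec.fst
  have hj : Primrec fun q : ((Code × ℕ) × ℕ) × ℕ => q.2 := Primrec.snd
  refine Primrec.list_flatMap (Primrec.list_range.comp (Primrec.fst.comp Primrec.fst)) ?_
  refine Primrec.list_flatMap (Primrec.const (List.range p)) ?_
  refine Primrec.ite (codeEdge_primrec p1 hx hy hj) (Primrec.list_cons.comp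
    ((vertexName_primrec p1 hy).pair ?_) (Primrec.const [])) (Primrec.const [])
  exact digitColor_primrec _ p1 ((stageCode_primrec _).comp p1) hx hy hj

variable {V : Type u} {m : ℕ}

/-- Presentations of the same input can differ in the order and the repetitions of their lists. Only
membership is used, and it is determined by the input. -/
theorem codeEdge_eq {I : Input (multigraphSignature p) s V} {e : V ≃ Fin m} {code : Code}
    (h : Presents I e code) : codeEdge p code = inputEdge I e := by
  funext a b j
  refine propext (and_congr_right fun hj => ?_)
  rw [h.adj, h.rel]
  constructor
  · rintro ⟨⟨x, y, hxy, ha, hb⟩, i, t, hr, hi, ht⟩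
    change Fin 2 → V at t
    refine ⟨x, y, hxy, ⟨i, hi, ?_⟩, ha, hb⟩
    have ht' : [(e (t 0) : ℕ), (e (t 1) : ℕ)] = [a, b] := ht
    simp only [List.cons.injEq, and_true] at ht'
    have h0 : t 0 = x := e.injective (Fin.ext (ht'.1.trans ha.symm))
    have h1 : t 1 = y := e.injective (Fin.ext (ht'.2.trans hb.symm))
    have : t = ![x, y] := by
      funext c
      fin_cases c
      · exact h0
      · exact h1
    rw [← this]
    exact hr
  · rintro ⟨x, y, hxy, ⟨i, hi, hr⟩, ha, hb⟩
    refine ⟨⟨x, y, hxy, ha, hb⟩, i, ![x, y], hr, hi, ?_⟩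
    change [(e x : ℕ), (e y : ℕ)] = [a, b]
    rw [ha, hb]

/-- Beyond the last vertex both sides have the default value 0, so they are equal as functions and
can be substituted for each other. -/
theorem codePart_eq {I : Input (multigraphSignature p) s V} {e : V ≃ Fin m} {code : Code}
    (h : Presents I e code) : codePart code = inputPart I e := by
  funext a
  rw [codePart, h.part, inputPart]
  split_ifs with ha
  · rw [List.getD_eq_getElem _ _ (by simpa using ha)]
    simp
  · rw [List.getD_eq_default _ _ (by simpa using ha)]

theorem edgeColoringAlgorithm_isComputable (k p s : ℕ) :
    (edgeColoringAlgorithm.{u} k p s).IsComputable := by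
  refine ⟨fun code x => Encodable.encode
    (vertexLabel k p s code.1 (codeEdge p code) (codePart code) x), ?_, ?_⟩
  · exact (Primrec.encode.comp vertexLabel_primrec).to_comp
  · intro V _ I m e he code hcode x
    rw [edgeColoringAlgorithm_run, edgeColoringRun_eq k I e he]
    beta_reduce
    rw [codeEdge_eq hcode, codePart_eq hcode, hcode.card]

end Computability

theorem mainTheorem1 (k p s : ℕ) :
    ASI.MemASIc.{u} s (ASI.edgeColoringProblem.{u} k p (k + p * s)) :=
  ⟨edgeColoringAlgorithm k p s, edgeColoringAlgorithm_isComputable k p s, _, _,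
    edgeColoringAlgorithm_solves k p s⟩
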